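/- Let $(X,d)$ be a nonempty compact metric space, $\mathcal W$ a finite alphabet, $a>0$, $\lambda\in(0,1)$, $\alpha\in(0,1]$. For $i\in\mathcal W$ let $g_i:X\to X$ be continuous, surjective and $(a,\lambda)$-Ruelle expanding: if $d(x,y)<a$ and $g_i(\tilde x)=x$, there is a unique $\tilde y$ with $g_i(\tilde y)=y$ and $d(\tilde x,\tilde y)<a$, and it satisfies $d(\tilde x,\tilde y)\le\lambda d(x,y)$. Let $\varphi:X\to\mathbb R$ be $\alpha$-Hölder with Hölder coefficient $D_\alpha(\varphi)$. For a finite word $w=i_1\dots i_n$ put $T_w=g_{i_n}\circ\dots\circ g_{i_1}$ and $\varphi_w=\varphi+\varphi\circ T_{i_1}+\dots+\varphi\circ T_{i_1\dots i_{n-1}}$. Assume joint topological mixing: for all nonempty open $U,V\subset X$ there is $m$ with $T_w^{-1}(U)\cap V\ne\emptyset$ for all words $w$ with $|w|\ge m$. **Measures.** Let $L_w(f)(x)=\sum_{T_w(y)=x}e^{\varphi_w(y)}f(y)$ and $\mathbb P_u^v(f)=L_v(f\,L_u(\mathbf 1))/L_{uv}(\mathbf 1)$. For a left-infinite word $\sigma=\dots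 j_2j_1$ and a right-infinite word $\omega=i_1i_2\dots$ let $\mu_{\sigma,\omega}$ be the weak$^*$ limit of $(\mathbb P_{j_k\dots j_1}^{i_1\dots i_l})^*\nu$ as $k,l\to\infty$, which exists for every Borel probability measure $\nu$ and does not depend on $\nu$. Let $\mathbb G$ be the semigroup of pairs generated by the $(g_i,\varphi)$, $i \in \mathcal W$, under $(g,\psi)*(h,\chi)=(g\circ h,\ \chi+\psi\circ h)$; it consists of the pairs $(T_w,\varphi_w)$ with $w$ a nonempty finite word. The equilibrium state of $(g,\psi)=(T_w,\varphi_w)\in\mathbb G$ is $\mu_{g,\psi}:=\mu_{\dots ww,\,ww\dots}$, which depends only on $(g,\psi)$. **Distances.** For finite words $v\neq w$ let $$d_{\mathcal W^*}(v,w)=2^{-\min\{k\ge 1:\ v_k\ne w_k\text{ or }k>\min(|v|,|w|)\}}+2^{-\min\{k\ge 1:\ v_{|v|+1-k}\ne w_{|w|+1-k}\text{ or }k>\min(|v|,|w|)\}},$$ and $d_{\mathcal W^*}(w,w)=0$. Let $\Delta=\max\{4D_\alpha(\varphi)/(1-\lambda^\alpha),\,a^{-\alpha}\}$, $d^*(x,y)=\min\{1,\Delta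 d(x,y)^\alpha\}$, and let $\overline W(\mu,\nu)$ be the Wasserstein distance for the cost $d^*$, i.e. the infimum of $\int d^*\,dP$ over all couplings $P$ of $\mu$ and $\nu$. Let $$\kappa(g)=\lim_{\varepsilon\to0}\inf\{d(g(x),g(y))/d(x,y):\ 0<d(x,y)<\varepsilon\}$$ and assume that $\kappa(g)<\infty$ for every $(g,\psi)\in\mathbb G$. Put $$d_{\mathbb G}((g,\psi),(h,\chi))=\overline W(\mu_{g,\psi},\mu_{h,\chi})+1/\kappa(g)+1/\kappa(h)$$ if $(g,\psi)\ne(h,\chi)$, and $d_{\mathbb G}=0$ otherwise. **Claim.** The measures $\mu_{\sigma,\omega}$ and $\mu_{g,\psi}$ are well defined as stated, and the following holds. 1. The set of finite words with $d_{\mathcal W^*}$ and $\mathbb G$ with $d_{\mathbb G}$ are discrete metric spaces. 2. The map $w\mapsto(T_w,\varphi_w)$ from the nonempty finite words to $\mathbb G$ is Hölder continuous, with an exponent in $(0,1]$. 3. A sequence $((g_n,\psi_n))_n$ in $\mathbb G$ is Cauchy if and only if it is eventually constant, or $\kappa(g_n)\to\infty$ and $(\mu_{g_n,\psi_n})_n$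 converges in the weak$^*$ topology. Two Cauchy sequences that are not eventually constant have the same limit in the completion of $\mathbb G$ if and only if their sequences of equilibrium states have the same weak$^*$ limit. 4. Let $\partial\mathbb G$ be the complement of $\mathbb G$ in its completion. The map $$\partial\mathbb G\to\{\mu_{\sigma,\omega}:\sigma\text{ left-infinite},\ \omega\text{ right-infinite}\},$$ which sends the limit of a sequence $((g_n,\psi_n))_n$ in $\mathbb G$ to the weak$^*$ limit of $(\mu_{g_n,\psi_n})_n$, is well defined, onto, and Lipschitz continuous with respect to the metric of the completion and $\overline W$. -/

import Mathlib

open MeasureTheory Filter Topology Set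
open scoped ENNReal NNReal

noncomputable section

namespace RuelleBoundary

/-! ## Expanding maps, words and transfer operators -/

/-- `(a, lam)`-Ruelle-expanding maps. -/
def IsRuelleExpanding {X : Type*} [MetricSpace X] (a lam : ℝ) (T : X → X) : Prop :=
  ∀ x y x' : X, dist x y < a → T x' = x →
    ∃ y' : X, (T y' = y ∧ dist x' y' < a) ∧ (∀ z : X, T z = y ∧ dist x' z < a → z = y') ∧
      dist x' y' ≤ lam * dist x y

/-- `T_w = T_{i_n} ∘ ⋯ ∘ T_{i_1}` for the word `w = i_1 … i_n`. -/
def wordMap {X W : Type*} (g : W → X → X) : List W → X → X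
  | [], x => x
  | i :: w, x => wordMap g w (g i x)

/-- `φ_w = φ + φ ∘ T_{i_1} + ⋯ + φ ∘ T_{i_1 … i_{n-1}}` for the word `w = i_1 … i_n`. -/
def wordPot {X W : Type*} (g : W → X → X) (φ : X → ℝ) : List W → X → ℝ
  | [], _ => 0
  | i :: w, x => φ x + wordPot g φ w (g i x)

/-- Joint topological mixing of the semigroup generated by the maps `g i`. -/
def JointlyMixing {X W : Type*} [TopologicalSpace X] (g : W → X → X) : Prop :=
  ∀ U V : Set X, IsOpen U → U.Nonempty → IsOpen V → V.Nonempty →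
    ∃ m : ℕ, ∀ w : List W, m ≤ w.length → (wordMap g w ⁻¹' U ∩ V).Nonempty

/-- The Ruelle operator `L_w(f)(x) = ∑_{T_w(y) = x} exp(φ_w(y)) f(y)`. -/
def ruelleOp {X W : Type*} (g : W → X → X) (φ : X → ℝ) (w : List W) (f : X → ℝ) (x : X) : ℝ :=
  ∑' y : {y : X // wordMap g w y = x}, Real.exp (wordPot g φ w y) * f y

/-- The quotient operator `P_u^v(f) = L_v(f · L_u(1)) / L_{uv}(1)`. -/
def quotientOp {X W : Type*} (g : W → X → X) (φ : X → ℝ) (u v : List W) (f : X → ℝ) (x : X) : ℝ :=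
  ruelleOp g φ v (fun y => f y * ruelleOp g φ u (fun _ => 1) y) x /
    ruelleOp g φ (u ++ v) (fun _ => 1) x

/-! ## Infinite words and the measures `μ_{σ,ω}` -/

/-- `[ω]_l = i_1 … i_l` for the right-infinite word `ω = i_1 i_2 …` (with `ω 0 = i_1`). -/
def initialWord {W : Type*} (ω : ℕ → W) (l : ℕ) : List W := (List.range l).map ω

/-- `_k[σ] = i_k … i_1` for the left-infinite word `σ = … i_2 i_1` (with `σ 0 = i_1`). -/
def finalWord {W : Type*} (σ : ℕ → W) (k : ℕ) : List W := ((List.range k).map σ).reverse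

/-- `μ` is the weak-* limit, as `k, l → ∞`, of the measures `(P_{_k[σ]}^{[ω]_l})^* ν`, for every
probability measure `ν`; here `P^* ν` is the measure with `∫ f d(P^* ν) = ∫ P f dν`. -/
def IsTwoSidedLimit {X W : Type*} [MetricSpace X] [MeasurableSpace X] [BorelSpace X]
    (g : W → X → X) (φ : X → ℝ) (σ ω : ℕ → W) (μ : ProbabilityMeasure X) : Prop :=
  ∀ (ν : ProbabilityMeasure X) (f : C(X, ℝ)),
    Tendsto (fun kl : ℕ × ℕ =>
        ∫ x, quotientOp g φ (finalWord σ kl.1) (initialWord ω kl.2) f x ∂(ν : Measure X))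
      (atTop ×ˢ atTop) (𝓝 (∫ x, f x ∂(μ : Measure X)))

instance nonempty_probabilityMeasure {X : Type*} [MeasurableSpace X] [Nonempty X] :
    Nonempty (ProbabilityMeasure X) :=
  ⟨⟨Measure.dirac (Classical.arbitrary X), inferInstance⟩⟩

/-- The measure `μ_{σ,ω}`. -/
def twoSidedState {X W : Type*} [MetricSpace X] [Nonempty X] [MeasurableSpace X] [BorelSpace X]
    (g : W → X → X) (φ : X → ℝ) (σ ω : ℕ → W) : ProbabilityMeasure X :=
  Classical.epsilon (IsTwoSidedLimit g φ σ ω)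

/-- The set of nonempty finite words. -/
abbrev NonemptyWord (W : Type*) : Type _ := {w : List W // w ≠ []}

/-- The right-infinite periodic word `www…`. -/
def rightPeriodic {W : Type*} (w : NonemptyWord W) (n : ℕ) : W :=
  w.1[n % w.1.length]'(Nat.mod_lt _ (List.length_pos_of_ne_nil w.2))

/-- The left-infinite periodic word `…www`. -/
def leftPeriodic {W : Type*} (w : NonemptyWord W) : ℕ → W :=
  rightPeriodic ⟨w.1.reverse, by simpa using w.2⟩

/-! ## The metric on finite words -/

/-- `min {k ≥ 1 : v_k ≠ w_k or k > min (|v|, |w|)}`. -/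
def firstDiff {W : Type*} (v w : List W) : ℕ :=
  sInf {k : ℕ | 1 ≤ k ∧ (v[k - 1]? ≠ w[k - 1]? ∨ min v.length w.length < k)}

open Classical in
/-- The distance on finite words. -/
def wordDist {W : Type*} (v w : List W) : ℝ :=
  if v = w then 0
  else (2 : ℝ)⁻¹ ^ firstDiff v w + (2 : ℝ)⁻¹ ^ firstDiff v.reverse w.reverse

/-! ## The extended semigroup -/

/-- Pairs `(g, ψ)` of a self-map and a potential. -/
@[ext] structure MapPot (X : Type*) where
  map : X → X
  pot : X → ℝ

/-- `(g₁, ψ₁) * (g₂, ψ₂) = (g₁ ∘ g₂, ψ₂ + ψ₁ ∘ g₂)`. -/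
instance {X : Type*} : Semigroup (MapPot X) where
  mul p q := ⟨p.map ∘ q.map, q.pot + p.pot ∘ q.map⟩
  mul_assoc p q r := by
    refine MapPot.ext rfl ?_
    funext x
    exact (add_assoc (r.pot x) (q.pot (r.map x)) (p.pot (q.map (r.map x)))).symm

/-- The semigroup generated by the pairs `(g i, φ)`. -/
def extSemigroup {X W : Type*} (g : W → X → X) (φ : X → ℝ) : Subsemigroup (MapPot X) :=
  Subsemigroup.closure (range fun i => (⟨g i, φ⟩ : MapPot X))

theorem wordMap_append {X W : Type*} (g : W → X → X) (u v : List W) (x : X) :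
    wordMap g (u ++ v) x = wordMap g v (wordMap g u x) := by
  induction u generalizing x with
  | nil => rfl
  | cons i u ih => exact ih _

theorem wordPot_append {X W : Type*} (g : W → X → X) (φ : X → ℝ) (u v : List W) (x : X) :
    wordPot g φ (u ++ v) x = wordPot g φ u x + wordPot g φ v (wordMap g u x) := by
  induction u generalizing x with
  | nil => simp [wordPot, wordMap]
  | cons i u ih => simp [wordPot, wordMap, ih, add_assoc]

theorem wordPair_mem {X W : Type*} (g : W → X → X) (φ : X → ℝ) (w : List W) (hw : w ≠ []) :
    (⟨wordMap g w, wordPot g φ w⟩ : MapPot X) ∈ extSemigroup g φ := by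
  induction w with
  | nil => exact absurd rfl hw
  | cons i w ih =>
    have hi : (⟨g i, φ⟩ : MapPot X) ∈ extSemigroup g φ :=
      Subsemigroup.subset_closure ⟨i, rfl⟩
    by_cases h : w = []
    · subst h
      have e : (⟨wordMap g [i], wordPot g φ [i]⟩ : MapPot X) = ⟨g i, φ⟩ := by
        refine MapPot.ext rfl ?_
        funext x
        exact add_zero _
      rw [e]
      exact hi
    · exact (extSemigroup g φ).mul_mem (ih h) hi

/-- The map `w ↦ (T_w, φ_w)`. -/
def wordPair {X W : Type*} (g : W → X → X) (φ : X → ℝ) (w : NonemptyWord W) : extSemigroup g φ :=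
  ⟨⟨wordMap g w.1, wordPot g φ w.1⟩, wordPair_mem g φ w.1 w.2⟩

theorem wordPair_surjective {X W : Type*} (g : W → X → X) (φ : X → ℝ) :
    Function.Surjective (wordPair g φ) := by
  rintro ⟨p, hp⟩
  suffices h : ∃ w : List W, w ≠ [] ∧ (⟨wordMap g w, wordPot g φ w⟩ : MapPot X) = p by
    obtain ⟨w, hw, h⟩ := h
    exact ⟨⟨w, hw⟩, Subtype.ext h⟩
  induction hp using Subsemigroup.closure_induction with
  | mem p hp =>
    obtain ⟨i, rfl⟩ := hp
    refine ⟨[i], by simp, MapPot.ext rfl ?_⟩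
    funext x
    exact add_zero _
  | mul p q _ _ h1 h2 =>
    obtain ⟨u, hu, rfl⟩ := h1
    obtain ⟨v, -, rfl⟩ := h2
    refine ⟨v ++ u, by simp [hu], MapPot.ext ?_ ?_⟩
    · funext x
      exact wordMap_append g v u x
    · funext x
      exact wordPot_append g φ v u x

/-- The measure `μ_{g,ψ} = μ_{…ww, ww…}`, where `(g, ψ) = (T_w, φ_w)`. -/
def eqState {X W : Type*} [MetricSpace X] [Nonempty X] [MeasurableSpace X] [BorelSpace X]
    (g : W → X → X) (φ : X → ℝ) (p : extSemigroup g φ) : ProbabilityMeasure X :=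
  twoSidedState g φ (leftPeriodic (wordPair_surjective g φ p).choose)
    (rightPeriodic (wordPair_surjective g φ p).choose)

/-- `κ(T) = lim_{ε → 0} inf {d(T x, T y) / d(x, y) : 0 < d(x, y) < ε}`. The infimum increases as
`ε` decreases, so that the limit is a supremum; it may be infinite. -/
def kappa {X : Type*} [MetricSpace X] (T : X → X) : ℝ≥0∞ :=
  ⨆ (ε : ℝ) (_ : 0 < ε), ⨅ (x : X) (y : X) (_ : 0 < dist x y ∧ dist x y < ε),
    edist (T x) (T y) / edist x y

/-! ## The Vaserstein distance and the metric on the extended semigroup -/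

/-- `Δ = max {4 C_φ, a^{-α}}` with `C_φ = D_α(φ) / (1 - lam^α)`, where `D_α(φ)` is the
`α`-Hölder coefficient of `φ`. -/
def deltaConst {X : Type*} [MetricSpace X] (a lam : ℝ) (α : ℝ≥0) (φ : X → ℝ) : ℝ :=
  max (4 * ((nnHolderNorm α φ : ℝ) / (1 - lam ^ (α : ℝ)))) (a ^ (-(α : ℝ)))

/-- `d^*(x, y) = min {1, Δ d(x, y)^α}`. -/
def dStar {X : Type*} [MetricSpace X] (a lam : ℝ) (α : ℝ≥0) (φ : X → ℝ) (x y : X) : ℝ :=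
  min 1 (deltaConst a lam α φ * dist x y ^ (α : ℝ))

/-- The Vaserstein distance with respect to `d^*`: the infimum of `∫ d^* dP` over all couplings
`P` of `μ` and `ν`. -/
def vaserstein {X : Type*} [MetricSpace X] [MeasurableSpace X]
    (a lam : ℝ) (α : ℝ≥0) (φ : X → ℝ) (μ ν : ProbabilityMeasure X) : ℝ :=
  sInf {r : ℝ | ∃ P : ProbabilityMeasure (X × X),
    (P : Measure (X × X)).map Prod.fst = μ ∧ (P : Measure (X × X)).map Prod.snd = ν ∧
      r = ∫ z, dStar a lam α φ z.1 z.2 ∂(P : Measure (X × X))}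

open Classical in
/-- The distance on the extended semigroup. -/
def semigroupDist {X W : Type*} [MetricSpace X] [Nonempty X] [MeasurableSpace X] [BorelSpace X]
    (a lam : ℝ) (α : ℝ≥0) (g : W → X → X) (φ : X → ℝ) (p q : extSemigroup g φ) : ℝ :=
  if p = q then 0
  else vaserstein a lam α φ (eqState g φ p) (eqState g φ q) +
    ((kappa p.1.map)⁻¹).toReal + ((kappa q.1.map)⁻¹).toReal

/-- A sequence is eventually constant. -/
def EventuallyConst {Y : Type*} (u : ℕ → Y) : Prop := ∃ y : Y, ∀ᶠ n in atTop, u n = y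

/-- The boundary of a metric space: the points that its completion adds to it. -/
def boundary (Y : Type*) [MetricSpace Y] : Set (UniformSpace.Completion Y) :=
  (range ((↑) : Y → UniformSpace.Completion Y))ᶜ

end RuelleBoundary

end

open RuelleBoundary

noncomputable section

namespace RuelleBoundary

/-! ## Kantorovich–Rubinstein duality on compact metric spaces -/

/-! The quotient operators are Markov operators with the cocycle rule `P_u^{vw} = P_{uv}^w ∘ P_u^v`.
Everything rests on a contraction that is uniform in the left word: for `v` of one fixed length,
`P_u^v` shrinks the `d^*`-Lipschitz seminorm by a factor below 1 (`exists_contraction`). For close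
points, inverse branches match the preimages, contract distances and distort the weights only
slightly. For far points, mixing puts an atom of each weight into one small ball, and the masses of
these atoms are bounded below because the functions `L_u(1)` have uniformly bounded quotients.
Iterating, `P_u^v(f)` becomes constant exponentially fast in `|v|` (`exists_decay`).

The left word is treated by a change of density: `P_{tp}^v(f) P_p^v(H) = P_p^v(f H)` with `H =
P_∅^p(L_t(1))`. After normalization `L_t(1)` is Lipschitz uniformly in `t`, so that `H` is constant
up to an error exponential in `|p|` (`exists_left_decay`). Hence `P_u^v(f)` depends, up to an
exponentially small error, only on the end of `u` and the beginning of `v`. Compactness of the space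
of probability measures then gives `μ_{σ,ω}`, and two such measures are `C ρ^N`-close when `N`
letters agree on both sides (`exists_twoSidedState_estimate`). Estimates for test functions become
Wasserstein estimates by Kantorovich–Rubinstein duality, which is proved here from Hahn–Banach and
Riesz–Markov.

Since `1/κ(T_w) ≤ lam^|w|`, the same exponential rate governs all terms of the semigroup distance,
and this gives Hölder continuity. Distinct elements are at distance at least `1/κ > 0`, whence
discreteness; a Cauchy sequence that is not eventually constant therefore has `1/κ → 0`, and only
the Wasserstein term, which metrizes weak convergence, is left in the limit. The boundary map is
Lipschitz because the Wasserstein distance is at most the semigroup distance. Its values are of the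
form `μ_{σ,ω}` by compactness of the sequence space over a finite alphabet, and it is onto because
the periodic words of `[ω]_n _n[σ]` approximate `(σ, ω)` on both sides. -/

/-- A continuous pseudometric on a topological space. -/
structure IsContPseudoDist {X : Type*} [TopologicalSpace X] (c : X → X → ℝ) : Prop where
  cont : Continuous fun z : X × X => c z.1 z.2
  self : ∀ x, c x x = 0
  symm : ∀ x y, c x y = c y x
  tri : ∀ x y z, c x z ≤ c x y + c y z
  nonneg : ∀ x y, 0 ≤ c x y

theorem IsContPseudoDist.continuous_of_lip {X : Type*} [TopologicalSpace X] {c : X → X → ℝ}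
    (hc : IsContPseudoDist c) {f : X → ℝ} {K : ℝ} (hf : ∀ x y, f x - f y ≤ K * c x y) :
    Continuous f := by
  refine continuous_iff_continuousAt.2 fun x => ?_
  have h1 : Tendsto (fun y => K * c y x) (𝓝 x) (𝓝 0) := by
    have h2 : Continuous fun y => K * c y x :=
      continuous_const.mul (hc.cont.comp (continuous_id.prodMk continuous_const))
    simpa [hc.self] using h2.tendsto x
  refine tendsto_iff_dist_tendsto_zero.2 (squeeze_zero (fun _ => dist_nonneg) (fun y => ?_) h1)
  rw [Real.dist_eq, abs_le]
  have h2 := hf x y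
  rw [hc.symm x y] at h2
  constructor
  · linarith
  · exact hf y x

theorem continuous_integrable {X : Type*} [TopologicalSpace X] [CompactSpace X]
    [MeasurableSpace X] [OpensMeasurableSpace X] (μ : Measure X) [IsFiniteMeasure μ]
    {f : X → ℝ} (hf : Continuous f) : Integrable f μ :=
  (BoundedContinuousFunction.mkOfCompact ⟨f, hf⟩).integrable μ

section Duality

set_option linter.unusedSectionVars false

variable {X : Type*} [MetricSpace X] [CompactSpace X] [MeasurableSpace X] [BorelSpace X]
  {c : X → X → ℝ} {μ ν : ProbabilityMeasure X} {B : ℝ}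

/-- The integral functionals of the `c`-Lipschitz functions separate `μ` and `ν` by at most `B`. -/
def DualLe (c : X → X → ℝ) (μ ν : ProbabilityMeasure X) (B : ℝ) : Prop :=
  ∀ f : X → ℝ, (∀ x y, f x - f y ≤ c x y) →
    ∫ x, f x ∂(μ : Measure X) - ∫ x, f x ∂(ν : Measure X) ≤ B

theorem DualLe.scale (hB : DualLe c μ ν B) {t : ℝ} (ht : 0 ≤ t)
    {f : X → ℝ} (hf : ∀ x y, f x - f y ≤ t * c x y) :
    ∫ x, f x ∂(μ : Measure X) - ∫ x, f x ∂(ν : Measure X) ≤ t * B := by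
  rcases ht.eq_or_lt with rfl | ht
  · obtain ⟨x₀⟩ := μ.nonempty
    have h : ∀ x, f x = f x₀ := fun x => le_antisymm (by simpa using hf x x₀) (by simpa using hf x₀ x)
    simp [h]
  · have h := hB (fun x => t⁻¹ * f x) fun x y => by
      rw [← mul_sub, inv_mul_le_iff₀ ht]
      exact hf x y
    rw [integral_const_mul, integral_const_mul, ← mul_sub, inv_mul_le_iff₀ ht] at h
    exact h

/-- Weak duality: the inf-convolution `f x = ⨅ y, (b y + t * c x y)` is `t * c`-Lipschitz and
satisfies `m - a ≤ f ≤ b`, so `f` carries the bound `B` over to the splitting. -/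
theorem DualLe.le_of_le_split (hc : IsContPseudoDist c) (hB : DualLe c μ ν B)
    {a b : C(X, ℝ)} {t m : ℝ} (ht : 0 ≤ t) (h : ∀ x y, m ≤ a x + b y + t * c x y) :
    m ≤ ∫ x, a x ∂(μ : Measure X) + ∫ x, b x ∂(ν : Measure X) + t * B := by
  obtain ⟨x₀⟩ := μ.nonempty
  have : Nonempty X := ⟨x₀⟩
  have hbd : ∀ x, BddBelow (range fun y => b y + t * c x y) := fun x =>
    ⟨m - a x, by rintro _ ⟨y, rfl⟩; have := h x y; dsimp only; linarith⟩
  let f : X → ℝ := fun x => ⨅ y, (b y + t * c x y)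
  have hf : ∀ x y, f x - f y ≤ t * c x y := by
    intro x y
    have : f x - t * c x y ≤ f y := by
      refine le_ciInf fun z => ?_
      have h1 : f x ≤ b z + t * c x z := ciInf_le (hbd x) z
      have h2 := mul_le_mul_of_nonneg_left (hc.tri x y z) ht
      linarith
    linarith
  have hfc : Continuous f := hc.continuous_of_lip hf
  have h1 := hB.scale ht hf
  have h2 : ∫ x, f x ∂(ν : Measure X) ≤ ∫ x, b x ∂(ν : Measure X) := by
    refine integral_mono (continuous_integrable _ hfc) (continuous_integrable _ b.continuous)
      fun x => ?_
    have := ciInf_le (hbd x) x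
    rw [hc.self] at this
    simpa using this
  have h3 : ∫ x, (m - a x) ∂(μ : Measure X) ≤ ∫ x, f x ∂(μ : Measure X) := by
    refine integral_mono (continuous_integrable _ (continuous_const.sub a.continuous))
      (continuous_integrable _ hfc) fun x => ?_
    refine le_ciInf fun y => ?_
    have := h x y
    linarith
  rw [integral_sub (integrable_const _) (continuous_integrable _ a.continuous)] at h3
  simp at h3
  linarith

/-- The costs of the ways to dominate `h` by a sum of functions of one variable and a multiple
of `c`, where the multiple `t * c` is charged `t * B`. -/
def splitCosts (c : X → X → ℝ) (μ ν : ProbabilityMeasure X) (B : ℝ) (h : C(X × X, ℝ)) : Set ℝ :=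
  {r | ∃ (a b : C(X, ℝ)) (t : ℝ), 0 ≤ t ∧ (∀ x y, h (x, y) ≤ a x + b y + t * c x y) ∧
    r = ∫ x, a x ∂(μ : Measure X) + ∫ x, b x ∂(ν : Measure X) + t * B}

theorem splitCosts_bddBelow (hc : IsContPseudoDist c) (hB : DualLe c μ ν B) (h : C(X × X, ℝ)) :
    BddBelow (splitCosts c μ ν B h) := by
  refine ⟨-‖h‖, ?_⟩
  rintro _ ⟨a, b, t, ht, hab, rfl⟩
  exact hB.le_of_le_split hc ht fun x y =>
    (neg_le_of_abs_le (h.norm_coe_le_norm (x, y))).trans (hab x y)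

theorem splitCosts_nonempty (h : C(X × X, ℝ)) : (splitCosts c μ ν B h).Nonempty :=
  ⟨_, ContinuousMap.const X ‖h‖, 0, 0, le_rfl, fun x y => by
    simpa using (le_abs_self _).trans (h.norm_coe_le_norm (x, y)), rfl⟩

/-- Hahn–Banach for the sublinear functional `sInf (splitCosts c μ ν B ·)`, extending from the zero
subspace. Such an `L` is integration against the coupling that is sought: splittings with one
nonzero term encode positivity, the marginals and the cost. -/
theorem exists_dominated_functional (hc : IsContPseudoDist c) (hB : DualLe c μ ν B) :
    ∃ L : C(X × X, ℝ) →ₗ[ℝ] ℝ, ∀ (h : C(X × X, ℝ)) (a b : C(X, ℝ)) (t : ℝ), 0 ≤ t →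
      (∀ x y, h (x, y) ≤ a x + b y + t * c x y) →
        L h ≤ ∫ x, a x ∂(μ : Measure X) + ∫ x, b x ∂(ν : Measure X) + t * B := by
  have key : ∀ (h : C(X × X, ℝ)) (a b : C(X, ℝ)) (t : ℝ), 0 ≤ t → (∀ x y, h (x, y) ≤ a x + b y + t * c x y) →
      sInf (splitCosts c μ ν B h) ≤
        ∫ x, a x ∂(μ : Measure X) + ∫ x, b x ∂(ν : Measure X) + t * B :=
    fun h a b t ht hab => csInf_le (splitCosts_bddBelow hc hB h) ⟨a, b, t, ht, hab, rfl⟩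
  have hle : ∀ r : ℝ, 0 < r → ∀ h : C(X × X, ℝ),
      sInf (splitCosts c μ ν B (r • h)) ≤ r * sInf (splitCosts c μ ν B h) := by
    intro r hr h
    rw [← div_le_iff₀' hr]
    refine le_csInf (splitCosts_nonempty h) ?_
    rintro _ ⟨a, b, t, ht, hab, rfl⟩
    rw [div_le_iff₀' hr]
    refine (key (r • h) (r • a) (r • b) (r * t) (by positivity) fun x y => ?_).trans_eq ?_
    · have := mul_le_mul_of_nonneg_left (hab x y) hr.le
      simp only [ContinuousMap.smul_apply, smul_eq_mul]
      linarith
    · simp only [ContinuousMap.smul_apply, smul_eq_mul, integral_const_mul]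
      ring
  obtain ⟨L, -, hL⟩ := exists_extension_of_le_sublinear (E := C(X × X, ℝ)) ⊥
    (fun h => sInf (splitCosts c μ ν B h))
    (fun r hr h => by
      refine le_antisymm (hle r hr h) ?_
      have := hle r⁻¹ (inv_pos.2 hr) (r • h)
      rw [smul_smul, inv_mul_cancel₀ hr.ne', one_smul, ← div_eq_inv_mul, le_div_iff₀' hr] at this
      exact this)
    (fun h h' => by
      rw [← sub_le_iff_le_add']
      refine le_csInf (splitCosts_nonempty h') ?_
      rintro _ ⟨a', b', t', ht', hab', rfl⟩
      rw [sub_le_comm]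
      refine le_csInf (splitCosts_nonempty h) ?_
      rintro _ ⟨a, b, t, ht, hab, rfl⟩
      rw [sub_le_iff_le_add]
      refine (key (h + h') (a + a') (b + b') (t + t') (by positivity) fun x y => ?_).trans_eq ?_
      · have h1 := hab x y
        have h2 := hab' x y
        simp only [ContinuousMap.add_apply]
        linarith
      · simp only [ContinuousMap.add_apply]
        rw [integral_add (continuous_integrable _ a.continuous)
          (continuous_integrable _ a'.continuous), integral_add
          (continuous_integrable _ b.continuous) (continuous_integrable _ b'.continuous)]
        ring)
    -- The value at 0 is nonnegative by weak duality with `m = 0`; this is where the bound `hB` is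
    -- indispensable.
    (by
      rintro ⟨x, hx⟩
      have hx0 : x = 0 := (Submodule.mem_bot ℝ).1 hx
      subst hx0
      have h0 : (⊥ : C(X × X, ℝ) →ₗ.[ℝ] ℝ) ⟨0, hx⟩ = 0 := LinearPMap.map_zero _
      rw [h0]
      refine le_csInf (splitCosts_nonempty 0) ?_
      rintro _ ⟨a, b, t, ht, hab, rfl⟩
      exact hB.le_of_le_split hc ht fun x y => by simpa using hab x y)
  exact ⟨L, fun h a b t ht hab => (hL h).trans (key h a b t ht hab)⟩

/-- Riesz–Markov; on a compact space every continuous function is compactly supported, and `L 1 = 1`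
gives total mass 1. -/
theorem exists_measure_of_positive {Y : Type*} [TopologicalSpace Y] [CompactSpace Y] [T2Space Y]
    [MeasurableSpace Y] [BorelSpace Y] (L : C(Y, ℝ) →ₗ[ℝ] ℝ)
    (hpos : ∀ h : C(Y, ℝ), (∀ y, 0 ≤ h y) → 0 ≤ L h) (h1 : L 1 = 1) :
    ∃ P : ProbabilityMeasure Y, ∀ h : C(Y, ℝ), ∫ y, h y ∂(P : Measure Y) = L h := by
  let Λ : CompactlySupportedContinuousMap Y ℝ →ₚ[ℝ] ℝ :=
    { toFun := fun h => L h.toContinuousMap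
      map_add' := fun g h => L.map_add g.toContinuousMap h.toContinuousMap
      map_smul' := fun r h => L.map_smul r h.toContinuousMap
      monotone' := fun g h hgh => by
        have := hpos (h.toContinuousMap - g.toContinuousMap) fun y => sub_nonneg.2 (hgh y)
        rw [map_sub] at this
        exact sub_nonneg.1 this }
  have hI : ∀ h : C(Y, ℝ), ∫ y, h y ∂(RealRMK.rieszMeasure Λ) = L h := fun h =>
    RealRMK.integral_rieszMeasure Λ
      { toContinuousMap := h, hasCompactSupport' := HasCompactSupport.of_compactSpace _ }
  have hprob : IsProbabilityMeasure (RealRMK.rieszMeasure Λ) := by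
    constructor
    have := hI 1
    simp only [ContinuousMap.one_apply, h1, integral_const, smul_eq_mul, mul_one] at this
    exact (ENNReal.toReal_eq_one_iff _).1 this
  exact ⟨⟨_, hprob⟩, hI⟩

theorem probabilityMeasure_ext {Y : Type*} [TopologicalSpace Y] [CompactSpace Y]
    [MeasurableSpace Y] [BorelSpace Y] [HasOuterApproxClosed Y]
    {P Q : Measure Y} [IsProbabilityMeasure P] [IsProbabilityMeasure Q]
    (h : ∀ f : C(Y, ℝ), ∫ y, f y ∂P = ∫ y, f y ∂Q) : P = Q :=
  ext_of_forall_integral_eq_of_IsFiniteMeasure fun f => h f.toContinuousMap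

/-- Kantorovich–Rubinstein duality. -/
theorem DualLe.exists_coupling (hc : IsContPseudoDist c) (hB : DualLe c μ ν B) :
    ∃ P : ProbabilityMeasure (X × X), (P : Measure (X × X)).map Prod.fst = μ ∧
      (P : Measure (X × X)).map Prod.snd = ν ∧ ∫ z, c z.1 z.2 ∂(P : Measure (X × X)) ≤ B := by
  obtain ⟨L, hL⟩ := exists_dominated_functional hc hB
  have hneg : ∀ h : C(X × X, ℝ), (∀ y, 0 ≤ h y) → 0 ≤ L h := fun h hh => by
    have := hL (-h) 0 0 0 le_rfl fun x y => by simpa using hh (x, y)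
    simpa using this
  -- Domination applied to the function and to its negative turns the inequality into an equality,
  -- which fixes the marginal.
  have hfst : ∀ a : C(X, ℝ), L (a.comp ⟨Prod.fst, continuous_fst⟩) = ∫ x, a x ∂(μ : Measure X) := by
    intro a
    refine le_antisymm ?_ ?_
    · simpa using hL (a.comp ⟨Prod.fst, continuous_fst⟩) a 0 0 le_rfl fun x y => by simp
    · have := hL (-a.comp ⟨Prod.fst, continuous_fst⟩) (-a) 0 0 le_rfl fun x y => by simp
      simpa [integral_neg] using this
  have hsnd : ∀ a : C(X, ℝ), L (a.comp ⟨Prod.snd, continuous_snd⟩) = ∫ x, a x ∂(ν : Measure X) := by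
    intro a
    refine le_antisymm ?_ ?_
    · simpa using hL (a.comp ⟨Prod.snd, continuous_snd⟩) 0 a 0 le_rfl fun x y => by simp
    · have := hL (-a.comp ⟨Prod.snd, continuous_snd⟩) 0 (-a) 0 le_rfl fun x y => by simp
      simpa [integral_neg] using this
  obtain ⟨P, hP⟩ := exists_measure_of_positive L hneg (by
    have := hfst 1
    simp only [ContinuousMap.one_apply, integral_const, probReal_univ, smul_eq_mul, mul_one] at this
    rw [← this]; rfl)
  refine ⟨P, ?_, ?_, ?_⟩
  · have := Measure.isProbabilityMeasure_map (μ := (P : Measure (X × X)))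
      (f := Prod.fst) measurable_fst.aemeasurable
    refine probabilityMeasure_ext fun f => ?_
    rw [integral_map measurable_fst.aemeasurable f.continuous.aestronglyMeasurable, ← hfst, ← hP]
    rfl
  · have := Measure.isProbabilityMeasure_map (μ := (P : Measure (X × X)))
      (f := Prod.snd) measurable_snd.aemeasurable
    refine probabilityMeasure_ext fun f => ?_
    rw [integral_map measurable_snd.aemeasurable f.continuous.aestronglyMeasurable, ← hsnd, ← hP]
    rfl
  · rw [show (∫ z, c z.1 z.2 ∂(P : Measure (X × X))) = _ from hP ⟨_, hc.cont⟩]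
    simpa using hL ⟨_, hc.cont⟩ 0 0 1 zero_le_one fun x y => by simp

/-- The easy half of Kantorovich–Rubinstein duality. -/
theorem integral_sub_le_of_coupling (hc : IsContPseudoDist c) {P : ProbabilityMeasure (X × X)}
    (h1 : (P : Measure (X × X)).map Prod.fst = μ) (h2 : (P : Measure (X × X)).map Prod.snd = ν)
    {f : X → ℝ} {K : ℝ} (hf : ∀ x y, f x - f y ≤ K * c x y) :
    ∫ x, f x ∂(μ : Measure X) - ∫ x, f x ∂(ν : Measure X) ≤
      K * ∫ z, c z.1 z.2 ∂(P : Measure (X × X)) := by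
  have hfc := hc.continuous_of_lip hf
  rw [← h1, ← h2, integral_map measurable_fst.aemeasurable hfc.aestronglyMeasurable,
    integral_map measurable_snd.aemeasurable hfc.aestronglyMeasurable, ← integral_sub
    (continuous_integrable _ (by fun_prop)) (continuous_integrable _ (by fun_prop)),
    ← integral_const_mul]
  exact integral_mono (continuous_integrable _ ((hfc.comp continuous_fst).sub
    (hfc.comp continuous_snd))) (continuous_integrable _ (continuous_const.mul hc.cont))
    fun z => hf z.1 z.2

end Duality

/-! ## The metric `d^*` and the Vaserstein distance -/

section DStar

variable {X : Type*} [MetricSpace X] {a lam : ℝ} {α : ℝ≥0} {φ : X → ℝ}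

theorem deltaConst_pos (ha : 0 < a) : 0 < deltaConst a lam α φ :=
  lt_max_of_lt_right (Real.rpow_pos_of_pos ha _)

theorem dStar_le_one (x y : X) : dStar a lam α φ x y ≤ 1 := min_le_left _ _

theorem dStar_isContPseudoDist (ha : 0 < a) (hα0 : 0 < α) (hα1 : α ≤ 1) :
    IsContPseudoDist (dStar a lam α φ) := by
  have hΔ := deltaConst_pos (X := X) (lam := lam) (α := α) (φ := φ) ha
  have hα0' : (0 : ℝ) < α := hα0
  have hn : ∀ x y : X, 0 ≤ deltaConst a lam α φ * dist x y ^ (α : ℝ) := fun x y => by positivity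
  refine ⟨?_, fun x => ?_, fun x y => ?_, fun x y z => ?_, fun x y => ?_⟩
  · refine continuous_const.min (continuous_const.mul ?_)
    exact continuous_dist.rpow_const fun _ => Or.inr α.2
  · simp [dStar, Real.zero_rpow hα0'.ne']
  · simp only [dStar, dist_comm]
  · have h1 : dist x z ^ (α : ℝ) ≤ dist x y ^ (α : ℝ) + dist y z ^ (α : ℝ) :=
      (Real.rpow_le_rpow dist_nonneg (dist_triangle x y z) α.2).trans
        (Real.rpow_add_le_add_rpow dist_nonneg dist_nonneg α.2 hα1)
    have h2 := mul_le_mul_of_nonneg_left h1 hΔ.le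
    have h3 := hn x y
    have h4 := hn y z
    simp only [dStar]
    rcases min_cases 1 (deltaConst a lam α φ * dist x y ^ (α : ℝ)) with h | h <;>
    rcases min_cases 1 (deltaConst a lam α φ * dist y z ^ (α : ℝ)) with h' | h' <;>
    rw [h.1, h'.1]
    · exact (min_le_left _ _).trans (by norm_num)
    · exact (min_le_left _ _).trans (by linarith)
    · exact (min_le_left _ _).trans (by linarith)
    · exact (min_le_right _ _).trans (by linarith)
  · exact le_min zero_le_one (hn x y)

end DStar

section Vaserstein

set_option linter.unusedSectionVars false

variable {X : Type*} [MetricSpace X] [CompactSpace X] [MeasurableSpace X] [BorelSpace X]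
  {a lam : ℝ} {α : ℝ≥0} {φ : X → ℝ}

theorem vaserstein_bddBelow (ha : 0 < a) (hα0 : 0 < α) (hα1 : α ≤ 1) (μ ν : ProbabilityMeasure X) :
    BddBelow {r : ℝ | ∃ P : ProbabilityMeasure (X × X),
      (P : Measure (X × X)).map Prod.fst = μ ∧ (P : Measure (X × X)).map Prod.snd = ν ∧
      r = ∫ z, dStar a lam α φ z.1 z.2 ∂(P : Measure (X × X))} := by
  refine ⟨0, ?_⟩
  rintro _ ⟨P, -, -, rfl⟩
  exact integral_nonneg fun z => (dStar_isContPseudoDist ha hα0 hα1).nonneg _ _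

/-- Upper bounds for the Wasserstein distance are obtained from here on by testing Lipschitz
functions, without constructing couplings. -/
theorem vaserstein_le_of_dualLe (ha : 0 < a) (hα0 : 0 < α) (hα1 : α ≤ 1)
    {μ ν : ProbabilityMeasure X} {B : ℝ} (h : DualLe (dStar a lam α φ) μ ν B) :
    vaserstein a lam α φ μ ν ≤ B := by
  obtain ⟨P, h1, h2, h3⟩ := h.exists_coupling (dStar_isContPseudoDist ha hα0 hα1)
  exact (csInf_le (vaserstein_bddBelow ha hα0 hα1 μ ν) ⟨P, h1, h2, rfl⟩).trans h3

theorem vaserstein_nonneg (ha : 0 < a) (hα0 : 0 < α) (hα1 : α ≤ 1)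
    (μ ν : ProbabilityMeasure X) : 0 ≤ vaserstein a lam α φ μ ν := by
  refine Real.sInf_nonneg ?_
  rintro _ ⟨P, -, -, rfl⟩
  exact integral_nonneg fun z => (dStar_isContPseudoDist ha hα0 hα1).nonneg _ _

theorem integral_sub_le_vaserstein (ha : 0 < a) (hα0 : 0 < α) (hα1 : α ≤ 1)
    (μ ν : ProbabilityMeasure X) {f : X → ℝ} {K : ℝ} (hK : 0 ≤ K)
    (hf : ∀ x y, f x - f y ≤ K * dStar a lam α φ x y) :
    ∫ x, f x ∂(μ : Measure X) - ∫ x, f x ∂(ν : Measure X) ≤ K * vaserstein a lam α φ μ ν := by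
  have hne : {r : ℝ | ∃ P : ProbabilityMeasure (X × X),
      (P : Measure (X × X)).map Prod.fst = μ ∧ (P : Measure (X × X)).map Prod.snd = ν ∧
      r = ∫ z, dStar a lam α φ z.1 z.2 ∂(P : Measure (X × X))}.Nonempty :=
    ⟨_, ⟨(μ : Measure X).prod ν, inferInstance⟩, Measure.map_fst_prod.trans (by simp),
      Measure.map_snd_prod.trans (by simp), rfl⟩
  rw [vaserstein, ← smul_eq_mul K (sInf _), ← Real.sInf_smul_of_nonneg hK]
  refine le_csInf hne.smul_set ?_
  rintro _ ⟨_, ⟨P, h1, h2, rfl⟩, rfl⟩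
  exact integral_sub_le_of_coupling (dStar_isContPseudoDist ha hα0 hα1) h1 h2 hf

theorem dualLe_vaserstein (ha : 0 < a) (hα0 : 0 < α) (hα1 : α ≤ 1)
    (μ ν : ProbabilityMeasure X) :
    DualLe (dStar a lam α φ) μ ν (vaserstein a lam α φ μ ν) := fun f hf => by
  simpa using integral_sub_le_vaserstein ha hα0 hα1 μ ν zero_le_one (f := f) (by simpa using hf)

theorem vaserstein_self (ha : 0 < a) (hα0 : 0 < α) (hα1 : α ≤ 1) (μ : ProbabilityMeasure X) :
    vaserstein a lam α φ μ μ = 0 :=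
  le_antisymm (vaserstein_le_of_dualLe ha hα0 hα1 fun f _ => by simp)
    (vaserstein_nonneg ha hα0 hα1 μ μ)

theorem vaserstein_comm (ha : 0 < a) (hα0 : 0 < α) (hα1 : α ≤ 1) (μ ν : ProbabilityMeasure X) :
    vaserstein a lam α φ μ ν = vaserstein a lam α φ ν μ := by
  have h : ∀ μ ν : ProbabilityMeasure X,
      vaserstein a lam α φ μ ν ≤ vaserstein a lam α φ ν μ := fun μ ν =>
    vaserstein_le_of_dualLe ha hα0 hα1 fun f hf => by
      have := dualLe_vaserstein ha hα0 hα1 ν μ (fun x => -f x) fun x y => by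
        have := hf y x
        rw [(dStar_isContPseudoDist ha hα0 hα1).symm] at this
        linarith
      rw [integral_neg, integral_neg] at this
      linarith
  exact le_antisymm (h μ ν) (h ν μ)

theorem vaserstein_triangle (ha : 0 < a) (hα0 : 0 < α) (hα1 : α ≤ 1)
    (μ ν ρ : ProbabilityMeasure X) :
    vaserstein a lam α φ μ ρ ≤ vaserstein a lam α φ μ ν + vaserstein a lam α φ ν ρ :=
  vaserstein_le_of_dualLe ha hα0 hα1 fun f hf => by
    have h1 := dualLe_vaserstein ha hα0 hα1 μ ν f hf
    have h2 := dualLe_vaserstein ha hα0 hα1 ν ρ f hf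
    linarith

theorem abs_integral_sub_le_vaserstein (ha : 0 < a) (hα0 : 0 < α) (hα1 : α ≤ 1)
    (μ ν : ProbabilityMeasure X) {f : X → ℝ} {K : ℝ} (hK : 0 ≤ K)
    (hf : ∀ x y, f x - f y ≤ K * dStar a lam α φ x y) :
    |∫ x, f x ∂(μ : Measure X) - ∫ x, f x ∂(ν : Measure X)| ≤ K * vaserstein a lam α φ μ ν := by
  have h1 := integral_sub_le_vaserstein ha hα0 hα1 μ ν hK hf
  have h2 := integral_sub_le_vaserstein ha hα0 hα1 ν μ hK hf
  rw [vaserstein_comm ha hα0 hα1] at h2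
  rw [abs_le]
  constructor <;> linarith

/-! ## Density of the Lipschitz functions, and the weak topology -/

/-- Stone–Weierstrass: on a compact space the `c`-Lipschitz functions, with arbitrary constants,
form an algebra, and the functions `c · x` separate points. -/
theorem exists_lip_near {c : X → X → ℝ} (hc : IsContPseudoDist c)
    (hsep : ∀ x y, c x y = 0 → x = y) (f : C(X, ℝ)) {ε : ℝ} (hε : 0 < ε) :
    ∃ (h : X → ℝ) (K : ℝ), 0 ≤ K ∧ (∀ x y, h x - h y ≤ K * c x y) ∧ ∀ x, |h x - f x| ≤ ε := by
  let A : Subalgebra ℝ C(X, ℝ) :=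
    { carrier := {h | ∃ K : ℝ, 0 ≤ K ∧ ∀ x y, h x - h y ≤ K * c x y}
      mul_mem' := by
        rintro h h' ⟨K, hK, hh⟩ ⟨K', hK', hh'⟩
        refine ⟨‖h‖ * K' + ‖h'‖ * K, by positivity, fun x y => ?_⟩
        have habs : ∀ (g : C(X, ℝ)) (L : ℝ), (∀ x y, g x - g y ≤ L * c x y) →
            |g x - g y| ≤ L * c x y := fun g L hg => by
          have h1 := hg x y
          have h2 := hg y x
          rw [hc.symm y x] at h2
          rw [abs_le]
          constructor <;> linarith
        have h1 := habs h K hh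
        have h2 := habs h' K' hh'
        have h3 : |h x * (h' x - h' y)| ≤ ‖h‖ * (K' * c x y) := by
          rw [abs_mul]
          exact mul_le_mul (h.norm_coe_le_norm x) h2 (abs_nonneg _) (norm_nonneg _)
        have h4 : |h' y * (h x - h y)| ≤ ‖h'‖ * (K * c x y) := by
          rw [abs_mul]
          exact mul_le_mul (h'.norm_coe_le_norm y) h1 (abs_nonneg _) (norm_nonneg _)
        have h5 := (abs_le.1 h3).2
        have h6 := (abs_le.1 h4).2
        simp only [ContinuousMap.mul_apply]
        linarith
      add_mem' := by
        rintro h h' ⟨K, hK, hh⟩ ⟨K', hK', hh'⟩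
        refine ⟨K + K', by positivity, fun x y => ?_⟩
        have h1 := hh x y
        have h2 := hh' x y
        simp only [ContinuousMap.add_apply]
        linarith
      algebraMap_mem' := fun r => ⟨0, le_rfl, fun x y => by simp⟩ }
  have hA : A.SeparatesPoints := by
    intro x y hxy
    refine ⟨_, ⟨⟨fun z => c z x, hc.cont.comp (continuous_id.prodMk continuous_const)⟩,
      ⟨1, zero_le_one, fun z w => ?_⟩, rfl⟩, ?_⟩
    · have := hc.tri z w x
      simp only [ContinuousMap.coe_mk]
      linarith
    · simp only [ContinuousMap.coe_mk, hc.self]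
      exact fun h => hxy (hsep y x h.symm).symm
  obtain ⟨⟨h, K, hK, hh⟩, hn⟩ :=
    ContinuousMap.exists_mem_subalgebra_near_continuousMap_of_separatesPoints A hA f ε hε
  exact ⟨h, K, hK, hh, fun x => ((h - f).norm_coe_le_norm x).trans hn.le⟩

theorem dStar_eq_zero (ha : 0 < a) (x y : X) (h : dStar a lam α φ x y = 0) : x = y := by
  by_contra hxy
  have h1 : 0 < deltaConst a lam α φ * dist x y ^ (α : ℝ) :=
    mul_pos (deltaConst_pos ha) (Real.rpow_pos_of_pos (dist_pos.2 hxy) _)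
  exact (lt_min zero_lt_one h1).ne' h

/-- Convergence of nonexpansive functionals can be tested on Lipschitz functions. -/
theorem tendsto_of_forall_lip (ha : 0 < a) (hα0 : 0 < α) (hα1 : α ≤ 1) {ι : Type*} {l : Filter ι}
    (I : ι → (X → ℝ) → ℝ) (J : (X → ℝ) → ℝ)
    (hI : ∀ n f h ε, Continuous f → Continuous h → (∀ x, |f x - h x| ≤ ε) → |I n f - I n h| ≤ ε)
    (hJ : ∀ f h ε, Continuous f → Continuous h → (∀ x, |f x - h x| ≤ ε) → |J f - J h| ≤ ε)
    (hl : ∀ (h : X → ℝ) (K : ℝ), 0 ≤ K → (∀ x y, h x - h y ≤ K * dStar a lam α φ x y) →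
      Tendsto (fun n => I n h) l (𝓝 (J h))) (f : C(X, ℝ)) :
    Tendsto (fun n => I n f) l (𝓝 (J f)) := by
  refine Metric.tendsto_nhds.2 fun ε hε => ?_
  have hc := dStar_isContPseudoDist (X := X) (lam := lam) (φ := φ) ha hα0 hα1
  obtain ⟨h, K, hK, hh, hn⟩ := exists_lip_near hc (dStar_eq_zero ha) f (ε := ε / 3) (by positivity)
  have hhc := hc.continuous_of_lip hh
  filter_upwards [Metric.tendsto_nhds.1 (hl h K hK hh) (ε / 3) (by positivity)] with n h1
  have h2 := hI n h f _ hhc f.continuous hn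
  have h3 := hJ h f _ hhc f.continuous hn
  rw [Real.dist_eq] at h1 ⊢
  rw [abs_lt] at h1 ⊢
  rw [abs_le] at h2 h3
  constructor <;> linarith

theorem abs_integral_sub_le {Y : Type*} [TopologicalSpace Y] [CompactSpace Y]
    [MeasurableSpace Y] [OpensMeasurableSpace Y] (μ : Measure Y) [IsProbabilityMeasure μ]
    {f h : Y → ℝ} {ε : ℝ} (hf : Continuous f) (hh : Continuous h) (hn : ∀ x, |f x - h x| ≤ ε) :
    |∫ x, f x ∂μ - ∫ x, h x ∂μ| ≤ ε := by
  rw [← integral_sub (continuous_integrable _ hf) (continuous_integrable _ hh)]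
  simpa using norm_integral_le_of_norm_le_const (μ := μ) (f := fun x => f x - h x) (.of_forall hn)

theorem probabilityMeasure_tendsto_iff {ι : Type*} {l : Filter ι} {μ : ι → ProbabilityMeasure X}
    {ν : ProbabilityMeasure X} :
    Tendsto μ l (𝓝 ν) ↔ ∀ f : C(X, ℝ), Tendsto (fun n => ∫ x, f x ∂(μ n : Measure X)) l
      (𝓝 (∫ x, f x ∂(ν : Measure X))) := by
  rw [ProbabilityMeasure.tendsto_iff_forall_integral_tendsto]
  exact ⟨fun h f => h (BoundedContinuousFunction.mkOfCompact f), fun h f => h f.toContinuousMap⟩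

theorem tendsto_of_forall_lip_integral (ha : 0 < a) (hα0 : 0 < α) (hα1 : α ≤ 1)
    {ι : Type*} {l : Filter ι} {μ : ι → ProbabilityMeasure X} {ν : ProbabilityMeasure X}
    (h : ∀ (h : X → ℝ) (K : ℝ), 0 ≤ K → (∀ x y, h x - h y ≤ K * dStar a lam α φ x y) →
      Tendsto (fun n => ∫ x, h x ∂(μ n : Measure X)) l (𝓝 (∫ x, h x ∂(ν : Measure X)))) :
    Tendsto μ l (𝓝 ν) :=
  probabilityMeasure_tendsto_iff.2 <| tendsto_of_forall_lip ha hα0 hα1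
    (fun n f => ∫ x, f x ∂(μ n : Measure X)) (fun f => ∫ x, f x ∂(ν : Measure X))
    (fun _ _ _ _ hf hh => abs_integral_sub_le _ hf hh) (fun _ _ _ hf hh => abs_integral_sub_le _ hf hh)
    h

/-! ### The Wasserstein distance metrizes weak convergence. -/

theorem tendsto_of_vaserstein (ha : 0 < a) (hα0 : 0 < α) (hα1 : α ≤ 1)
    {ι : Type*} {l : Filter ι} {μ : ι → ProbabilityMeasure X} {ν : ProbabilityMeasure X}
    (h : Tendsto (fun n => vaserstein a lam α φ (μ n) ν) l (𝓝 0)) : Tendsto μ l (𝓝 ν) := by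
  refine tendsto_of_forall_lip_integral ha hα0 hα1 (lam := lam) (φ := φ) fun f K hK hf => ?_
  refine tendsto_iff_dist_tendsto_zero.2 (squeeze_zero (fun _ => dist_nonneg) (fun n => ?_)
    (by simpa using h.const_mul K))
  exact abs_integral_sub_le_vaserstein ha hα0 hα1 _ _ hK hf

/-- By Arzelà–Ascoli the 1-Lipschitz functions, normalized to vanish at one point, are totally
bounded, so weak convergence is uniform over them; duality then bounds the distance. -/
theorem tendsto_vaserstein (ha : 0 < a) (hα0 : 0 < α) (hα1 : α ≤ 1)
    {ι : Type*} {l : Filter ι} {μ : ι → ProbabilityMeasure X} {ν : ProbabilityMeasure X}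
    (h : Tendsto μ l (𝓝 ν)) : Tendsto (fun n => vaserstein a lam α φ (μ n) ν) l (𝓝 0) := by
  obtain ⟨x₀⟩ := ν.nonempty
  have hc := dStar_isContPseudoDist (X := X) (lam := lam) (φ := φ) ha hα0 hα1
  let A : Set (BoundedContinuousFunction X ℝ) :=
    {f | (∀ x, f x ∈ Icc (-1 : ℝ) 1) ∧ ∀ x y, f x - f y ≤ dStar a lam α φ x y}
  have hA : TotallyBounded A := by
    refine ((BoundedContinuousFunction.arzela_ascoli (Icc (-1 : ℝ) 1) isCompact_Icc A
      (fun f x hf => hf.1 x) ?_).totallyBounded).subset subset_closure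
    intro x
    rw [Metric.equicontinuousAt_iff]
    intro ε hε
    have h1 : Tendsto (fun y => dStar a lam α φ x y) (𝓝 x) (𝓝 0) := by
      have h2 : Continuous fun y => dStar a lam α φ x y :=
        hc.cont.comp (continuous_const.prodMk continuous_id)
      simpa [hc.self] using h2.tendsto x
    obtain ⟨δ, hδ, hd⟩ := Metric.eventually_nhds_iff.1 (h1.eventually (gt_mem_nhds hε))
    refine ⟨δ, hδ, fun y hy f => ?_⟩
    have h2 := f.2.2 x y
    have h3 := f.2.2 y x
    have h4 := hd hy
    rw [hc.symm y x] at h3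
    rw [Real.dist_eq, abs_lt]
    constructor <;> linarith
  refine Metric.tendsto_nhds.2 fun ε hε => ?_
  obtain ⟨t, ht, htA⟩ := Metric.totallyBounded_iff.1 hA (ε / 4) (by positivity)
  have hev : ∀ᶠ n in l, ∀ f ∈ t,
      |∫ x, f x ∂(μ n : Measure X) - ∫ x, f x ∂(ν : Measure X)| < ε / 4 := by
    refine (eventually_all_finite ht).2 fun f _ => ?_
    exact Metric.tendsto_nhds.1 (probabilityMeasure_tendsto_iff.1 h f.toContinuousMap) (ε / 4)
      (by positivity)
  filter_upwards [hev] with n hn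
  rw [dist_zero_right, Real.norm_of_nonneg (vaserstein_nonneg ha hα0 hα1 _ _)]
  refine (vaserstein_le_of_dualLe ha hα0 hα1 (B := 3 * (ε / 4)) fun f hf => ?_).trans_lt
    (by linarith)
  have hfc : Continuous f := hc.continuous_of_lip (K := 1) (by simpa using hf)
  -- Subtracting a constant does not affect the difference of integrals; as `d^* ≤ 1`, the values
  -- now lie in `[-1, 1]`.
  let g : BoundedContinuousFunction X ℝ :=
    BoundedContinuousFunction.mkOfCompact ⟨fun x => f x - f x₀, hfc.sub continuous_const⟩
  have hg : g ∈ A := by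
    refine ⟨fun x => ?_, fun x y => by simpa [g] using hf x y⟩
    have h1 := (hf x x₀).trans (dStar_le_one x x₀)
    have h2 := (hf x₀ x).trans (dStar_le_one x₀ x)
    simp only [g, BoundedContinuousFunction.mkOfCompact_apply, ContinuousMap.coe_mk, mem_Icc]
    constructor <;> linarith
  obtain ⟨f', hf', hgf⟩ := mem_iUnion₂.1 (htA hg)
  have hn' := hn f' hf'
  have hgf' : ∀ x, |g x - f' x| ≤ ε / 4 := fun x =>
    ((g.dist_coe_le_dist x).trans (Metric.mem_ball.1 hgf).le)
  have h1 := abs_integral_sub_le (μ n : Measure X) g.continuous f'.continuous hgf'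
  have h2 := abs_integral_sub_le (ν : Measure X) g.continuous f'.continuous hgf'
  have h3 : ∀ ρ : ProbabilityMeasure X, ∫ x, g x ∂(ρ : Measure X) =
      ∫ x, f x ∂(ρ : Measure X) - f x₀ := fun ρ => by
    simp only [g, BoundedContinuousFunction.mkOfCompact_apply, ContinuousMap.coe_mk]
    rw [integral_sub (continuous_integrable _ hfc) (integrable_const _)]
    simp
  rw [h3, abs_le] at h1 h2
  rw [abs_lt] at hn'
  linarith

/-- Compactness yields a limit along an ultrafilter. The integrals of Lipschitz functions are
Cauchy, so their full limits agree with those along the ultrafilter. -/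
theorem exists_tendsto_of_cauchy_vaserstein (ha : 0 < a) (hα0 : 0 < α) (hα1 : α ≤ 1)
    {μ : ℕ → ProbabilityMeasure X}
    (h : ∀ ε > 0, ∃ N, ∀ m ≥ N, ∀ n ≥ N, vaserstein a lam α φ (μ m) (μ n) < ε) :
    ∃ ν, Tendsto μ atTop (𝓝 ν) := by
  obtain ⟨ν, -, hν⟩ := (isCompact_univ (X := ProbabilityMeasure X)).ultrafilter_le_nhds
    ((Ultrafilter.of atTop).map μ) (by simp)
  refine ⟨ν, tendsto_of_forall_lip_integral ha hα0 hα1 (lam := lam) (φ := φ) fun f K hK hf => ?_⟩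
  have hfc := (dStar_isContPseudoDist (X := X) (lam := lam) (φ := φ) ha hα0 hα1).continuous_of_lip hf
  have hcau : CauchySeq fun n => ∫ x, f x ∂(μ n : Measure X) := by
    refine Metric.cauchySeq_iff.2 fun ε hε => ?_
    -- `K + 1` instead of `K` because `K` may be 0.
    obtain ⟨N, hN⟩ := h (ε / (K + 1)) (by positivity)
    refine ⟨N, fun m hm n hn => ?_⟩
    have h1 := abs_integral_sub_le_vaserstein ha hα0 hα1 (μ m) (μ n) hK hf
    have h2 := hN m hm n hn
    rw [lt_div_iff₀ (by positivity)] at h2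
    have h3 := vaserstein_nonneg (lam := lam) (φ := φ) ha hα0 hα1 (μ m) (μ n)
    rw [Real.dist_eq]
    nlinarith
  obtain ⟨L, hL⟩ := cauchySeq_tendsto_of_complete hcau
  have h1 : Tendsto (fun n => ∫ x, f x ∂(μ n : Measure X)) ((Ultrafilter.of atTop : Ultrafilter ℕ) : Filter ℕ)
      (𝓝 (∫ x, f x ∂(ν : Measure X))) :=
    probabilityMeasure_tendsto_iff.1 (show Tendsto μ _ _ from hν) ⟨f, hfc⟩
  rwa [tendsto_nhds_unique h1 (hL.mono_left (Ultrafilter.of_le atTop))]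

end Vaserstein

/-! ## Inverse branches -/

/-- The standing hypotheses on the maps `g i` and the potential `φ`. -/
structure RuelleSystem {X W : Type*} [MetricSpace X] (g : W → X → X) (φ : X → ℝ) (a lam : ℝ)
    (α : ℝ≥0) : Prop where
  ha : 0 < a
  hlam0 : 0 < lam
  hlam1 : lam < 1
  hα0 : 0 < α
  hα1 : α ≤ 1
  hcont : ∀ i, Continuous (g i)
  hsurj : ∀ i, Function.Surjective (g i)
  hexp : ∀ i, IsRuelleExpanding a lam (g i)
  hmix : JointlyMixing g
  hφ : MemHolder α φ

/-- The preimage of `y` under `T` that is close to `x`. -/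
def branch {X : Type*} [MetricSpace X] (a : ℝ) (T : X → X) (x y : X) : X :=
  @Classical.epsilon X ⟨x⟩ fun z => T z = y ∧ dist x z < a

theorem IsRuelleExpanding.branch_spec {X : Type*} [MetricSpace X] {a lam : ℝ} {T : X → X}
    (hT : IsRuelleExpanding a lam T) {x y : X} (h : dist (T x) y < a) :
    T (branch a T x y) = y ∧ dist x (branch a T x y) < a ∧
      dist x (branch a T x y) ≤ lam * dist (T x) y := by
  obtain ⟨z, ⟨hz1, hz2⟩, huniq, hd⟩ := hT (T x) y x h rfl
  have hs : T (branch a T x y) = y ∧ dist x (branch a T x y) < a :=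
    @Classical.epsilon_spec X (fun z => T z = y ∧ dist x z < a) ⟨z, hz1, hz2⟩
  refine ⟨hs.1, hs.2, ?_⟩
  rw [huniq _ hs]
  exact hd

theorem IsRuelleExpanding.eq_branch {X : Type*} [MetricSpace X] {a lam : ℝ} {T : X → X}
    (hT : IsRuelleExpanding a lam T) {x y z : X} (h : dist (T x) y < a) (hz : T z = y)
    (hd : dist x z < a) : branch a T x y = z := by
  obtain ⟨z', -, huniq, -⟩ := hT (T x) y x h rfl
  have hs := hT.branch_spec h
  rw [huniq _ ⟨hs.1, hs.2.1⟩, huniq _ ⟨hz, hd⟩]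

/-- The preimage of `y` under `T_w` that is obtained by following the orbit of `x`. -/
def branchWord {X W : Type*} [MetricSpace X] (g : W → X → X) (a : ℝ) : List W → X → X → X
  | [], _, y => y
  | i :: w, x, y => branch a (g i) x (branchWord g a w (g i x) y)

/-- The constant `D_α(φ) / (1 - lam^α)`. -/
def potConst {X : Type*} [MetricSpace X] (lam : ℝ) (α : ℝ≥0) (φ : X → ℝ) : ℝ :=
  (nnHolderNorm α φ : ℝ) / (1 - lam ^ (α : ℝ))

/-- The set of preimages of `x` under `T_w`, as a finite set. -/
def fiber {X W : Type*} (g : W → X → X) (w : List W) (x : X) : Finset X :=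
  open Classical in
  if h : {y | wordMap g w y = x}.Finite then h.toFinset else ∅

namespace RuelleSystem

variable {X W : Type*} [MetricSpace X] {g : W → X → X} {φ : X → ℝ} {a lam : ℝ} {α : ℝ≥0}

section Branches

variable (S : RuelleSystem g φ a lam α)
include S

/-- Branches do not increase distances, so the branch over the tail of the word stays within reach
of the branch for the first letter. The last clause makes branches in opposite directions mutually
inverse, hence bijections between fibers. -/
theorem branchWord_spec (w : List W) (x y : X) (h : dist (wordMap g w x) y < a) :
    wordMap g w (branchWord g a w x y) = y ∧
      dist x (branchWord g a w x y) ≤ lam ^ w.length * dist (wordMap g w x) y ∧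
      branchWord g a w (branchWord g a w x y) (wordMap g w x) = x := by
  induction w generalizing x with
  | nil => simp [wordMap, branchWord]
  | cons i w ih =>
    obtain ⟨h1, h2, h3⟩ := ih (g i x) h
    have h4 : dist (g i x) (branchWord g a w (g i x) y) < a :=
      h2.trans_lt ((mul_le_of_le_one_left dist_nonneg
        (pow_le_one₀ S.hlam0.le S.hlam1.le)).trans_lt h)
    obtain ⟨h5, h6, h7⟩ := (S.hexp i).branch_spec h4
    refine ⟨?_, ?_, ?_⟩
    · simp only [wordMap, branchWord]
      rw [h5, h1]
    · simp only [wordMap, branchWord, List.length_cons]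
      refine h7.trans ?_
      rw [pow_succ', mul_assoc]
      exact mul_le_mul_of_nonneg_left h2 S.hlam0.le
    · simp only [wordMap, branchWord]
      rw [h5, h3]
      refine (S.hexp i).eq_branch ?_ rfl ?_
      · rw [h5, dist_comm]
        exact h4
      · rw [dist_comm]
        exact h6

theorem wordMap_branchWord {w : List W} {x y : X} (h : dist (wordMap g w x) y < a) :
    wordMap g w (branchWord g a w x y) = y := (S.branchWord_spec w x y h).1

theorem dist_branchWord {w : List W} {x y : X} (h : dist (wordMap g w x) y < a) :
    dist x (branchWord g a w x y) ≤ lam ^ w.length * dist (wordMap g w x) y :=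
  (S.branchWord_spec w x y h).2.1

theorem dist_branchWord_le {w : List W} {x y : X} (h : dist (wordMap g w x) y < a) :
    dist x (branchWord g a w x y) ≤ dist (wordMap g w x) y :=
  (S.dist_branchWord h).trans (mul_le_of_le_one_left dist_nonneg
    (pow_le_one₀ S.hlam0.le S.hlam1.le))

theorem rpow_lam_lt_one : lam ^ (α : ℝ) < 1 :=
  Real.rpow_lt_one S.hlam0.le S.hlam1 S.hα0

theorem potConst_nonneg : 0 ≤ potConst lam α φ :=
  div_nonneg (NNReal.coe_nonneg _) (sub_nonneg.2 S.rpow_lam_lt_one.le)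

omit S in
theorem four_potConst_le : 4 * potConst lam α φ ≤ deltaConst a lam α φ := le_max_left _ _

theorem holder (x y : X) : |φ x - φ y| ≤ potConst lam α φ * (1 - lam ^ (α : ℝ)) *
    dist x y ^ (α : ℝ) := by
  have h := S.hφ.holderWith.dist_le x y
  rw [Real.dist_eq] at h
  rwa [potConst, div_mul_cancel₀ _ (sub_pos.2 S.rpow_lam_lt_one).ne']

theorem continuous_pot : Continuous φ := S.hφ.holderWith.continuous S.hα0

/-- Bounded distortion: the Hölder errors along the two orbits are summed by a geometric series,
uniformly in the word. -/
theorem wordPot_branchWord {w : List W} {x y : X} (h : dist (wordMap g w x) y < a) :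
    |wordPot g φ w x - wordPot g φ w (branchWord g a w x y)| ≤
      potConst lam α φ * dist (wordMap g w x) y ^ (α : ℝ) := by
  have ht0 : 0 < lam ^ (α : ℝ) := Real.rpow_pos_of_pos S.hlam0 _
  have ht1 := S.rpow_lam_lt_one
  have hC := S.potConst_nonneg
  -- With `t = lam^α`, the factor `1 - t^n` makes the induction close: the new letter adds at most
  -- `(1 - t) t^(n+1)`, and the slack is `t^n (1 - t)^2 ≥ 0`.
  suffices H : |wordPot g φ w x - wordPot g φ w (branchWord g a w x y)| ≤
      potConst lam α φ * (1 - (lam ^ (α : ℝ)) ^ w.length) *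
        dist (wordMap g w x) y ^ (α : ℝ) by
    refine H.trans (mul_le_mul_of_nonneg_right (mul_le_of_le_one_right hC ?_) (by positivity))
    have : 0 ≤ (lam ^ (α : ℝ)) ^ w.length := by positivity
    linarith
  induction w generalizing x with
  | nil => simp [wordPot]
  | cons i w ih =>
    have h1 := ih (x := g i x) h
    have h2 := S.dist_branchWord (w := w) (x := g i x) h
    have h4 : dist (g i x) (branchWord g a w (g i x) y) < a :=
      (S.dist_branchWord_le (w := w) (x := g i x) h).trans_lt h
    have h5 := (S.hexp i).branch_spec h4
    have h6 := S.holder x (branchWord g a (i :: w) x y)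
    have h7 : dist x (branchWord g a (i :: w) x y) ≤
        lam ^ (w.length + 1) * dist (wordMap g w (g i x)) y :=
      S.dist_branchWord (w := i :: w) h
    have h8 : dist x (branchWord g a (i :: w) x y) ^ (α : ℝ) ≤
        (lam ^ (α : ℝ)) ^ (w.length + 1) * dist (wordMap g w (g i x)) y ^ (α : ℝ) := by
      refine (Real.rpow_le_rpow dist_nonneg h7 α.2).trans_eq ?_
      rw [Real.mul_rpow (pow_nonneg S.hlam0.le _) dist_nonneg, Real.rpow_pow_comm S.hlam0.le]
      rfl
    simp only [wordPot, wordMap, branchWord, List.length_cons] at *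
    rw [h5.1]
    set t := lam ^ (α : ℝ)
    set C := potConst lam α φ
    set d := dist (wordMap g w (g i x)) y ^ (α : ℝ)
    have hd : 0 ≤ d := by positivity
    have h9 := h6.trans (mul_le_mul_of_nonneg_left h8 (mul_nonneg hC (sub_nonneg.2 ht1.le)))
    have h10 : 0 ≤ C * d * t ^ w.length * (1 - t) ^ 2 := by positivity
    rw [abs_le] at *
    rw [pow_succ] at *
    constructor <;> nlinarith

/-! ### Expansion rates of the maps `T_w`. -/

/-- For points close enough, uniform continuity keeps the images within `a`, and uniqueness
identifies `y` with the branch that follows the orbit of `x`. -/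
theorem expanding_near [CompactSpace X] (w : List W) : ∃ ε > 0, ∀ x y, dist x y < ε →
    dist x y ≤ lam ^ w.length * dist (wordMap g w x) (wordMap g w y) := by
  induction w with
  | nil => exact ⟨1, one_pos, fun x y _ => by simp [wordMap]⟩
  | cons i w ih =>
    obtain ⟨ε, hε, h⟩ := ih
    obtain ⟨δ, hδ, hd⟩ := Metric.uniformContinuous_iff.1
      (CompactSpace.uniformContinuous_of_continuous (S.hcont i)) (min ε a) (lt_min hε S.ha)
    refine ⟨min δ a, lt_min hδ S.ha, fun x y hxy => ?_⟩
    have h1 := hd (hxy.trans_le (min_le_left _ _))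
    have h2 := h _ _ (h1.trans_le (min_le_left _ _))
    have h3 := h1.trans_le (min_le_right _ _)
    have h4 := ((S.hexp i).branch_spec h3).2.2
    rw [(S.hexp i).eq_branch h3 rfl (hxy.trans_le (min_le_right _ _))] at h4
    refine h4.trans ?_
    rw [List.length_cons, pow_succ', mul_assoc]
    exact mul_le_mul_of_nonneg_left h2 S.hlam0.le

theorem kappa_inv_le [CompactSpace X] (w : List W) :
    (kappa (wordMap g w))⁻¹ ≤ ENNReal.ofReal (lam ^ w.length) := by
  obtain ⟨ε, hε, h⟩ := S.expanding_near w
  rw [ENNReal.inv_le_iff_inv_le]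
  refine le_iSup₂_of_le ε hε (le_iInf₂ fun x y => le_iInf fun hxy => ?_)
  have h1 := h x y hxy.2
  have hl : 0 < lam ^ w.length := pow_pos S.hlam0 _
  have h0 : edist x y ≠ 0 := by
    rw [edist_dist]
    simpa using hxy.1
  rw [ENNReal.le_div_iff_mul_le (.inl h0) (.inl (edist_ne_top _ _)), mul_comm, ← div_eq_mul_inv]
  refine ENNReal.div_le_of_le_mul ?_
  rw [edist_dist, edist_dist, mul_comm, ← ENNReal.ofReal_mul hl.le]
  exact ENNReal.ofReal_le_ofReal h1

end Branches

/-! ## Preimages -/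

section Fibers

variable [CompactSpace X]

/-- Each ball of radius `a / 2` of a finite cover contains at most one point of an `a`-separated
set. The bound is uniform over all fibers of single letters. -/
theorem exists_bound_card_separated (X : Type*) [MetricSpace X] [CompactSpace X] {a : ℝ}
    (ha : 0 < a) : ∃ N : ℕ, ∀ s : Set X, (∀ x ∈ s, ∀ y ∈ s, dist x y < a → x = y) →
      s.Finite ∧ s.ncard ≤ N := by
  obtain ⟨t, ht, hcov⟩ := Metric.totallyBounded_iff.1 (isCompact_univ (X := X)).totallyBounded
    (a / 2) (by positivity)
  refine ⟨t.ncard, fun s hs => ?_⟩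
  have hx : ∀ x : X, ∃ y ∈ t, dist x y < a / 2 := fun x => by simpa using hcov (mem_univ x)
  choose f hf hd using hx
  have hinj : InjOn f s := fun x hx y hy hxy => hs x hx y hy <| by
    have h1 := hd x
    have h2 := hd y
    rw [hxy] at h1
    have h3 := dist_triangle_right x y (f y)
    linarith
  exact ⟨Set.Finite.of_finite_image (ht.subset (by rintro _ ⟨x, -, rfl⟩; exact hf x)) hinj,
    Set.ncard_le_ncard_of_injOn f (fun x _ => hf x) hinj ht⟩

variable (S : RuelleSystem g φ a lam α)
include S

omit [CompactSpace X] in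
theorem separated_preimage (i : W) (z : X) :
    ∀ x ∈ {y | g i y = z}, ∀ y ∈ {y | g i y = z}, dist x y < a → x = y := by
  intro x hx y hy hxy
  have hx' : g i x = z := hx
  have h : dist (g i x) z < a := by rw [hx', dist_self]; exact S.ha
  exact ((S.hexp i).eq_branch h hx' (by simpa using S.ha)).symm.trans
    ((S.hexp i).eq_branch h hy hxy)

theorem finite_preimage (w : List W) (x : X) : {y | wordMap g w y = x}.Finite := by
  obtain ⟨N, hN⟩ := exists_bound_card_separated X S.ha
  induction w with
  | nil => simp [wordMap]
  | cons i w ih =>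
    exact ih.preimage' (f := g i) fun z _ => (hN _ (S.separated_preimage i z)).1

theorem mem_fiber {w : List W} {x y : X} : y ∈ fiber g w x ↔ wordMap g w y = x := by
  rw [fiber, dif_pos (S.finite_preimage w x)]
  simp

omit [CompactSpace X] in
theorem wordMap_surjective (w : List W) : Function.Surjective (wordMap g w) := by
  induction w with
  | nil => exact fun x => ⟨x, rfl⟩
  | cons i w ih => exact ih.comp (S.hsurj i)

theorem fiber_nonempty (w : List W) (x : X) : (fiber g w x).Nonempty := by
  obtain ⟨y, hy⟩ := S.wordMap_surjective w x
  exact ⟨y, S.mem_fiber.2 hy⟩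

theorem card_fiber_singleton_le : ∃ N : ℕ, ∀ i x, (fiber g [i] x).card ≤ N := by
  obtain ⟨N, hN⟩ := exists_bound_card_separated X S.ha
  refine ⟨N, fun i x => ?_⟩
  refine le_trans (le_of_eq ?_) (hN _ (S.separated_preimage i x)).2
  rw [← Set.ncard_coe_finset]
  congr 1
  ext y
  simp [S.mem_fiber, wordMap]

theorem branchWord_mem_fiber {w : List W} {x y x' : X} (h : dist x y < a) (hx : x' ∈ fiber g w x) :
    branchWord g a w x' y ∈ fiber g w y := by
  rw [S.mem_fiber] at hx ⊢
  subst hx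
  exact S.wordMap_branchWord h

/-- The inverse branches identify the preimages of two close points. -/
theorem sum_fiber_branchWord {w : List W} {x y : X} (h : dist x y < a) (F : X → ℝ) :
    ∑ y' ∈ fiber g w y, F y' = ∑ x' ∈ fiber g w x, F (branchWord g a w x' y) := by
  have h' : dist y x < a := by rwa [dist_comm]
  have hinv : ∀ {x y x' : X}, dist x y < a → x' ∈ fiber g w x →
      branchWord g a w (branchWord g a w x' y) x = x' := by
    intro x y x' h hx
    rw [S.mem_fiber] at hx
    subst hx
    exact (S.branchWord_spec w x' y h).2.2
  exact Finset.sum_nbij' (fun y' => branchWord g a w y' x) (fun x' => branchWord g a w x' y)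
    (fun y' hy => S.branchWord_mem_fiber h' hy) (fun x' hx => S.branchWord_mem_fiber h hx)
    (fun y' hy => hinv h' hy) (fun x' hx => hinv h hx) (fun y' hy => by rw [hinv h' hy])

/-- The preimages of every point under long words are dense at every given scale. -/
theorem exists_fiber_dense {r : ℝ} (hr : 0 < r) : ∃ m : ℕ, ∀ w : List W, m ≤ w.length →
    ∀ x z, ∃ y ∈ fiber g w x, dist z y < r := by
  -- Mixing is applied to the finitely many pairs from a net, which makes the length uniform. The
  -- orbit it supplies ends within `a` of `x`, so a branch moves its starting point into the fiber,
  -- by less than `r / 2` for long words.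
  obtain ⟨t, ht, hcov⟩ := Metric.totallyBounded_iff.1 (isCompact_univ (X := X)).totallyBounded
    (min (a / 2) (r / 4)) (lt_min (half_pos S.ha) (by positivity))
  have hx : ∀ x : X, ∃ y ∈ t, dist x y < min (a / 2) (r / 4) := fun x =>
    mem_iUnion₂.1 (hcov (mem_univ x)) |>.imp fun y hy => ⟨hy.1, hy.2⟩
  obtain ⟨m₀, hm₀⟩ := exists_pow_lt_of_lt_one (show 0 < r / 2 / a from div_pos (by positivity) S.ha)
    S.hlam1
  have hm : ∀ p : X × X, ∃ m : ℕ, ∀ w : List W, m ≤ w.length →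
      (wordMap g w ⁻¹' Metric.ball p.1 (a / 2) ∩ Metric.ball p.2 (r / 4)).Nonempty := fun p =>
    S.hmix _ _ Metric.isOpen_ball ⟨p.1, Metric.mem_ball_self (half_pos S.ha)⟩
      Metric.isOpen_ball ⟨p.2, Metric.mem_ball_self (by positivity)⟩
  choose M hM using hm
  have htt : (t ×ˢ t).Finite := ht.prod ht
  obtain ⟨m₁, hm₁⟩ := (htt.image M).bddAbove
  refine ⟨max m₀ m₁, fun w hw x z => ?_⟩
  obtain ⟨x', hx', hxd⟩ := hx x
  obtain ⟨z', hz', hzd⟩ := hx z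
  obtain ⟨q, hq1, hq2⟩ := hM (x', z') w
    ((hm₁ ⟨_, ⟨hx', hz'⟩, rfl⟩).trans ((le_max_right _ _).trans hw))
  have hq1' : dist (wordMap g w q) x' < a / 2 := hq1
  have hq2' : dist q z' < r / 4 := hq2
  have h1 : dist (wordMap g w q) x < a := by
    have h2 := dist_triangle_right (wordMap g w q) x x'
    have h3 := hxd.trans_le (min_le_left _ _)
    linarith
  refine ⟨branchWord g a w q x, S.mem_fiber.2 (S.wordMap_branchWord h1), ?_⟩
  have h4 := S.dist_branchWord h1
  have h5 : lam ^ w.length ≤ lam ^ m₀ :=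
    pow_le_pow_of_le_one S.hlam0.le S.hlam1.le ((le_max_left _ _).trans hw)
  have h6 : lam ^ w.length * dist (wordMap g w q) x ≤ r / 2 / a * a :=
    mul_le_mul (h5.trans hm₀.le) h1.le dist_nonneg (by have := S.ha; positivity)
  rw [div_mul_cancel₀ _ S.ha.ne'] at h6
  have h7 := dist_triangle z z' q
  have h8 := dist_triangle z q (branchWord g a w q x)
  have h9 := hzd.trans_le (min_le_right _ _)
  rw [dist_comm q z'] at hq2'
  linarith

end Fibers

end RuelleSystem

/-! ## Ruelle operators and quotient operators -/

/-- The function `L_w(1)`. -/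
def ruelleMass {X W : Type*} (g : W → X → X) (φ : X → ℝ) (w : List W) : X → ℝ :=
  ruelleOp g φ w fun _ => 1

/-- The mass of the atom at `y` of the measure that represents `f ↦ P_u^v(f)(x)`. -/
def quotientWeight {X W : Type*} (g : W → X → X) (φ : X → ℝ) (u v : List W) (x y : X) : ℝ :=
  Real.exp (wordPot g φ v y) * ruelleMass g φ u y / ruelleMass g φ (u ++ v) x

theorem ruelleOp_congr_of_eq {X W : Type*} {g : W → X → X} {φ : X → ℝ} {w w' : List W}
    (h1 : wordMap g w = wordMap g w') (h2 : wordPot g φ w = wordPot g φ w') :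
    ruelleOp g φ w = ruelleOp g φ w' := by
  funext f x
  rw [ruelleOp, ruelleOp, h2, h1]

namespace RuelleSystem

variable {X W : Type*} [MetricSpace X] [CompactSpace X] {g : W → X → X} {φ : X → ℝ} {a lam : ℝ}
  {α : ℝ≥0} (S : RuelleSystem g φ a lam α)
include S

theorem ruelleOp_eq_sum (w : List W) (f : X → ℝ) (x : X) :
    ruelleOp g φ w f x = ∑ y ∈ fiber g w x, Real.exp (wordPot g φ w y) * f y := by
  rw [← Finset.tsum_subtype]
  exact (Equiv.subtypeEquivRight fun y => (S.mem_fiber (w := w) (x := x) (y := y)).symm).tsum_eq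
    fun y : {y // y ∈ fiber g w x} => Real.exp (wordPot g φ w y) * f y

/-- The preimages under `T_{uv}` are grouped by their image under `T_u`. -/
theorem ruelleOp_append (u v : List W) (f : X → ℝ) (x : X) :
    ruelleOp g φ (u ++ v) f x = ruelleOp g φ v (ruelleOp g φ u f) x := by
  classical
  rw [S.ruelleOp_eq_sum, S.ruelleOp_eq_sum, ← Finset.sum_fiberwise_of_maps_to
    (s := fiber g (u ++ v) x) (t := fiber g v x) (g := wordMap g u)]
  · refine Finset.sum_congr rfl fun z hz => ?_
    rw [S.ruelleOp_eq_sum, Finset.mul_sum]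
    have hs : (fiber g (u ++ v) x).filter (fun y => wordMap g u y = z) = fiber g u z := by
      ext y
      rw [Finset.mem_filter, S.mem_fiber, S.mem_fiber, wordMap_append]
      rw [S.mem_fiber] at hz
      constructor
      · exact fun h => h.2
      · rintro rfl
        exact ⟨hz, rfl⟩
    rw [hs]
    refine Finset.sum_congr rfl fun y hy => ?_
    rw [S.mem_fiber] at hy
    rw [wordPot_append, hy, Real.exp_add]
    ring
  · intro y hy
    rw [S.mem_fiber, wordMap_append] at hy
    exact S.mem_fiber.2 hy

theorem ruelleMass_append (u v : List W) (x : X) :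
    ruelleMass g φ (u ++ v) x = ruelleOp g φ v (ruelleMass g φ u) x :=
  S.ruelleOp_append u v _ x

theorem ruelleMass_eq_sum (w : List W) (x : X) :
    ruelleMass g φ w x = ∑ y ∈ fiber g w x, Real.exp (wordPot g φ w y) := by
  rw [ruelleMass, S.ruelleOp_eq_sum]
  simp

theorem ruelleMass_pos (w : List W) (x : X) : 0 < ruelleMass g φ w x := by
  rw [S.ruelleMass_eq_sum]
  exact Finset.sum_pos (fun _ _ => Real.exp_pos _) (S.fiber_nonempty w x)

theorem ruelleMass_nil (x : X) : ruelleMass g φ [] x = 1 := by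
  have : fiber g ([] : List W) x = {x} := by
    ext y
    simp [S.mem_fiber, wordMap]
  rw [S.ruelleMass_eq_sum, this]
  simp [wordPot]

theorem ruelleOp_mono (w : List W) {f h : X → ℝ} (hfh : ∀ x, f x ≤ h x) (x : X) :
    ruelleOp g φ w f x ≤ ruelleOp g φ w h x := by
  rw [S.ruelleOp_eq_sum, S.ruelleOp_eq_sum]
  exact Finset.sum_le_sum fun y _ => mul_le_mul_of_nonneg_left (hfh y) (Real.exp_pos _).le

theorem ruelleOp_const_mul (w : List W) (r : ℝ) (f : X → ℝ) (x : X) :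
    ruelleOp g φ w (fun y => r * f y) x = r * ruelleOp g φ w f x := by
  rw [S.ruelleOp_eq_sum, S.ruelleOp_eq_sum, Finset.mul_sum]
  exact Finset.sum_congr rfl fun y _ => by ring

theorem ruelleOp_const (w : List W) (r : ℝ) (x : X) :
    ruelleOp g φ w (fun _ => r) x = r * ruelleMass g φ w x := by
  rw [ruelleMass, ← S.ruelleOp_const_mul]
  simp

theorem exists_pot_bound : ∃ B : ℝ, 0 ≤ B ∧ ∀ x, |φ x| ≤ B := by
  obtain ⟨B, hB⟩ := isCompact_univ.exists_bound_of_continuousOn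
    (S.continuous_pot.continuousOn (s := univ))
  exact ⟨max B 0, le_max_right _ _, fun x => (hB x (mem_univ x)).trans (le_max_left _ _)⟩

omit [MetricSpace X] [CompactSpace X] S in
theorem abs_wordPot_le {B : ℝ} (hB : ∀ x, |φ x| ≤ B) (w : List W) (x : X) :
    |wordPot g φ w x| ≤ w.length * B := by
  induction w generalizing x with
  | nil => simp [wordPot]
  | cons i w ih =>
    simp only [wordPot, List.length_cons, Nat.cast_add, Nat.cast_one]
    have h1 := abs_add_le (φ x) (wordPot g φ w (g i x))
    have h2 := ih (g i x)
    have h3 := hB x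
    linarith

theorem exists_ruelleMass_le : ∃ M : ℝ, 1 ≤ M ∧ ∀ (w : List W) (x : X),
    ruelleMass g φ w x ≤ M ^ w.length := by
  obtain ⟨B, hB0, hB⟩ := S.exists_pot_bound
  obtain ⟨N, hN⟩ := S.card_fiber_singleton_le
  refine ⟨max 1 (N * Real.exp B), le_max_left _ _, fun w => ?_⟩
  have h1 : ∀ i x, ruelleMass g φ [i] x ≤ max 1 (N * Real.exp B) := fun i x => by
    refine le_max_of_le_right ?_
    rw [S.ruelleMass_eq_sum]
    refine (Finset.sum_le_card_nsmul _ _ (Real.exp B) fun y _ => ?_).trans ?_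
    · simpa [wordPot] using le_of_abs_le (hB y)
    · rw [nsmul_eq_mul]
      exact mul_le_mul_of_nonneg_right (by exact_mod_cast hN i x) (Real.exp_pos _).le
  induction w with
  | nil => intro x; simp [S.ruelleMass_nil]
  | cons i w ih =>
    intro x
    rw [← List.singleton_append, S.ruelleMass_append]
    refine (S.ruelleOp_mono w (h1 i) x).trans ?_
    rw [S.ruelleOp_const, List.singleton_append, List.length_cons, pow_succ']
    exact mul_le_mul_of_nonneg_left (ih x) (zero_le_one.trans (le_max_left _ _))

omit [CompactSpace X] in
theorem exp_wordPot_branchWord_le {w : List W} {x y : X} (h : dist (wordMap g w x) y < a) :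
    Real.exp (wordPot g φ w x) ≤
      Real.exp (potConst lam α φ * dist (wordMap g w x) y ^ (α : ℝ)) *
        Real.exp (wordPot g φ w (branchWord g a w x y)) := by
  rw [← Real.exp_add]
  refine Real.exp_le_exp.2 ?_
  have := (abs_le.1 (S.wordPot_branchWord h)).2
  linarith

/-- Inverse branches match the terms of the two sums, and bounded distortion compares matched terms.
-/
theorem ruelleMass_le_of_dist_lt (w : List W) {x y : X} (h : dist x y < a) :
    ruelleMass g φ w x ≤ Real.exp (potConst lam α φ * dist x y ^ (α : ℝ)) * ruelleMass g φ w y := by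
  rw [S.ruelleMass_eq_sum, S.ruelleMass_eq_sum, S.sum_fiber_branchWord h, Finset.mul_sum]
  refine Finset.sum_le_sum fun x' hx => ?_
  rw [S.mem_fiber] at hx
  subst hx
  exact S.exp_wordPot_branchWord_le h

/-- The functions `L_w(1)` have uniformly bounded quotients. -/
theorem exists_ruelleMass_le_mul : ∃ K : ℝ, 1 ≤ K ∧ ∀ (w : List W) (x y : X),
    ruelleMass g φ w x ≤ K * ruelleMass g φ w y := by
  obtain ⟨B, hB0, hB⟩ := S.exists_pot_bound
  obtain ⟨M, hM1, hM⟩ := S.exists_ruelleMass_le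
  obtain ⟨m, hm⟩ := S.exists_fiber_dense S.ha
  have hC := S.potConst_nonneg
  have ha := S.ha
  set E := Real.exp (potConst lam α φ * a ^ (α : ℝ)) with hE
  have hE1 : 1 ≤ E := Real.one_le_exp (by positivity)
  have hB1 : 1 ≤ Real.exp (m * B) := Real.one_le_exp (by positivity)
  have hMm : 1 ≤ M ^ m := one_le_pow₀ hM1
  refine ⟨M ^ m * (E * Real.exp (m * B)), ?_, fun w x y => ?_⟩
  · exact one_le_mul_of_one_le_of_one_le hMm (one_le_mul_of_one_le_of_one_le hE1 hB1)
  · have hlow : ∀ w : List W, w.length ≤ m → ∀ z,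
        1 ≤ Real.exp (m * B) * Real.exp (wordPot g φ w z) := fun w hw z => by
      rw [← Real.exp_add]
      refine Real.one_le_exp ?_
      have h1 := (abs_le.1 (abs_wordPot_le (g := g) hB w z)).1
      have h2 : (w.length : ℝ) * B ≤ m * B :=
        mul_le_mul_of_nonneg_right (by exact_mod_cast hw) hB0
      linarith
    -- For short words both sides are bounded by constants; density of preimages is needed only for
    -- long words.
    rcases lt_or_ge w.length m with hw | hw
    · have h1 : ruelleMass g φ w x ≤ M ^ m := (hM w x).trans (pow_le_pow_right₀ hM1 hw.le)
      obtain ⟨z, hz⟩ := S.fiber_nonempty w y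
      have h2 : Real.exp (wordPot g φ w z) ≤ ruelleMass g φ w y := by
        rw [S.ruelleMass_eq_sum]
        exact Finset.single_le_sum (f := fun z => Real.exp (wordPot g φ w z))
          (fun _ _ => (Real.exp_pos _).le) hz
      have h3 : 1 ≤ E * Real.exp (m * B) * ruelleMass g φ w y := by
        rw [mul_assoc]
        refine one_le_mul_of_one_le_of_one_le hE1 ((hlow w hw.le z).trans ?_)
        exact mul_le_mul_of_nonneg_left h2 (Real.exp_pos _).le
      rw [mul_assoc]
      exact h1.trans (le_mul_of_one_le_right (by positivity) h3)
    -- The last `m` letters are split off: some preimage of `y` under `T_v` lies within `a` of any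
    -- given `z`, and its single term in `L_{uv}(1)(y)` already controls `L_u(1)(z)`.
    · obtain ⟨u, v, rfl, hv⟩ : ∃ u v : List W, w = u ++ v ∧ v.length = m :=
        ⟨w.take (w.length - m), w.drop (w.length - m), by simp, by simp; omega⟩
      rw [S.ruelleMass_append u v x]
      have h1 : ∀ z, ruelleMass g φ u z ≤
          E * Real.exp (m * B) * ruelleMass g φ (u ++ v) y := by
        intro z
        obtain ⟨z', hz', hzz⟩ := hm v hv.ge y z
        have h2 : ruelleMass g φ u z ≤ E * ruelleMass g φ u z' := by
          refine (S.ruelleMass_le_of_dist_lt u hzz).trans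
            (mul_le_mul_of_nonneg_right ?_ (S.ruelleMass_pos u z').le)
          refine Real.exp_le_exp.2 (mul_le_mul_of_nonneg_left ?_ hC)
          exact Real.rpow_le_rpow dist_nonneg hzz.le α.2
        have h3 : Real.exp (wordPot g φ v z') * ruelleMass g φ u z' ≤
            ruelleMass g φ (u ++ v) y := by
          rw [S.ruelleMass_append, S.ruelleOp_eq_sum]
          exact Finset.single_le_sum
            (f := fun z => Real.exp (wordPot g φ v z) * ruelleMass g φ u z)
            (fun z _ => (mul_pos (Real.exp_pos _) (S.ruelleMass_pos u z)).le) hz'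
        have h4 := hlow v hv.le z'
        have h5 : ruelleMass g φ u z' ≤ Real.exp (m * B) * ruelleMass g φ (u ++ v) y := by
          refine (le_mul_of_one_le_left (S.ruelleMass_pos u z').le h4).trans ?_
          rw [mul_assoc]
          exact mul_le_mul_of_nonneg_left h3 (Real.exp_pos _).le
        rw [mul_assoc]
        exact h2.trans (mul_le_mul_of_nonneg_left h5 (zero_le_one.trans hE1))
      refine (S.ruelleOp_mono v h1 x).trans ?_
      rw [S.ruelleOp_const, mul_comm, ← hv, mul_assoc (M ^ v.length)]
      refine mul_le_mul_of_nonneg_right (hM v x) ?_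
      exact mul_nonneg (by positivity) (S.ruelleMass_pos _ y).le

/-- Near `x` the fiber over `y` is the image of the fixed fiber over `x` under branches, which tend
to the identity as `y → x`. -/
theorem continuous_ruelleOp (w : List W) {f : X → ℝ} (hf : Continuous f) :
    Continuous (ruelleOp g φ w f) := by
  have hcw : Continuous (wordPot g φ w) := by
    clear hf
    induction w with
    | nil => exact continuous_const
    | cons i w ih => exact S.continuous_pot.add (ih.comp (S.hcont i))
  refine continuous_iff_continuousAt.2 fun x => ?_
  have h1 : ∀ᶠ y in 𝓝 x, dist x y < a := by
    filter_upwards [Metric.ball_mem_nhds x S.ha] with y hy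
    rwa [dist_comm]
  have h2 : ruelleOp g φ w f =ᶠ[𝓝 x] fun y => ∑ x' ∈ fiber g w x,
      Real.exp (wordPot g φ w (branchWord g a w x' y)) * f (branchWord g a w x' y) := by
    filter_upwards [h1] with y hy
    rw [S.ruelleOp_eq_sum, S.sum_fiber_branchWord hy fun z => Real.exp (wordPot g φ w z) * f z]
  rw [ContinuousAt, S.ruelleOp_eq_sum]
  refine Tendsto.congr' h2.symm (tendsto_finsetSum _ fun x' hx => ?_)
  have h3 : Tendsto (fun y => branchWord g a w x' y) (𝓝 x) (𝓝 x') := by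
    refine tendsto_iff_dist_tendsto_zero.2 (squeeze_zero' (.of_forall fun _ => dist_nonneg) ?_
      (show Tendsto (fun y => dist x y) (𝓝 x) (𝓝 0) by
        simpa using (continuous_const.dist continuous_id : Continuous fun y => dist x y).tendsto x))
    filter_upwards [h1] with y hy
    rw [S.mem_fiber] at hx
    subst hx
    rw [dist_comm]
    exact S.dist_branchWord_le hy
  exact ((Real.continuous_exp.comp hcw).mul hf).tendsto x' |>.comp h3

/-! ### Quotient operators -/

theorem quotientOp_eq_sum (u v : List W) (f : X → ℝ) (x : X) :
    quotientOp g φ u v f x = ∑ y ∈ fiber g v x, quotientWeight g φ u v x y * f y := by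
  rw [quotientOp, S.ruelleOp_eq_sum, Finset.sum_div]
  refine Finset.sum_congr rfl fun y _ => ?_
  rw [quotientWeight, ruelleMass, ruelleMass]
  ring

theorem quotientWeight_pos (u v : List W) (x y : X) : 0 < quotientWeight g φ u v x y :=
  div_pos (mul_pos (Real.exp_pos _) (S.ruelleMass_pos _ _)) (S.ruelleMass_pos _ _)

theorem sum_quotientWeight (u v : List W) (x : X) :
    ∑ y ∈ fiber g v x, quotientWeight g φ u v x y = 1 := by
  simp only [quotientWeight]
  rw [← Finset.sum_div, ← S.ruelleOp_eq_sum, ← S.ruelleMass_append]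
  exact div_self (S.ruelleMass_pos _ _).ne'

theorem quotientOp_le (u v : List W) {f : X → ℝ} {M : ℝ} (hf : ∀ x, f x ≤ M) (x : X) :
    quotientOp g φ u v f x ≤ M := by
  rw [S.quotientOp_eq_sum]
  refine (Finset.sum_le_sum fun y _ =>
    mul_le_mul_of_nonneg_left (hf y) (S.quotientWeight_pos u v x y).le).trans_eq ?_
  rw [← Finset.sum_mul, S.sum_quotientWeight, one_mul]

theorem le_quotientOp (u v : List W) {f : X → ℝ} {M : ℝ} (hf : ∀ x, M ≤ f x) (x : X) :
    M ≤ quotientOp g φ u v f x := by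
  rw [S.quotientOp_eq_sum]
  refine (Eq.trans ?_ (Finset.sum_mul _ _ M)).trans_le (Finset.sum_le_sum fun y _ =>
    mul_le_mul_of_nonneg_left (hf y) (S.quotientWeight_pos u v x y).le)
  rw [S.sum_quotientWeight, one_mul]

theorem quotientOp_sub (u v : List W) (f h : X → ℝ) (x : X) :
    quotientOp g φ u v (fun y => f y - h y) x =
      quotientOp g φ u v f x - quotientOp g φ u v h x := by
  rw [S.quotientOp_eq_sum, S.quotientOp_eq_sum, S.quotientOp_eq_sum, ← Finset.sum_sub_distrib]
  exact Finset.sum_congr rfl fun y _ => by ring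

theorem quotientOp_add (u v : List W) (f h : X → ℝ) (x : X) :
    quotientOp g φ u v (fun y => f y + h y) x =
      quotientOp g φ u v f x + quotientOp g φ u v h x := by
  rw [S.quotientOp_eq_sum, S.quotientOp_eq_sum, S.quotientOp_eq_sum, ← Finset.sum_add_distrib]
  exact Finset.sum_congr rfl fun y _ => by ring

theorem quotientOp_const_mul (u v : List W) (r : ℝ) (f : X → ℝ) (x : X) :
    quotientOp g φ u v (fun y => r * f y) x = r * quotientOp g φ u v f x := by
  rw [S.quotientOp_eq_sum, S.quotientOp_eq_sum, Finset.mul_sum]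
  exact Finset.sum_congr rfl fun y _ => by ring

theorem quotientOp_const (u v : List W) (r : ℝ) (x : X) :
    quotientOp g φ u v (fun _ => r) x = r :=
  le_antisymm (S.quotientOp_le u v (fun _ => le_rfl) x) (S.le_quotientOp u v (fun _ => le_rfl) x)

theorem abs_quotientOp_le (u v : List W) {f : X → ℝ} {M : ℝ} (hf : ∀ x, |f x| ≤ M) (x : X) :
    |quotientOp g φ u v f x| ≤ M :=
  abs_le.2 ⟨S.le_quotientOp u v (fun x => (abs_le.1 (hf x)).1) x,
    S.quotientOp_le u v (fun x => (abs_le.1 (hf x)).2) x⟩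

theorem continuous_quotientOp (u v : List W) {f : X → ℝ} (hf : Continuous f) :
    Continuous (quotientOp g φ u v f) :=
  (S.continuous_ruelleOp v (hf.mul (S.continuous_ruelleOp u continuous_const))).div
    (S.continuous_ruelleOp _ continuous_const) fun x => (S.ruelleMass_pos _ x).ne'

/-- The cocycle rule: the denominator of the inner operator cancels against the weight `L_{uv}(1)`
of the outer one. The left word grows, which is why contraction must be uniform in it. -/
theorem quotientOp_append (u v w : List W) (f : X → ℝ) (x : X) :
    quotientOp g φ u (v ++ w) f x = quotientOp g φ (u ++ v) w (quotientOp g φ u v f) x := by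
  simp only [quotientOp]
  rw [S.ruelleOp_append, List.append_assoc]
  congr 2
  funext y
  exact (div_mul_cancel₀ _ (S.ruelleMass_pos (u ++ v) y).ne').symm

/-- Prefixing `t` reweights by the density `L_{tp}(1) / L_p(1) = P_∅^p(L_t(1))`; the second factor
on the left is its normalization. -/
theorem quotientOp_append_left_mul (t p v : List W) (f : X → ℝ) (x : X) :
    quotientOp g φ (t ++ p) v f x *
        quotientOp g φ p v (quotientOp g φ [] p (ruelleMass g φ t)) x =
      quotientOp g φ p v (fun y => f y * quotientOp g φ [] p (ruelleMass g φ t) y) x := by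
  have h1 : ∀ y, quotientOp g φ [] p (ruelleMass g φ t) y * ruelleMass g φ p y =
      ruelleMass g φ (t ++ p) y := fun y => by
    rw [S.ruelleMass_append, quotientOp, List.nil_append]
    rw [show ruelleOp g φ p (fun _ => 1) y = ruelleMass g φ p y from rfl,
      div_mul_cancel₀ _ (S.ruelleMass_pos p y).ne']
    congr 1
    funext z
    rw [show ruelleOp g φ [] (fun _ => 1) z = ruelleMass g φ [] z from rfl, S.ruelleMass_nil,
      mul_one]
  have h2 : ∀ y, quotientOp g φ [] p (ruelleMass g φ t) y * ruelleOp g φ p (fun _ => 1) y =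
      ruelleOp g φ (t ++ p) (fun _ => 1) y := h1
  have h3 : ruelleOp g φ v (ruelleOp g φ (t ++ p) fun _ => 1) x =
      ruelleMass g φ (t ++ p ++ v) x := (S.ruelleMass_append _ _ x).symm
  have h4 := (S.ruelleMass_pos (t ++ p ++ v) x).ne'
  simp only [quotientOp, mul_assoc] at h2 h3 ⊢
  simp only [h2, h3]
  rw [show ruelleOp g φ (t ++ p ++ v) (fun _ => 1) x = ruelleMass g φ (t ++ p ++ v) x from rfl]
  field_simp

end RuelleSystem

/-! ## Contraction by quotient operators -/

theorem exists_interval_of_osc_le {X : Type*} [Nonempty X] {f : X → ℝ} {K : ℝ}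
    (hf : ∀ x y, f x - f y ≤ K) : ∃ m, ∀ x, m ≤ f x ∧ f x ≤ m + K := by
  obtain ⟨x₀⟩ := ‹Nonempty X›
  have : Nonempty X := ⟨x₀⟩
  have hb : BddBelow (range f) := ⟨f x₀ - K, by
    rintro _ ⟨y, rfl⟩
    have := hf x₀ y
    linarith⟩
  refine ⟨⨅ x, f x, fun x => ⟨ciInf_le hb x, ?_⟩⟩
  have : f x - K ≤ ⨅ x, f x := le_ciInf fun y => by
    have := hf x y
    linarith
  linarith

/-- Comparison of the averages of two close functions for two weights with bounded quotient. -/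
theorem sum_mul_sub_sum_mul_le {ι : Type*} {s : Finset ι} {p q f h : ι → ℝ} {θ ε m K : ℝ}
    (hp : ∀ i ∈ s, 0 ≤ p i) (hp1 : ∑ i ∈ s, p i = 1) (hq : ∀ i ∈ s, 0 ≤ q i)
    (hq1 : ∑ i ∈ s, q i = 1) (hpq : ∀ i ∈ s, θ * q i ≤ p i) (hfh : ∀ i ∈ s, f i - h i ≤ ε)
    (hm : ∀ i ∈ s, m ≤ h i ∧ h i ≤ m + K) :
    ∑ i ∈ s, p i * f i - ∑ i ∈ s, q i * h i ≤ ε + (1 - θ) * K := by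
  have hθ : θ ≤ 1 := by
    have := Finset.sum_le_sum hpq
    rwa [← Finset.mul_sum, hp1, hq1, mul_one] at this
  have h1 : ∑ i ∈ s, p i * f i ≤ ε + ∑ i ∈ s, p i * h i := by
    have : ∑ i ∈ s, p i * f i ≤ ∑ i ∈ s, (p i * ε + p i * h i) :=
      Finset.sum_le_sum fun i hi => by
        have := mul_le_mul_of_nonneg_left (hfh i hi) (hp i hi)
        linarith
    rwa [Finset.sum_add_distrib, ← Finset.sum_mul, hp1, one_mul] at this
  -- `p` splits into `θ q` and a nonnegative remainder of mass `1 - θ`; only the remainder sees the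
  -- oscillation `K`.
  have h2 : ∑ i ∈ s, (p i - θ * q i) * h i ≤ ∑ i ∈ s, (p i - θ * q i) * (m + K) :=
    Finset.sum_le_sum fun i hi =>
      mul_le_mul_of_nonneg_left (hm i hi).2 (sub_nonneg.2 (hpq i hi))
  have h3 : ∑ i ∈ s, q i * m ≤ ∑ i ∈ s, q i * h i :=
    Finset.sum_le_sum fun i hi => mul_le_mul_of_nonneg_left (hm i hi).1 (hq i hi)
  rw [← Finset.sum_mul, hq1, one_mul] at h3
  rw [← Finset.sum_mul, Finset.sum_sub_distrib, ← Finset.mul_sum, hp1, hq1] at h2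
  have h4 : ∑ i ∈ s, (p i - θ * q i) * h i = ∑ i ∈ s, p i * h i - θ * ∑ i ∈ s, q i * h i := by
    rw [Finset.mul_sum, ← Finset.sum_sub_distrib]
    exact Finset.sum_congr rfl fun i _ => by ring
  rw [h4] at h2
  have h5 := mul_le_mul_of_nonneg_left h3 (sub_nonneg.2 hθ)
  nlinarith

/-- An average is bounded by means of the weight of an atom. -/
theorem sum_mul_le_of_atom {ι : Type*} {s : Finset ι} {p f : ι → ℝ} {c M : ℝ} {i : ι} (hi : i ∈ s)
    (hp : ∀ j ∈ s, 0 ≤ p j) (hp1 : ∑ j ∈ s, p j = 1) (hf : ∀ j ∈ s, f j ≤ M) (hc : c ≤ p i) :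
    ∑ j ∈ s, p j * f j ≤ M - c * (M - f i) := by
  have h1 : p i * (M - f i) ≤ ∑ j ∈ s, p j * (M - f j) :=
    Finset.single_le_sum (f := fun j => p j * (M - f j))
      (fun j hj => mul_nonneg (hp j hj) (sub_nonneg.2 (hf j hj))) hi
  have h2 : ∑ j ∈ s, p j * (M - f j) = M - ∑ j ∈ s, p j * f j := by
    simp only [mul_sub, Finset.sum_sub_distrib]
    rw [← Finset.sum_mul, hp1, one_mul]
  have h3 := mul_le_mul_of_nonneg_right hc (sub_nonneg.2 (hf i hi))
  linarith

namespace RuelleSystem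

variable {X W : Type*} [MetricSpace X] [CompactSpace X] {g : W → X → X} {φ : X → ℝ} {a lam : ℝ}
  {α : ℝ≥0} (S : RuelleSystem g φ a lam α)
include S

omit [CompactSpace X] in
theorem isContPseudoDist_dStar : IsContPseudoDist (dStar a lam α φ) :=
  dStar_isContPseudoDist S.ha S.hα0 S.hα1

omit [CompactSpace X] in
-- The role of the term `a^(-α)` in `Δ`: wherever `d^*` is not truncated, inverse branches are
-- available.
theorem dist_lt_of_mul_rpow_lt_one {x y : X} (h : deltaConst a lam α φ * dist x y ^ (α : ℝ) < 1) :
    dist x y < a := by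
  by_contra! hle
  have h1 : a ^ (α : ℝ) ≤ dist x y ^ (α : ℝ) := Real.rpow_le_rpow S.ha.le hle α.2
  have h2 : a ^ (-(α : ℝ)) * a ^ (α : ℝ) = 1 := by
    rw [← Real.rpow_add S.ha]
    simp
  have h3 : a ^ (-(α : ℝ)) ≤ deltaConst a lam α φ := le_max_right _ _
  have h4 := mul_le_mul h3 h1 (Real.rpow_nonneg S.ha.le _)
    (deltaConst_pos (φ := φ) (lam := lam) (α := α) S.ha).le
  linarith

/-- The exponent is `9/4 = 1 + 1/4 + 1`: distortion of `φ_v`, of `L_u(1)` at the contracted points,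
and of the normalization `L_{uv}(1)`. -/
theorem quotientWeight_branchWord_le (u v : List W) {x y x' : X} (h : dist x y < a)
    (hx : x' ∈ fiber g v x) (hv : (lam ^ (α : ℝ)) ^ v.length ≤ 1 / 4) :
    Real.exp (-(9 / 4 * (potConst lam α φ * dist x y ^ (α : ℝ)))) *
      quotientWeight g φ u v y (branchWord g a v x' y) ≤ quotientWeight g φ u v x x' := by
  rw [S.mem_fiber] at hx
  subst hx
  set z := branchWord g a v x' y with hz
  set D := dist (wordMap g v x') y ^ (α : ℝ) with hD
  have hC := S.potConst_nonneg
  have h1 : Real.exp (wordPot g φ v z) ≤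
      Real.exp (potConst lam α φ * D) * Real.exp (wordPot g φ v x') := by
    rw [← Real.exp_add]
    refine Real.exp_le_exp.2 ?_
    have := (abs_le.1 (S.wordPot_branchWord h)).1
    linarith
  have hd := S.dist_branchWord h
  have h2 : ruelleMass g φ u z ≤
      Real.exp (1 / 4 * (potConst lam α φ * D)) * ruelleMass g φ u x' := by
    have h3 : dist z x' < a := by
      rw [dist_comm]
      exact (S.dist_branchWord_le h).trans_lt h
    refine (S.ruelleMass_le_of_dist_lt u h3).trans
      (mul_le_mul_of_nonneg_right (Real.exp_le_exp.2 ?_) (S.ruelleMass_pos u x').le)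
    have h4 : dist z x' ^ (α : ℝ) ≤ 1 / 4 * D := by
      rw [dist_comm]
      refine (Real.rpow_le_rpow dist_nonneg hd α.2).trans ?_
      rw [Real.mul_rpow (pow_nonneg S.hlam0.le _) dist_nonneg, ← Real.rpow_pow_comm S.hlam0.le]
      exact mul_le_mul_of_nonneg_right hv (by positivity)
    have := mul_le_mul_of_nonneg_left h4 hC
    linarith
  have h3 : ruelleMass g φ (u ++ v) (wordMap g v x') ≤
      Real.exp (potConst lam α φ * D) * ruelleMass g φ (u ++ v) y :=
    S.ruelleMass_le_of_dist_lt _ h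
  have hm1 := S.ruelleMass_pos (u ++ v) (wordMap g v x')
  have hm2 := S.ruelleMass_pos (u ++ v) y
  have hm3 := S.ruelleMass_pos u z
  have hm4 := S.ruelleMass_pos u x'
  rw [quotientWeight, quotientWeight, ← mul_div_assoc, div_le_div_iff₀ hm2 hm1]
  set s := potConst lam α φ * D
  have he : Real.exp (-(9 / 4 * s)) * (Real.exp s * Real.exp (1 / 4 * s) * Real.exp s) = 1 := by
    rw [← Real.exp_add, ← Real.exp_add, ← Real.exp_add]
    exact (Real.exp_eq_one_iff _).2 (by ring)
  calc Real.exp (-(9 / 4 * s)) * (Real.exp (wordPot g φ v z) * ruelleMass g φ u z) *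
        ruelleMass g φ (u ++ v) (wordMap g v x')
      ≤ Real.exp (-(9 / 4 * s)) * ((Real.exp s * Real.exp (wordPot g φ v x')) *
        (Real.exp (1 / 4 * s) * ruelleMass g φ u x')) *
        (Real.exp s * ruelleMass g φ (u ++ v) y) := by gcongr
    _ = (Real.exp (-(9 / 4 * s)) * (Real.exp s * Real.exp (1 / 4 * s) * Real.exp s)) *
        (Real.exp (wordPot g φ v x') * ruelleMass g φ u x' * ruelleMass g φ (u ++ v) y) := by ring
    _ = _ := by rw [he, one_mul]

/-- The factor is `13/16 = 1/4 + 9/16`: contraction of the preimages gives `1/4`, and the change of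
weights gives `9/4` times the distortion constant, which is at most `Δ / 4`. -/
theorem quotientOp_sub_le_of_near (u v : List W) {f : X → ℝ} {K : ℝ} (hK : 0 ≤ K)
    (hf : ∀ x y, f x - f y ≤ K * dStar a lam α φ x y)
    (hv : (lam ^ (α : ℝ)) ^ v.length ≤ 1 / 4) {x y : X}
    (h : deltaConst a lam α φ * dist x y ^ (α : ℝ) < 1) :
    quotientOp g φ u v f x - quotientOp g φ u v f y ≤ 13 / 16 * K * dStar a lam α φ x y := by
  have hxy := S.dist_lt_of_mul_rpow_lt_one h
  have : Nonempty X := ⟨x⟩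
  have hosc : ∀ x y, f x - f y ≤ K := fun x y =>
    (hf x y).trans (mul_le_of_le_one_right hK (dStar_le_one x y))
  obtain ⟨m, hm⟩ := exists_interval_of_osc_le hosc
  have hΔ := deltaConst_pos (X := X) (lam := lam) (α := α) (φ := φ) S.ha
  rw [S.quotientOp_eq_sum, S.quotientOp_eq_sum, S.sum_fiber_branchWord hxy
    fun z => quotientWeight g φ u v y z * f z]
  set D := dist x y ^ (α : ℝ) with hD
  have hD0 : 0 ≤ D := by positivity
  refine (sum_mul_sub_sum_mul_le (θ := Real.exp (-(9 / 4 * (potConst lam α φ * D))))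
    (ε := K * (1 / 4 * (deltaConst a lam α φ * D))) (m := m) (K := K)
    (fun z _ => (S.quotientWeight_pos u v x z).le) (S.sum_quotientWeight u v x)
    (fun z _ => (S.quotientWeight_pos u v y _).le) ?_
    (fun z hz => S.quotientWeight_branchWord_le u v hxy hz hv) (fun z hz => ?_)
    (fun z _ => hm _)).trans ?_
  · rw [← S.sum_fiber_branchWord hxy fun z => quotientWeight g φ u v y z]
    exact S.sum_quotientWeight u v y
  · refine (hf _ _).trans (mul_le_mul_of_nonneg_left ((min_le_right _ _).trans ?_) hK)
    rw [S.mem_fiber] at hz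
    subst hz
    have h4 : dist z (branchWord g a v z y) ^ (α : ℝ) ≤ 1 / 4 * D := by
      refine (Real.rpow_le_rpow dist_nonneg (S.dist_branchWord hxy) α.2).trans ?_
      rw [Real.mul_rpow (pow_nonneg S.hlam0.le _) dist_nonneg, ← Real.rpow_pow_comm S.hlam0.le]
      exact mul_le_mul_of_nonneg_right hv (by positivity)
    have := mul_le_mul_of_nonneg_left h4 hΔ.le
    linarith
  · have h1 : dStar a lam α φ x y = deltaConst a lam α φ * D := min_eq_right h.le
    rw [h1]
    have h2 := Real.add_one_le_exp (-(9 / 4 * (potConst lam α φ * D)))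
    have h3 := mul_le_mul_of_nonneg_right (four_potConst_le (a := a) (lam := lam) (α := α) (φ := φ))
      hD0
    have h5 : 1 - Real.exp (-(9 / 4 * (potConst lam α φ * D))) ≤
        9 / 16 * (deltaConst a lam α φ * D) := by linarith
    have h6 := mul_le_mul_of_nonneg_right h5 hK
    linarith

/-- Uniformity in `u` holds because `L_u(1)` enters only through its quotients, which are bounded.
-/
theorem exists_quotientWeight_ge (n : ℕ) : ∃ c : ℝ, 0 < c ∧ ∀ u v : List W, v.length = n →
    ∀ x, ∀ y ∈ fiber g v x, c ≤ quotientWeight g φ u v x y := by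
  obtain ⟨B, hB0, hB⟩ := S.exists_pot_bound
  obtain ⟨M, hM1, hM⟩ := S.exists_ruelleMass_le
  obtain ⟨K, hK1, hK⟩ := S.exists_ruelleMass_le_mul
  refine ⟨Real.exp (-(n * B)) / (K * M ^ n), by positivity, ?_⟩
  rintro u v rfl x y -
  have h1 : ruelleMass g φ (u ++ v) x ≤ K * ruelleMass g φ u y * M ^ v.length := by
    rw [S.ruelleMass_append]
    refine (S.ruelleOp_mono v (fun z => hK u z y) x).trans ?_
    rw [S.ruelleOp_const]
    exact mul_le_mul_of_nonneg_left (hM v x)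
      (mul_nonneg (by positivity) (S.ruelleMass_pos u y).le)
  have h2 : Real.exp (-(v.length * B)) ≤ Real.exp (wordPot g φ v y) :=
    Real.exp_le_exp.2 (abs_le.1 (abs_wordPot_le hB v y)).1
  have h3 := S.ruelleMass_pos u y
  rw [quotientWeight, div_le_div_iff₀ (by positivity) (S.ruelleMass_pos _ _)]
  calc Real.exp (-(v.length * B)) * ruelleMass g φ (u ++ v) x
      ≤ Real.exp (wordPot g φ v y) * (K * ruelleMass g φ u y * M ^ v.length) := by
        gcongr
        exact (S.ruelleMass_pos _ _).le
    _ = _ := by ring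

/-- Quotient operators for words of a certain length contract the Lipschitz seminorm. -/
theorem exists_contraction : ∃ (n : ℕ) (s : ℝ), 0 < n ∧ 0 < s ∧ s < 1 ∧
    ∀ u v : List W, v.length = n → ∀ (f : X → ℝ) (K : ℝ), 0 ≤ K →
      (∀ x y, f x - f y ≤ K * dStar a lam α φ x y) →
        ∀ x y, quotientOp g φ u v f x - quotientOp g φ u v f y ≤
          s * K * dStar a lam α φ x y := by
  rcases isEmpty_or_nonempty X with hX | ⟨⟨z₀⟩⟩
  · exact ⟨1, 1 / 2, by norm_num, by norm_num, by norm_num, fun _ _ _ _ _ _ _ x => hX.elim x⟩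
  have : Nonempty X := ⟨z₀⟩
  have hc := S.isContPseudoDist_dStar
  obtain ⟨r, hr, hball⟩ : ∃ r > 0, ∀ x y, dist z₀ x < r → dist z₀ y < r →
      dStar a lam α φ x y < 1 / 2 := by
    have h1 : Continuous fun y => dStar a lam α φ z₀ y :=
      hc.cont.comp (continuous_const.prodMk continuous_id)
    have h2 : Tendsto (fun y => dStar a lam α φ z₀ y) (𝓝 z₀) (𝓝 0) := by
      simpa [hc.self] using h1.tendsto z₀
    obtain ⟨r, hr, hd⟩ := Metric.eventually_nhds_iff.1
      (h2.eventually (gt_mem_nhds (show (0 : ℝ) < 1 / 4 by norm_num)))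
    refine ⟨r, hr, fun x y hx hy => ?_⟩
    have h3 := hc.tri x z₀ y
    have h4 := hd (y := x) (by rwa [dist_comm])
    have h5 := hd (y := y) (by rwa [dist_comm])
    rw [hc.symm x z₀] at h3
    linarith
  obtain ⟨m₀, hm₀⟩ := S.exists_fiber_dense hr
  obtain ⟨m₁, hm₁⟩ := exists_pow_lt_of_lt_one (show (0 : ℝ) < 1 / 4 by norm_num) S.rpow_lam_lt_one
  have hlam : 0 ≤ lam ^ (α : ℝ) := Real.rpow_nonneg S.hlam0.le _
  set n := max (max m₀ m₁) 1 with hn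
  obtain ⟨c, hc0, hcw⟩ := S.exists_quotientWeight_ge n
  -- The first rate serves the pairs with untruncated cost, the second the pairs with `d^* = 1`.
  refine ⟨n, max (13 / 16) (1 - c / 2), by omega, lt_max_of_lt_left (by norm_num),
    max_lt (by norm_num) (by linarith), fun u v hv f K hK hf x y => ?_⟩
  have hv1 : (lam ^ (α : ℝ)) ^ v.length ≤ 1 / 4 :=
    (pow_le_pow_of_le_one hlam S.rpow_lam_lt_one.le (by omega)).trans hm₁.le
  rcases lt_or_ge (deltaConst a lam α φ * dist x y ^ (α : ℝ)) 1 with h | h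
  · refine (S.quotientOp_sub_le_of_near u v hK hf hv1 h).trans ?_
    exact mul_le_mul_of_nonneg_right (mul_le_mul_of_nonneg_right (le_max_left _ _) hK)
      (hc.nonneg x y)
  · have h1 : dStar a lam α φ x y = 1 := min_eq_left h
    rw [h1, mul_one]
    have hosc : ∀ x y, f x - f y ≤ K := fun x y =>
      (hf x y).trans (mul_le_of_le_one_right hK (dStar_le_one x y))
    obtain ⟨m, hm⟩ := exists_interval_of_osc_le hosc
    -- Both weights have an atom of mass at least `c` in the ball around `z₀`, where `f` varies by
    -- at most `K / 2`; this saves `c K / 2` of the oscillation.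
    obtain ⟨x', hx', hxd⟩ := hm₀ v (by omega) x z₀
    obtain ⟨y', hy', hyd⟩ := hm₀ v (by omega) y z₀
    have h2 := sum_mul_le_of_atom (f := f) (M := m + K) hx'
      (fun z _ => (S.quotientWeight_pos u v x z).le) (S.sum_quotientWeight u v x)
      (fun z _ => (hm z).2) (hcw u v hv x x' hx')
    have h3 := sum_mul_le_of_atom (f := fun z => -f z) (M := -m) hy'
      (fun z _ => (S.quotientWeight_pos u v y z).le) (S.sum_quotientWeight u v y)
      (fun z _ => neg_le_neg (hm z).1) (hcw u v hv y y' hy')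
    simp only [mul_neg, Finset.sum_neg_distrib] at h3
    rw [← S.quotientOp_eq_sum] at h2 h3
    have h4 : f x' - f y' ≤ K * (1 / 2) :=
      (hf x' y').trans (mul_le_mul_of_nonneg_left (hball x' y' hxd hyd).le hK)
    have h5 := mul_le_mul_of_nonneg_left h4 hc0.le
    have h6 : (1 - c / 2) * K ≤ max (13 / 16) (1 - c / 2) * K :=
      mul_le_mul_of_nonneg_right (le_max_right _ _) hK
    linarith

/-- Exponential decay of the oscillation under quotient operators. -/
theorem exists_decay : ∃ C ρ : ℝ, 1 ≤ C ∧ 0 < ρ ∧ ρ < 1 ∧ ∀ (u v : List W) (f : X → ℝ) (K : ℝ),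
    0 ≤ K → (∀ x y, f x - f y ≤ K * dStar a lam α φ x y) →
      ∀ x y, quotientOp g φ u v f x - quotientOp g φ u v f y ≤ C * K * ρ ^ v.length := by
  obtain ⟨n, s, hn, hs0, hs1, hcontr⟩ := S.exists_contraction
  have hstep : ∀ (q : ℕ) (u v : List W) (f : X → ℝ) (K : ℝ), q * n ≤ v.length →
    0 ≤ K → (∀ x y, f x - f y ≤ K * dStar a lam α φ x y) →
      ∀ x y, quotientOp g φ u v f x - quotientOp g φ u v f y ≤ s ^ q * K := by
    intro q
    induction q with
    | zero =>
      intro u v f K _ hK hf x y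
      have : Nonempty X := ⟨x⟩
      obtain ⟨m, hm⟩ := exists_interval_of_osc_le fun x y =>
        (hf x y).trans (mul_le_of_le_one_right hK (dStar_le_one x y))
      have h1 := S.quotientOp_le u v (fun z => (hm z).2) x
      have h2 := S.le_quotientOp u v (fun z => (hm z).1) y
      linarith
    | succ q ih =>
      intro u v f K hv hK hf x y
      have hv' : n ≤ v.length := le_trans (by nlinarith) hv
      have h1 := hcontr u (v.take n) (by simpa using hv') f K hK hf
      -- The block of `n` letters just used moves to the left word.
      have h2 := ih (u ++ v.take n) (v.drop n) (quotientOp g φ u (v.take n) f) (s * K)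
        (by rw [List.length_drop]; rw [add_mul, one_mul] at hv; omega) (by positivity) h1 x y
      rw [← S.quotientOp_append, ← S.quotientOp_append, List.take_append_drop] at h2
      rwa [pow_succ, mul_assoc]
  -- The rate per letter is the `n`-th root of `s`; the factor `s⁻¹` pays for the incomplete last
  -- block.
  refine ⟨s⁻¹, s ^ (n : ℝ)⁻¹, (one_le_inv₀ hs0).2 hs1.le, Real.rpow_pos_of_pos hs0 _,
    Real.rpow_lt_one hs0.le hs1 (by positivity), fun u v f K hK hf x y => ?_⟩
  refine (hstep (v.length / n) u v f K (Nat.div_mul_le_self _ _) hK hf x y).trans ?_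
  have h1 : s ^ (v.length / n + 1) ≤ (s ^ (n : ℝ)⁻¹) ^ v.length := by
    have h2 : (s ^ (n : ℝ)⁻¹) ^ n = s := Real.rpow_inv_natCast_pow hs0.le hn.ne'
    calc s ^ (v.length / n + 1) = (s ^ (n : ℝ)⁻¹) ^ (n * (v.length / n + 1)) := by
          rw [pow_mul, h2]
      _ ≤ _ := pow_le_pow_of_le_one (Real.rpow_nonneg hs0.le _)
          (Real.rpow_le_one hs0.le hs1.le (by positivity)) (Nat.lt_mul_div_succ _ hn).le
  have h3 : s ^ (v.length / n) ≤ s⁻¹ * (s ^ (n : ℝ)⁻¹) ^ v.length := by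
    rw [inv_mul_eq_div, le_div_iff₀ hs0, ← pow_succ]
    exact h1
  have := mul_le_mul_of_nonneg_right h3 hK
  linarith

/-! ### Dependence of the quotient operators on the left word. -/

/-- The densities `L_t(1)`, normalized at a point, are bounded above and away from 0, and Lipschitz,
uniformly in `t`: distortion handles close pairs, boundedness the others. -/
theorem exists_ruelleMass_lip : ∃ K : ℝ, 1 ≤ K ∧ ∀ (t : List W) (x₀ : X),
    (∀ x, K⁻¹ ≤ (ruelleMass g φ t x₀)⁻¹ * ruelleMass g φ t x) ∧
    ∀ x y, (ruelleMass g φ t x₀)⁻¹ * ruelleMass g φ t x -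
      (ruelleMass g φ t x₀)⁻¹ * ruelleMass g φ t y ≤ K * dStar a lam α φ x y := by
  obtain ⟨K, hK1, hK⟩ := S.exists_ruelleMass_le_mul
  have hK0 : 0 < K := zero_lt_one.trans_le hK1
  refine ⟨K, hK1, fun t x₀ => ⟨fun x => ?_, fun x y => ?_⟩⟩
  · rw [inv_mul_eq_div, le_div_iff₀ (S.ruelleMass_pos _ _), inv_mul_le_iff₀ hK0]
    exact hK t x₀ x
  · have hp := S.ruelleMass_pos t x₀
    have hle : ∀ x, (ruelleMass g φ t x₀)⁻¹ * ruelleMass g φ t x ≤ K := fun x => by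
      rw [inv_mul_le_iff₀ hp, mul_comm]
      exact hK t x x₀
    have hnn : ∀ x, 0 ≤ (ruelleMass g φ t x₀)⁻¹ * ruelleMass g φ t x := fun x =>
      mul_nonneg (inv_nonneg.2 hp.le) (S.ruelleMass_pos t x).le
    rcases lt_or_ge (deltaConst a lam α φ * dist x y ^ (α : ℝ)) 1 with h | h
    · have hxy := S.dist_lt_of_mul_rpow_lt_one h
      rw [show dStar a lam α φ x y = _ from min_eq_right h.le]
      have h1 := mul_le_mul_of_nonneg_left (S.ruelleMass_le_of_dist_lt t hxy) (inv_nonneg.2 hp.le)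
      have hC := S.potConst_nonneg
      set w := potConst lam α φ * dist x y ^ (α : ℝ) with hw
      have hw0 : 0 ≤ w := by positivity
      have h2 := mul_le_mul_of_nonneg_right
        (four_potConst_le (a := a) (lam := lam) (α := α) (φ := φ))
        (show 0 ≤ dist x y ^ (α : ℝ) by positivity)
      -- Here `w < 1/4`, since `4 w ≤ Δ d^α < 1`.
      have h3 : Real.exp w - 1 ≤ 4 * w := by
        have h4 : Real.exp w * (1 - w) ≤ 1 := by
          have h5 := mul_le_mul_of_nonneg_left (Real.one_sub_le_exp_neg w) (Real.exp_pos w).le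
          rwa [← Real.exp_add, add_neg_cancel, Real.exp_zero] at h5
        nlinarith [Real.exp_pos w]
      have h6 : (Real.exp w - 1) * ((ruelleMass g φ t x₀)⁻¹ * ruelleMass g φ t y) ≤
          4 * w * K := mul_le_mul h3 (hle y) (hnn y) (by positivity)
      have h7 := mul_le_mul_of_nonneg_right h2 hK0.le
      linarith
    · rw [show dStar a lam α φ x y = 1 from min_eq_left h, mul_one]
      have := hle x
      have := hnn y
      linarith

/-- Changing `P_p^v` to `P_{tp}^v` has an effect that is exponentially small in the length
of `p`. -/
theorem exists_left_decay : ∃ C ρ : ℝ, 1 ≤ C ∧ 0 < ρ ∧ ρ < 1 ∧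
    ∀ (t p v : List W) (f : X → ℝ) (M : ℝ), (∀ x, |f x| ≤ M) → ∀ x,
      |quotientOp g φ (t ++ p) v f x - quotientOp g φ p v f x| ≤ C * M * ρ ^ p.length := by
  obtain ⟨C, ρ, hC, hρ0, hρ1, hdec⟩ := S.exists_decay
  obtain ⟨K, hK1, hK⟩ := S.exists_ruelleMass_lip
  have hK0 : 0 < K := zero_lt_one.trans_le hK1
  refine ⟨C * K * K, ρ, one_le_mul_of_one_le_of_one_le (one_le_mul_of_one_le_of_one_le hC hK1) hK1,
    hρ0, hρ1, fun t p v f M hf x => ?_⟩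
  have hM : 0 ≤ M := (abs_nonneg _).trans (hf x)
  obtain ⟨hlow, hlip⟩ := hK t x
  set G := fun y => (ruelleMass g φ t x)⁻¹ * ruelleMass g φ t y with hG
  -- `H` is the density that turns `P_p^v` into `P_{tp}^v`, up to the normalization `R`. It is an
  -- average of a uniformly Lipschitz function, hence nearly constant.
  set H := quotientOp g φ [] p G with hH
  have hosc : ∀ y z, H y - H z ≤ C * K * ρ ^ p.length := hdec [] p G K hK0.le hlip
  have hHlow : ∀ y, K⁻¹ ≤ H y := fun y => S.le_quotientOp _ _ hlow y
  set R := quotientOp g φ p v H x with hR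
  have hRlow : K⁻¹ ≤ R := S.le_quotientOp _ _ hHlow x
  have hid : quotientOp g φ (t ++ p) v f x * R = quotientOp g φ p v (fun y => f y * H y) x := by
    have h1 := S.quotientOp_append_left_mul t p v f x
    have h2 : H = fun y => (ruelleMass g φ t x)⁻¹ * quotientOp g φ [] p (ruelleMass g φ t) y := by
      funext y
      exact S.quotientOp_const_mul _ _ _ _ _
    rw [hR, h2, S.quotientOp_const_mul, mul_left_comm, h1, ← S.quotientOp_const_mul]
    congr 1
    funext y
    ring
  have hRH : ∀ y, |H y - R| ≤ C * K * ρ ^ p.length := fun y => by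
    have h1 : H y - C * K * ρ ^ p.length ≤ R := S.le_quotientOp _ _ (fun z => by
      have := hosc y z
      linarith) x
    have h2 : R ≤ H y + C * K * ρ ^ p.length := S.quotientOp_le _ _ (fun z => by
      have := hosc z y
      linarith) x
    rw [abs_le]
    constructor <;> linarith
  -- The difference of the operators sees only `H - R`, which is bounded by the oscillation of `H`;
  -- dividing by `R ≥ K⁻¹` costs the second factor `K`.
  have hdiff : (quotientOp g φ (t ++ p) v f x - quotientOp g φ p v f x) * R =
      quotientOp g φ p v (fun y => f y * (H y - R)) x := by
    rw [sub_mul, hid, mul_comm _ R, ← S.quotientOp_const_mul, ← S.quotientOp_sub]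
    congr 1
    funext y
    ring
  have h1 := S.abs_quotientOp_le p v (f := fun y => f y * (H y - R))
    (M := M * (C * K * ρ ^ p.length)) (fun y => by
      rw [abs_mul]
      exact mul_le_mul (hf y) (hRH y) (abs_nonneg _) hM) x
  rw [← hdiff, abs_mul, abs_of_pos ((inv_pos.2 hK0).trans_le hRlow)] at h1
  have h2 := (mul_le_mul_of_nonneg_left hRlow (abs_nonneg
    (quotientOp g φ (t ++ p) v f x - quotientOp g φ p v f x))).trans h1
  rw [← div_eq_mul_inv, div_le_iff₀ hK0] at h2
  linarith

/-- `P_u^v(f)` is determined, up to an exponentially small error, by the end of `u` and the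
beginning of `v`. -/
theorem exists_two_sided_decay : ∃ C ρ : ℝ, 1 ≤ C ∧ 0 < ρ ∧ ρ < 1 ∧
    ∀ (t t' p q r r' : List W) (f : X → ℝ) (K : ℝ), 0 ≤ K →
      (∀ x y, f x - f y ≤ K * dStar a lam α φ x y) → ∀ x y,
        |quotientOp g φ (t ++ p) (q ++ r) f x - quotientOp g φ (t' ++ p) (q ++ r') f y| ≤
          C * K * (ρ ^ p.length + ρ ^ q.length) := by
  obtain ⟨C, ρ, hC, hρ0, hρ1, hdec⟩ := S.exists_decay
  obtain ⟨C', ρ', hC', hρ0', hρ1', hdec'⟩ := S.exists_left_decay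
  refine ⟨C + 2 * C', max ρ ρ', by linarith, lt_max_of_lt_left hρ0, max_lt hρ1 hρ1',
    fun t t' p q r r' f K hK hf x y => ?_⟩
  have hosc : ∀ x y, f x - f y ≤ K := fun x y =>
    (hf x y).trans (mul_le_of_le_one_right hK (dStar_le_one x y))
  have hleft : ∀ t v z, |quotientOp g φ (t ++ p) v f z - quotientOp g φ p v f z| ≤
      C' * K * ρ' ^ p.length := fun t v z => by
    -- Subtracting a constant replaces the sup norm by the oscillation, which is at most `K`.
    have h1 := hdec' t p v (fun w => f w - f x) K (fun w => by
      have h2 := hosc w x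
      have h3 := hosc x w
      rw [abs_le]
      constructor <;> linarith) z
    rwa [S.quotientOp_sub, S.quotientOp_sub, S.quotientOp_const, S.quotientOp_const,
      sub_sub_sub_cancel_right] at h1
  -- By the cocycle rule both values are averages of `P_p^q(f)`, whose oscillation is small; the
  -- tails and base points do not matter.
  have hright : ∀ r r' x y, quotientOp g φ p (q ++ r) f x - quotientOp g φ p (q ++ r') f y ≤
      C * K * ρ ^ q.length := fun r r' x y => by
    have h1 := hdec p q f K hK hf
    rw [S.quotientOp_append, S.quotientOp_append]
    have h2 : ∀ z, quotientOp g φ (p ++ q) r (quotientOp g φ p q f) x ≤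
        quotientOp g φ p q f z + C * K * ρ ^ q.length := fun z =>
      S.quotientOp_le _ _ (fun w => by
        have := h1 w z
        linarith) x
    have h3 := S.le_quotientOp (p ++ q) r' (f := quotientOp g φ p q f)
      (M := quotientOp g φ (p ++ q) r (quotientOp g φ p q f) x - C * K * ρ ^ q.length)
      (fun w => by
        have := h2 w
        linarith) y
    linarith
  have h1 := abs_le.1 (hleft t (q ++ r) x)
  have h2 := abs_le.1 (hleft t' (q ++ r') y)
  have h3 := hright r r' x y
  have h4 := hright r' r y x
  have h5 : C' * K * ρ' ^ p.length ≤ C' * K * max ρ ρ' ^ p.length := by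
    gcongr
    exact le_max_right _ _
  have h6 : C * K * ρ ^ q.length ≤ C * K * max ρ ρ' ^ q.length := by
    gcongr
    exact le_max_left _ _
  have h7 : 0 ≤ C * K * max ρ ρ' ^ p.length := by positivity
  have h8 : 0 ≤ C' * K * max ρ ρ' ^ q.length := by positivity
  rw [abs_le]
  constructor <;> nlinarith

end RuelleSystem

/-! ## Two-sided limits -/

theorem initialWord_length {W : Type*} (ω : ℕ → W) (l : ℕ) : (initialWord ω l).length = l := by
  simp [initialWord]

theorem finalWord_eq_reverse {W : Type*} (σ : ℕ → W) (k : ℕ) :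
    finalWord σ k = (initialWord σ k).reverse := rfl

theorem finalWord_length {W : Type*} (σ : ℕ → W) (k : ℕ) : (finalWord σ k).length = k := by
  simp [finalWord]

theorem initialWord_add {W : Type*} (ω : ℕ → W) (m l : ℕ) :
    initialWord ω (m + l) = initialWord ω m ++ initialWord (fun n => ω (m + n)) l := by
  simp [initialWord, List.range_add, Function.comp_def]

theorem finalWord_add {W : Type*} (σ : ℕ → W) (m l : ℕ) :
    finalWord σ (m + l) = finalWord (fun n => σ (m + n)) l ++ finalWord σ m := by
  simp [finalWord_eq_reverse, initialWord_add]

theorem initialWord_rightPeriodic_of_le {W : Type*} (w : NonemptyWord W) {l : ℕ}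
    (hl : l ≤ w.1.length) : initialWord (rightPeriodic w) l = w.1.take l := by
  refine List.ext_getElem (by simp [initialWord, hl]) fun n h1 h2 => ?_
  rw [initialWord_length] at h1
  simp [initialWord, rightPeriodic, Nat.mod_eq_of_lt (h1.trans_le hl)]

theorem finalWord_leftPeriodic_of_le {W : Type*} (w : NonemptyWord W) {l : ℕ}
    (hl : l ≤ w.1.length) : finalWord (leftPeriodic w) l = (w.1.reverse.take l).reverse := by
  rw [finalWord_eq_reverse, leftPeriodic, initialWord_rightPeriodic_of_le _ (by simpa using hl)]

theorem initialWord_rightPeriodic_mul {W : Type*} (w : NonemptyWord W) (k : ℕ) :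
    initialWord (rightPeriodic w) (k * w.1.length) = (List.replicate k w.1).flatten := by
  induction k with
  | zero => simp [initialWord]
  | succ k ih =>
    rw [add_mul, one_mul, add_comm, initialWord_add, initialWord_rightPeriodic_of_le w le_rfl,
      List.take_length, List.replicate_succ, List.flatten_cons, ← ih]
    congr 2
    funext n
    simp [rightPeriodic]

theorem finalWord_leftPeriodic_mul {W : Type*} (w : NonemptyWord W) (k : ℕ) :
    finalWord (leftPeriodic w) (k * w.1.length) = (List.replicate k w.1).flatten := by
  have h := initialWord_rightPeriodic_mul ⟨w.1.reverse, by simpa using w.2⟩ k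
  rw [List.length_reverse] at h
  rw [finalWord_eq_reverse, leftPeriodic, h]
  simp [List.reverse_flatten]

theorem wordMap_flatten_congr {X W : Type*} {g : W → X → X} {w w' : List W}
    (h : wordMap g w = wordMap g w') (k : ℕ) :
    wordMap g (List.replicate k w).flatten = wordMap g (List.replicate k w').flatten := by
  induction k with
  | zero => rfl
  | succ k ih =>
    funext x
    rw [List.replicate_succ, List.replicate_succ, List.flatten_cons, List.flatten_cons,
      wordMap_append, wordMap_append, ih, h]

theorem wordPot_flatten_congr {X W : Type*} {g : W → X → X} {φ : X → ℝ} {w w' : List W}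
    (h : wordMap g w = wordMap g w') (h' : wordPot g φ w = wordPot g φ w') (k : ℕ) :
    wordPot g φ (List.replicate k w).flatten = wordPot g φ (List.replicate k w').flatten := by
  induction k with
  | zero => rfl
  | succ k ih =>
    funext x
    rw [List.replicate_succ, List.replicate_succ, List.flatten_cons, List.flatten_cons,
      wordPot_append, wordPot_append, ih, h, h']

namespace RuelleSystem

variable {X W : Type*} [MetricSpace X] [CompactSpace X] [MeasurableSpace X] [BorelSpace X]
  {g : W → X → X} {φ : X → ℝ} {a lam : ℝ} {α : ℝ≥0} (S : RuelleSystem g φ a lam α)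
include S

theorem exists_quotientMeasure (u v : List W) (x : X) : ∃ P : ProbabilityMeasure X,
    ∀ f : C(X, ℝ), ∫ y, f y ∂(P : Measure X) = quotientOp g φ u v f x :=
  exists_measure_of_positive
    { toFun := fun f => quotientOp g φ u v f x
      map_add' := fun f h => S.quotientOp_add u v f h x
      map_smul' := fun r f => S.quotientOp_const_mul u v r f x }
    (fun _ hh => S.le_quotientOp u v hh x) (S.quotientOp_const u v 1 x)

/-- A cluster point along the diagonal `k = l` inherits the two-sided estimate. As `t`, `r` and `x`
are arbitrary, it is then the limit over all pairs of lengths and all initial measures. -/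
theorem exists_state_estimate [Nonempty X] : ∃ C ρ : ℝ, 1 ≤ C ∧ 0 < ρ ∧ ρ < 1 ∧
    ∀ σ ω : ℕ → W, ∃ μ : ProbabilityMeasure X, ∀ (N : ℕ) (t r : List W) (f : X → ℝ) (K : ℝ),
      0 ≤ K → (∀ x y, f x - f y ≤ K * dStar a lam α φ x y) → ∀ x,
        |quotientOp g φ (t ++ finalWord σ N) (initialWord ω N ++ r) f x -
          ∫ y, f y ∂(μ : Measure X)| ≤ C * K * ρ ^ N := by
  obtain ⟨C, ρ, hC, hρ0, hρ1, hdec⟩ := S.exists_two_sided_decay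
  refine ⟨2 * C, ρ, by linarith, hρ0, hρ1, fun σ ω => ?_⟩
  obtain ⟨x₀⟩ := ‹Nonempty X›
  choose P hP using fun n : ℕ => S.exists_quotientMeasure (finalWord σ n) (initialWord ω n) x₀
  obtain ⟨μ, -, hμ⟩ := (isCompact_univ (X := ProbabilityMeasure X)).ultrafilter_le_nhds
    ((Ultrafilter.of atTop).map P) (by simp)
  refine ⟨μ, fun N t r f K hK hf x => ?_⟩
  have hfc : Continuous f := S.isContPseudoDist_dStar.continuous_of_lip hf
  have h1 : Tendsto (fun n => ∫ y, f y ∂(P n : Measure X))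
      ((Ultrafilter.of atTop : Ultrafilter ℕ) : Filter ℕ) (𝓝 (∫ y, f y ∂(μ : Measure X))) :=
    probabilityMeasure_tendsto_iff.1 (show Tendsto P _ _ from hμ) ⟨f, hfc⟩
  refine le_of_tendsto ((tendsto_const_nhds.sub h1).abs)
    (((eventually_ge_atTop N).filter_mono (Ultrafilter.of_le atTop)).mono fun n hn => ?_)
  obtain ⟨m, rfl⟩ := Nat.exists_eq_add_of_le hn
  rw [show ∫ y, f y ∂(P (N + m) : Measure X) = _ from hP (N + m) ⟨f, hfc⟩]
  have h2 := hdec t (finalWord (fun n => σ (N + n)) m) (finalWord σ N) (initialWord ω N) r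
    (initialWord (fun n => ω (N + n)) m) f K hK hf x x₀
  rw [← finalWord_add, ← initialWord_add, finalWord_length, initialWord_length] at h2
  refine h2.trans_eq ?_
  ring

theorem isTwoSidedLimit_of_estimate {σ ω : ℕ → W} {μ : ProbabilityMeasure X} {C ρ : ℝ}
    (hρ0 : 0 < ρ) (hρ1 : ρ < 1)
    (h : ∀ (N : ℕ) (t r : List W) (f : X → ℝ) (K : ℝ),
      0 ≤ K → (∀ x y, f x - f y ≤ K * dStar a lam α φ x y) → ∀ x,
        |quotientOp g φ (t ++ finalWord σ N) (initialWord ω N ++ r) f x -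
          ∫ y, f y ∂(μ : Measure X)| ≤ C * K * ρ ^ N) : IsTwoSidedLimit g φ σ ω μ := by
  intro ν
  have hnear : ∀ (kl : ℕ × ℕ) (f h : X → ℝ) (ε : ℝ), Continuous f → Continuous h →
      (∀ x, |f x - h x| ≤ ε) →
        |∫ x, quotientOp g φ (finalWord σ kl.1) (initialWord ω kl.2) f x ∂(ν : Measure X) -
          ∫ x, quotientOp g φ (finalWord σ kl.1) (initialWord ω kl.2) h x ∂(ν : Measure X)| ≤ ε :=
    fun kl f h ε hf hh hfh => abs_integral_sub_le _ (S.continuous_quotientOp _ _ hf)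
      (S.continuous_quotientOp _ _ hh) fun x => by
        rw [← S.quotientOp_sub]
        exact S.abs_quotientOp_le _ _ hfh x
  refine tendsto_of_forall_lip S.ha S.hα0 S.hα1 (lam := lam) (φ := φ)
    (fun (kl : ℕ × ℕ) f =>
      ∫ x, quotientOp g φ (finalWord σ kl.1) (initialWord ω kl.2) f x ∂(ν : Measure X))
    (fun f => ∫ x, f x ∂(μ : Measure X)) hnear (fun _ _ _ hf hh => abs_integral_sub_le _ hf hh) ?_
  intro f K hK hf
  have hfc : Continuous f := S.isContPseudoDist_dStar.continuous_of_lip hf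
  refine Metric.tendsto_nhds.2 fun ε hε => ?_
  have hlim : Tendsto (fun N => C * K * ρ ^ N) atTop (𝓝 0) := by
    simpa using (tendsto_pow_atTop_nhds_zero_of_lt_one hρ0.le hρ1).const_mul (C * K)
  obtain ⟨N, hN⟩ := (hlim.eventually (gt_mem_nhds hε)).exists
  filter_upwards [(eventually_ge_atTop N).prod_mk (eventually_ge_atTop N)] with kl hkl
  obtain ⟨k, hk⟩ := Nat.exists_eq_add_of_le hkl.1
  obtain ⟨l, hl⟩ := Nat.exists_eq_add_of_le hkl.2
  rw [hk, hl, finalWord_add, initialWord_add, Real.dist_eq]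
  refine lt_of_le_of_lt ?_ hN
  have h1 := abs_integral_sub_le (ν : Measure X) (S.continuous_quotientOp
    (finalWord (fun n => σ (N + n)) k ++ finalWord σ N)
    (initialWord ω N ++ initialWord (fun n => ω (N + n)) l) hfc)
    (continuous_const (y := ∫ y, f y ∂(μ : Measure X))) (h N _ _ f K hK hf)
  simpa using h1

-- Cofinal agreement along possibly different lengths suffices. This covers uniqueness of the limit
-- as well as periodic words of unequal length.
omit S [CompactSpace X] in
theorem _root_.RuelleBoundary.IsTwoSidedLimit.eq_of_subseq [CompactSpace X] {σ ω σ' ω' : ℕ → W}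
    {μ μ' : ProbabilityMeasure X} (h : IsTwoSidedLimit g φ σ ω μ)
    (h' : IsTwoSidedLimit g φ σ' ω' μ') {s s' : ℕ → ℕ} (hs : Tendsto s atTop atTop)
    (hs' : Tendsto s' atTop atTop)
    (heq : ∀ n, quotientOp g φ (finalWord σ (s n)) (initialWord ω (s n)) =
      quotientOp g φ (finalWord σ' (s' n)) (initialWord ω' (s' n))) : μ = μ' := by
  refine Subtype.ext (show (μ : Measure X) = μ' from probabilityMeasure_ext fun f => ?_)
  have h1 := (h μ f).comp (hs.prodMk hs)
  have h2 := (h' μ f).comp (hs'.prodMk hs')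
  refine tendsto_nhds_unique h1 (h2.congr fun n => ?_)
  simp only [Function.comp_apply, heq]

theorem exists_twoSidedState_estimate [Nonempty X] : ∃ C ρ : ℝ, 1 ≤ C ∧ 0 < ρ ∧ ρ < 1 ∧
    (∀ σ ω : ℕ → W, IsTwoSidedLimit g φ σ ω (twoSidedState g φ σ ω)) ∧
    ∀ (σ ω σ' ω' : ℕ → W) (N : ℕ), finalWord σ N = finalWord σ' N →
      initialWord ω N = initialWord ω' N →
        vaserstein a lam α φ (twoSidedState g φ σ ω) (twoSidedState g φ σ' ω') ≤ C * ρ ^ N := by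
  obtain ⟨C, ρ, hC, hρ0, hρ1, hex⟩ := S.exists_state_estimate
  have hlim : ∀ σ ω : ℕ → W, IsTwoSidedLimit g φ σ ω (twoSidedState g φ σ ω) := fun σ ω => by
    obtain ⟨μ, hμ⟩ := hex σ ω
    exact Classical.epsilon_spec (p := IsTwoSidedLimit g φ σ ω)
      ⟨μ, S.isTwoSidedLimit_of_estimate hρ0 hρ1 hμ⟩
  refine ⟨2 * C, ρ, by linarith, hρ0, hρ1, hlim, fun σ ω σ' ω' N h1 h2 => ?_⟩
  obtain ⟨μ, hμ⟩ := hex σ ω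
  obtain ⟨μ', hμ'⟩ := hex σ' ω'
  rw [(hlim σ ω).eq_of_subseq (S.isTwoSidedLimit_of_estimate hρ0 hρ1 hμ) tendsto_id tendsto_id
    fun _ => rfl, (hlim σ' ω').eq_of_subseq (S.isTwoSidedLimit_of_estimate hρ0 hρ1 hμ')
    tendsto_id tendsto_id fun _ => rfl]
  refine vaserstein_le_of_dualLe S.ha S.hα0 S.hα1 fun f hf => ?_
  obtain ⟨x₀⟩ := ‹Nonempty X›
  have hf' : ∀ x y, f x - f y ≤ 1 * dStar a lam α φ x y := by simpa using hf
  have h3 := abs_le.1 (hμ N [] [] f 1 zero_le_one hf' x₀)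
  have h4 := abs_le.1 (hμ' N [] [] f 1 zero_le_one hf' x₀)
  rw [h1, h2] at h3
  linarith

/-- Words with the same pair `(T_w, φ_w)` have powers with the same pairs, hence the same Ruelle
operators, even if their lengths differ; compare at whole periods. -/
theorem twoSidedState_periodic_congr [Nonempty X] {w w' : NonemptyWord W}
    (h : wordPair g φ w = wordPair g φ w') :
    twoSidedState g φ (leftPeriodic w) (rightPeriodic w) =
      twoSidedState g φ (leftPeriodic w') (rightPeriodic w') := by
  obtain ⟨-, -, -, -, -, hlim, -⟩ := S.exists_twoSidedState_estimate
  have h1 : wordMap g w.1 = wordMap g w'.1 := congrArg (fun p => p.1.map) h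
  have h2 : wordPot g φ w.1 = wordPot g φ w'.1 := congrArg (fun p => p.1.pot) h
  have htend : ∀ w : NonemptyWord W, Tendsto (fun n => n * w.1.length) atTop atTop := fun w =>
    tendsto_id.atTop_mul_const' (List.length_pos_of_ne_nil w.2)
  refine (hlim _ _).eq_of_subseq (hlim _ _) (htend w) (htend w') fun n => ?_
  rw [finalWord_leftPeriodic_mul, initialWord_rightPeriodic_mul, finalWord_leftPeriodic_mul,
    initialWord_rightPeriodic_mul]
  have e1 := ruelleOp_congr_of_eq (wordMap_flatten_congr h1 n)
    (wordPot_flatten_congr (φ := φ) h1 h2 n)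
  have e2 : ∀ w : List W, (List.replicate n w).flatten ++ (List.replicate n w).flatten =
      (List.replicate (n + n) w).flatten := fun w => by
    rw [List.replicate_add, List.flatten_append]
  have e3 := ruelleOp_congr_of_eq (wordMap_flatten_congr h1 (n + n))
    (wordPot_flatten_congr (φ := φ) h1 h2 (n + n))
  funext f x
  simp only [quotientOp, e1, e2, e3]

theorem eqState_wordPair [Nonempty X] (w : NonemptyWord W) :
    eqState g φ (wordPair g φ w) = twoSidedState g φ (leftPeriodic w) (rightPeriodic w) :=
  S.twoSidedState_periodic_congr (wordPair_surjective g φ (wordPair g φ w)).choose_spec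

end RuelleSystem

/-! ## The metric on finite words -/

section Words

variable {W : Type*}

/-- `firstDiff` is one more than the length of the longest common prefix; this form replaces the
infimum in all later arguments. -/
theorem lt_firstDiff_iff (v w : List W) (n : ℕ) :
    n < firstDiff v w ↔ n ≤ v.length ∧ n ≤ w.length ∧ v.take n = w.take n := by
  have hne : {k : ℕ | 1 ≤ k ∧ (v[k - 1]? ≠ w[k - 1]? ∨ min v.length w.length < k)}.Nonempty :=
    ⟨min v.length w.length + 1, by omega, Or.inr (by omega)⟩
  have h0 : n < firstDiff v w ↔ ∀ k, 1 ≤ k → k ≤ n →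
      v[k - 1]? = w[k - 1]? ∧ k ≤ min v.length w.length := by
    constructor
    · intro h k hk hkn
      by_contra hcon
      have hmem : k ∈ {k : ℕ | 1 ≤ k ∧ (v[k - 1]? ≠ w[k - 1]? ∨ min v.length w.length < k)} := by
        refine ⟨hk, ?_⟩
        by_cases he : v[k - 1]? = w[k - 1]?
        · exact Or.inr (by
            by_contra hlt
            exact hcon ⟨he, not_lt.1 hlt⟩)
        · exact Or.inl he
      have := Nat.sInf_le hmem
      rw [firstDiff] at h
      omega
    · intro h
      have hmem := Nat.sInf_mem hne
      by_contra hcon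
      obtain ⟨h1, h2⟩ := h (firstDiff v w) hmem.1 (not_lt.1 hcon)
      rcases hmem.2 with h3 | h3
      · exact h3 h1
      · exact absurd h3 (not_lt.2 h2)
  rw [h0]
  constructor
  · intro h
    have hn : n ≤ min v.length w.length := by
      rcases n.eq_zero_or_pos with rfl | hn
      · exact Nat.zero_le _
      · exact (h n hn le_rfl).2
    refine ⟨by omega, by omega, List.ext_getElem? fun k => ?_⟩
    rw [List.getElem?_take, List.getElem?_take]
    split_ifs with hk
    · simpa using (h (k + 1) (by omega) (by omega)).1
    · rfl
  · rintro ⟨h1, h2, h3⟩ k hk hkn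
    refine ⟨?_, by omega⟩
    have h4 := congrArg (fun l => l[k - 1]?) h3
    simp only [List.getElem?_take] at h4
    rwa [if_pos (by omega), if_pos (by omega)] at h4

theorem firstDiff_comm (v w : List W) : firstDiff v w = firstDiff w v := by
  simp only [firstDiff, ne_comm, min_comm]

theorem firstDiff_pos (v w : List W) : 0 < firstDiff v w := by
  simp [lt_firstDiff_iff]

theorem firstDiff_le (v w : List W) : firstDiff v w ≤ v.length + 1 := by
  by_contra! h
  have := ((lt_firstDiff_iff v w _).1 h).1
  omega

/-- Sharing a prefix of given length is transitive, so each half of the distance is an ultrametric.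
-/
theorem min_firstDiff_le (u v w : List W) :
    min (firstDiff u v) (firstDiff v w) ≤ firstDiff u w := by
  have h1 := firstDiff_pos u v
  have h2 := firstDiff_pos v w
  obtain ⟨n, hn⟩ : ∃ n, min (firstDiff u v) (firstDiff v w) = n + 1 :=
    ⟨min (firstDiff u v) (firstDiff v w) - 1, by omega⟩
  rw [hn]
  have h3 := (lt_firstDiff_iff u v n).1 (by omega)
  have h4 := (lt_firstDiff_iff v w n).1 (by omega)
  exact (lt_firstDiff_iff u w n).2 ⟨h3.1, h4.2.1, h3.2.2.trans h4.2.2⟩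

theorem half_pow_firstDiff_le (u v w : List W) : (2 : ℝ)⁻¹ ^ firstDiff u w ≤
    (2 : ℝ)⁻¹ ^ firstDiff u v + (2 : ℝ)⁻¹ ^ firstDiff v w := by
  have h := pow_le_pow_of_le_one (show (0 : ℝ) ≤ 2⁻¹ by norm_num) (by norm_num)
    (min_firstDiff_le u v w)
  refine h.trans ?_
  have h1 : (0 : ℝ) < (2 : ℝ)⁻¹ ^ firstDiff u v := by positivity
  have h2 : (0 : ℝ) < (2 : ℝ)⁻¹ ^ firstDiff v w := by positivity
  rcases min_choice (firstDiff u v) (firstDiff v w) with h | h <;> rw [h] <;> linarith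

theorem wordDist_of_ne {v w : List W} (h : v ≠ w) : wordDist v w =
    (2 : ℝ)⁻¹ ^ firstDiff v w + (2 : ℝ)⁻¹ ^ firstDiff v.reverse w.reverse := if_neg h

theorem wordDist_self (v : List W) : wordDist v v = 0 := if_pos rfl

theorem wordDist_nonneg (v w : List W) : 0 ≤ wordDist v w := by
  rw [wordDist]
  split_ifs
  · exact le_rfl
  · positivity

/-- The metric space of finite words. -/
abbrev wordMetricSpace (W : Type*) : MetricSpace (List W) where
  dist := wordDist
  dist_self := wordDist_self
  dist_comm v w := by
    by_cases h : v = w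
    · rw [h]
    · rw [wordDist_of_ne h, wordDist_of_ne (Ne.symm h), firstDiff_comm,
        firstDiff_comm v.reverse]
  dist_triangle u v w := by
    by_cases h1 : u = v
    · rw [h1, wordDist_self, zero_add]
    by_cases h2 : v = w
    · rw [h2, wordDist_self, add_zero]
    by_cases h3 : u = w
    · rw [h3, wordDist_self]
      exact add_nonneg (wordDist_nonneg _ _) (wordDist_nonneg _ _)
    rw [wordDist_of_ne h1, wordDist_of_ne h2, wordDist_of_ne h3]
    have h4 := half_pow_firstDiff_le u v w
    have h5 := half_pow_firstDiff_le u.reverse v.reverse w.reverse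
    linarith
  eq_of_dist_eq_zero {v w} h := by
    by_contra hvw
    have h' : wordDist v w = 0 := h
    rw [wordDist_of_ne hvw] at h'
    have : (0 : ℝ) < (2 : ℝ)⁻¹ ^ firstDiff v w + (2 : ℝ)⁻¹ ^ firstDiff v.reverse w.reverse := by
      positivity
    exact this.ne' h'

theorem half_pow_length_le_wordDist {v w : List W} (h : v ≠ w) :
    (2 : ℝ)⁻¹ ^ (v.length + 1) ≤ wordDist v w := by
  rw [wordDist_of_ne h]
  have h1 := pow_le_pow_of_le_one (show (0 : ℝ) ≤ 2⁻¹ by norm_num) (by norm_num) (firstDiff_le v w)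
  have h2 : (0 : ℝ) < (2 : ℝ)⁻¹ ^ firstDiff v.reverse w.reverse := by positivity
  linarith

end Words

theorem discreteTopology_of_forall_le_dist {Y : Type*} [MetricSpace Y] {r : Y → ℝ}
    (hr : ∀ y, 0 < r y) (h : ∀ x y, x ≠ y → r x ≤ dist x y) : DiscreteTopology Y := by
  refine discreteTopology_iff_isOpen_singleton.2 fun x => Metric.isOpen_singleton_iff.2
    ⟨r x, hr x, fun y hy => ?_⟩
  by_contra hne
  have := h x y (Ne.symm hne)
  rw [dist_comm] at hy
  linarith

/-! ## The metric on the extended semigroup -/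

/-- The number `1 / κ(g)` for the element `(g, ψ)` of the extended semigroup. -/
def invKappa {X W : Type*} [MetricSpace X] {g : W → X → X} {φ : X → ℝ} (p : extSemigroup g φ) :
    ℝ := ((kappa p.1.map)⁻¹).toReal

namespace RuelleSystem

variable {X W : Type*} [MetricSpace X] [CompactSpace X]
  {g : W → X → X} {φ : X → ℝ} {a lam : ℝ} {α : ℝ≥0} (S : RuelleSystem g φ a lam α)
include S

theorem inv_kappa_ne_top (p : extSemigroup g φ) : (kappa p.1.map)⁻¹ ≠ ⊤ := by
  obtain ⟨w, rfl⟩ := wordPair_surjective g φ p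
  exact ((S.kappa_inv_le w.1).trans_lt ENNReal.ofReal_lt_top).ne

theorem invKappa_wordPair_le (w : NonemptyWord W) :
    invKappa (wordPair g φ w) ≤ lam ^ w.1.length :=
  ENNReal.toReal_le_of_le_ofReal (pow_nonneg S.hlam0.le _) (S.kappa_inv_le w.1)

omit S [CompactSpace X] in
theorem invKappa_nonneg (p : extSemigroup g φ) : 0 ≤ invKappa p := ENNReal.toReal_nonneg

theorem invKappa_pos (hκ : ∀ p ∈ extSemigroup g φ, kappa p.map ≠ ⊤) (p : extSemigroup g φ) :
    0 < invKappa p :=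
  ENNReal.toReal_pos (ENNReal.inv_ne_zero.2 (hκ p.1 p.2)) (S.inv_kappa_ne_top p)

theorem tendsto_invKappa_iff {u : ℕ → extSemigroup g φ} :
    Tendsto (fun n => invKappa (u n)) atTop (𝓝 0) ↔
      Tendsto (fun n => kappa (u n).1.map) atTop (𝓝 ⊤) := by
  refine (ENNReal.tendsto_toReal_zero_iff fun n => S.inv_kappa_ne_top (u n)).trans ?_
  rw [← ENNReal.inv_top]
  exact tendsto_inv_iff

variable [MeasurableSpace X] [BorelSpace X] [Nonempty X]

/-- The metric space structure on the extended semigroup. -/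
abbrev semigroupMetricSpace (hκ : ∀ p ∈ extSemigroup g φ, kappa p.map ≠ ⊤) :
    MetricSpace (extSemigroup g φ) where
  dist := semigroupDist a lam α g φ
  dist_self p := if_pos rfl
  dist_comm p q := by
    by_cases h : p = q
    · rw [h]
    · rw [semigroupDist, semigroupDist, if_neg h, if_neg (Ne.symm h),
        vaserstein_comm S.ha S.hα0 S.hα1]
      ring
  dist_triangle p q r := by
    have hp := invKappa_nonneg p
    have hq := invKappa_nonneg q
    have hr := invKappa_nonneg r
    have hV := fun p q : extSemigroup g φ => vaserstein_nonneg (lam := lam) (φ := φ)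
      S.ha S.hα0 S.hα1 (eqState g φ p) (eqState g φ q)
    have hpq := hV p q
    have hqr := hV q r
    have ht := vaserstein_triangle (lam := lam) (φ := φ) S.ha S.hα0 S.hα1
      (eqState g φ p) (eqState g φ q) (eqState g φ r)
    simp only [invKappa] at hp hq hr
    by_cases h1 : p = q
    · subst h1
      simp [semigroupDist]
    by_cases h2 : q = r
    · subst h2
      simp [semigroupDist]
    simp only [semigroupDist, if_neg h1, if_neg h2]
    split_ifs with h3 <;> linarith
  eq_of_dist_eq_zero {p q} h := by
    by_contra hpq
    have h' : semigroupDist a lam α g φ p q = 0 := h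
    rw [semigroupDist, if_neg hpq] at h'
    have hp := S.invKappa_pos hκ p
    have hq := S.invKappa_pos hκ q
    simp only [invKappa] at hp hq
    have := vaserstein_nonneg (lam := lam) (φ := φ) S.ha S.hα0 S.hα1 (eqState g φ p)
      (eqState g φ q)
    linarith

theorem vaserstein_le_semigroupDist (p q : extSemigroup g φ) :
    vaserstein a lam α φ (eqState g φ p) (eqState g φ q) ≤ semigroupDist a lam α g φ p q := by
  rw [semigroupDist]
  split_ifs with h
  · rw [h, vaserstein_self S.ha S.hα0 S.hα1]
  · have hp := invKappa_nonneg p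
    have hq := invKappa_nonneg q
    simp only [invKappa] at hp hq
    linarith

theorem semigroupDist_le (p q : extSemigroup g φ) :
    semigroupDist a lam α g φ p q ≤
      vaserstein a lam α φ (eqState g φ p) (eqState g φ q) + invKappa p + invKappa q := by
  rw [semigroupDist]
  split_ifs with h
  · exact add_nonneg (add_nonneg (vaserstein_nonneg S.ha S.hα0 S.hα1 _ _) (invKappa_nonneg p))
      (invKappa_nonneg q)
  · rfl

theorem invKappa_le_semigroupDist {p q : extSemigroup g φ} (h : p ≠ q) :
    invKappa p ≤ semigroupDist a lam α g φ p q := by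
  rw [semigroupDist, if_neg h]
  have hq := invKappa_nonneg q
  simp only [invKappa] at hq ⊢
  have := vaserstein_nonneg (lam := lam) (φ := φ) S.ha S.hα0 S.hα1 (eqState g φ p)
    (eqState g φ q)
  linarith

/-- The map `w ↦ (T_w, φ_w)` is Hölder continuous. -/
theorem exists_semigroupDist_wordPair_le : ∃ C r : ℝ, 0 < C ∧ 0 < r ∧ r ≤ 1 ∧
    ∀ v w : NonemptyWord W, semigroupDist a lam α g φ (wordPair g φ v) (wordPair g φ w) ≤
      C * wordDist v.1 w.1 ^ r := by
  obtain ⟨C, ρ, hC, hρ0, hρ1, -, hst⟩ := S.exists_twoSidedState_estimate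
  have hl0 := S.hlam0
  have hl1 := S.hlam1
  -- A common rate for states and expansion; including `2⁻¹` makes the exponent `r`, defined by
  -- `2^(-r) = τ`, at most 1.
  set τ := max (max ρ lam) 2⁻¹ with hτ
  have hτ0 : 0 < τ := lt_max_of_lt_right (by norm_num)
  have hτ1 : τ < 1 := max_lt (max_lt hρ1 hl1) (by norm_num)
  have hτ2 : (2 : ℝ)⁻¹ ≤ τ := le_max_right _ _
  have hlog2 : 0 < Real.log 2 := Real.log_pos (by norm_num)
  have hr : (2 : ℝ)⁻¹ ^ (-Real.log τ / Real.log 2) = τ := by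
    rw [Real.rpow_def_of_pos (by norm_num), Real.log_inv]
    rw [show -Real.log 2 * (-Real.log τ / Real.log 2) = Real.log τ by field_simp]
    exact Real.exp_log hτ0
  have hr0 : 0 < -Real.log τ / Real.log 2 := div_pos (neg_pos.2 (Real.log_neg hτ0 hτ1)) hlog2
  have hr1 : -Real.log τ / Real.log 2 ≤ 1 := by
    rw [div_le_one hlog2, neg_le, ← Real.log_inv]
    exact Real.log_le_log (by norm_num) hτ2
  set r := -Real.log τ / Real.log 2
  -- `C` for the states and 1 for each of the two terms `1/κ`. The factor 2 pays for the shift: `N`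
  -- common letters on both sides correspond to a distance of at least `2^(-(N+1))`.
  refine ⟨(C + 2) * 2, r, by linarith, hr0, hr1, fun v w => ?_⟩
  by_cases hvw : v = w
  · subst hvw
    rw [wordDist_self, Real.zero_rpow hr0.ne', semigroupDist, if_pos rfl, mul_zero]
  have hne : v.1 ≠ w.1 := fun h => hvw (Subtype.ext h)
  have hf1 := firstDiff_pos v.1 w.1
  have hf2 := firstDiff_pos v.1.reverse w.1.reverse
  obtain ⟨N, hN⟩ : ∃ N, min (firstDiff v.1 w.1) (firstDiff v.1.reverse w.1.reverse) = N + 1 :=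
    ⟨min (firstDiff v.1 w.1) (firstDiff v.1.reverse w.1.reverse) - 1, by omega⟩
  obtain ⟨h1, h2, h3⟩ := (lt_firstDiff_iff v.1 w.1 N).1 (by omega)
  obtain ⟨-, -, h4⟩ := (lt_firstDiff_iff v.1.reverse w.1.reverse N).1 (by omega)
  have hV : vaserstein a lam α φ (eqState g φ (wordPair g φ v)) (eqState g φ (wordPair g φ w)) ≤
      C * ρ ^ N := by
    rw [S.eqState_wordPair, S.eqState_wordPair]
    refine hst _ _ _ _ N ?_ ?_
    · rw [finalWord_leftPeriodic_of_le v h1, finalWord_leftPeriodic_of_le w h2, h4]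
    · rw [initialWord_rightPeriodic_of_le v h1, initialWord_rightPeriodic_of_le w h2, h3]
  have hρτ : ρ ^ N ≤ τ ^ N :=
    pow_le_pow_left₀ hρ0.le ((le_max_left _ _).trans (le_max_left _ _)) N
  have hlτ : lam ^ N ≤ τ ^ N :=
    pow_le_pow_left₀ hl0.le ((le_max_right _ _).trans (le_max_left _ _)) N
  have hk : ∀ x : NonemptyWord W, N ≤ x.1.length → invKappa (wordPair g φ x) ≤ τ ^ N :=
    fun x hx => (S.invKappa_wordPair_le x).trans
      ((pow_le_pow_of_le_one hl0.le hl1.le hx).trans hlτ)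
  have hd : (2 : ℝ)⁻¹ ^ (N + 1) ≤ wordDist v.1 w.1 := by
    rw [wordDist_of_ne hne, ← hN]
    have h5 : (0 : ℝ) < (2 : ℝ)⁻¹ ^ firstDiff v.1 w.1 := by positivity
    have h6 : (0 : ℝ) < (2 : ℝ)⁻¹ ^ firstDiff v.1.reverse w.1.reverse := by positivity
    rcases min_choice (firstDiff v.1 w.1) (firstDiff v.1.reverse w.1.reverse) with h | h <;>
      rw [h] <;> linarith
  have hd' : τ ^ (N + 1) ≤ wordDist v.1 w.1 ^ r := by
    refine le_trans (le_of_eq ?_) (Real.rpow_le_rpow (by positivity) hd hr0.le)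
    rw [← Real.rpow_pow_comm (by norm_num), hr]
  have h7 : τ ^ N ≤ 2 * wordDist v.1 w.1 ^ r := by
    have h8 : τ ^ N * 2⁻¹ ≤ τ ^ (N + 1) := by
      rw [pow_succ]
      exact mul_le_mul_of_nonneg_left hτ2 (by positivity)
    linarith
  have h8 := S.semigroupDist_le (wordPair g φ v) (wordPair g φ w)
  have h9 := hk v h1
  have h10 := hk w h2
  have h11 := mul_le_mul_of_nonneg_left hρτ (zero_le_one.trans hC)
  have h12 := mul_le_mul_of_nonneg_left h7 (show 0 ≤ C + 2 by linarith)
  linarith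

end RuelleSystem

/-! ## Cauchy sequences and the boundary -/

theorem exists_seq_tendsto_coe {Y : Type*} [MetricSpace Y] (z : UniformSpace.Completion Y) :
    ∃ u : ℕ → Y, Tendsto (fun n => (u n : UniformSpace.Completion Y)) atTop (𝓝 z) := by
  obtain ⟨s, hs, hz⟩ := mem_closure_iff_seq_limit.1 (UniformSpace.Completion.denseRange_coe z)
  choose u hu using hs
  exact ⟨u, by simpa only [hu] using hz⟩

theorem cauchySeq_coe_iff {Y : Type*} [MetricSpace Y] {u : ℕ → Y} :
    CauchySeq (fun n => (u n : UniformSpace.Completion Y)) ↔ CauchySeq u := by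
  simp only [Metric.cauchySeq_iff, UniformSpace.Completion.dist_eq]

namespace RuelleSystem

variable {X W : Type*} [MetricSpace X] [CompactSpace X] [MeasurableSpace X] [BorelSpace X]
  [Nonempty X] {g : W → X → X} {φ : X → ℝ} {a lam : ℝ} {α : ℝ≥0}
  [MetricSpace (extSemigroup g φ)] (S : RuelleSystem g φ a lam α)
  (hd : ∀ p q : extSemigroup g φ, dist p q = semigroupDist a lam α g φ p q)
include S hd

theorem vaserstein_le_dist (p q : extSemigroup g φ) :
    vaserstein a lam α φ (eqState g φ p) (eqState g φ q) ≤ dist p q := by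
  rw [hd]
  exact S.vaserstein_le_semigroupDist p q

theorem dist_le (p q : extSemigroup g φ) :
    dist p q ≤ vaserstein a lam α φ (eqState g φ p) (eqState g φ q) + invKappa p + invKappa q := by
  rw [hd]
  exact S.semigroupDist_le p q

theorem discreteTopology (hκ : ∀ p ∈ extSemigroup g φ, kappa p.map ≠ ⊤) :
    DiscreteTopology (extSemigroup g φ) :=
  discreteTopology_of_forall_le_dist (S.invKappa_pos hκ) fun p q h => by
    rw [hd]
    exact S.invKappa_le_semigroupDist h

/-- Each late term differs from another late term, and their distance is at least `1/κ` of the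
former. -/
theorem tendsto_invKappa_of_cauchySeq {u : ℕ → extSemigroup g φ} (hu : CauchySeq u)
    (hne : ¬ EventuallyConst u) : Tendsto (fun n => invKappa (u n)) atTop (𝓝 0) := by
  refine Metric.tendsto_atTop.2 fun ε hε => ?_
  obtain ⟨N, hN⟩ := Metric.cauchySeq_iff.1 hu ε hε
  refine ⟨N, fun n hn => ?_⟩
  rw [dist_zero_right, Real.norm_of_nonneg (invKappa_nonneg _)]
  obtain ⟨m, hm, hmn⟩ : ∃ m ≥ N, u n ≠ u m := by
    by_contra! h
    exact hne ⟨u n, (eventually_ge_atTop N).mono fun m hm => (h m hm).symm⟩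
  refine lt_of_le_of_lt ?_ (hN n hn m hm)
  rw [hd]
  exact S.invKappa_le_semigroupDist hmn

theorem exists_tendsto_eqState {u : ℕ → extSemigroup g φ} (hu : CauchySeq u) :
    ∃ μ, Tendsto (fun n => eqState g φ (u n)) atTop (𝓝 μ) := by
  refine exists_tendsto_of_cauchy_vaserstein S.ha S.hα0 S.hα1 (lam := lam) (φ := φ)
    fun ε hε => ?_
  obtain ⟨N, hN⟩ := Metric.cauchySeq_iff.1 hu ε hε
  exact ⟨N, fun m hm n hn => (S.vaserstein_le_dist hd _ _).trans_lt (hN m hm n hn)⟩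

/-- The filter `l` is left free: the full product gives the Cauchy property, the diagonal gives
equality of limits. -/
theorem tendsto_dist_of_tendsto_eqState {u v : ℕ → extSemigroup g φ} {μ : ProbabilityMeasure X}
    {l : Filter (ℕ × ℕ)} (hl : l ≤ atTop ×ˢ atTop)
    (hu : Tendsto (fun n => eqState g φ (u n)) atTop (𝓝 μ))
    (hv : Tendsto (fun n => eqState g φ (v n)) atTop (𝓝 μ))
    (hu' : Tendsto (fun n => invKappa (u n)) atTop (𝓝 0))
    (hv' : Tendsto (fun n => invKappa (v n)) atTop (𝓝 0)) :
    Tendsto (fun mn : ℕ × ℕ => dist (u mn.1) (v mn.2)) l (𝓝 0) := by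
  have h1 := tendsto_vaserstein (lam := lam) (φ := φ) S.ha S.hα0 S.hα1 hu
  have h2 := tendsto_vaserstein (lam := lam) (φ := φ) S.ha S.hα0 S.hα1 hv
  have hf : Tendsto (Prod.fst : ℕ × ℕ → ℕ) l atTop := tendsto_fst.mono_left hl
  have hs : Tendsto (Prod.snd : ℕ × ℕ → ℕ) l atTop := tendsto_snd.mono_left hl
  have h3 := (((h1.comp hf).add (h2.comp hs)).add (hu'.comp hf)).add (hv'.comp hs)
  simp only [add_zero] at h3
  refine squeeze_zero (fun _ => dist_nonneg) (fun mn => ?_) h3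
  have h4 := S.dist_le hd (u mn.1) (v mn.2)
  have h5 := vaserstein_triangle (lam := lam) (φ := φ) S.ha S.hα0 S.hα1
    (eqState g φ (u mn.1)) μ (eqState g φ (v mn.2))
  rw [vaserstein_comm S.ha S.hα0 S.hα1 μ] at h5
  simp only [Function.comp_apply]
  linarith

theorem cauchySeq_of_tendsto_eqState {u : ℕ → extSemigroup g φ} {μ : ProbabilityMeasure X}
    (hu : Tendsto (fun n => eqState g φ (u n)) atTop (𝓝 μ))
    (hu' : Tendsto (fun n => invKappa (u n)) atTop (𝓝 0)) : CauchySeq u := by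
  rw [cauchySeq_iff_tendsto_dist_atTop_0, ← prod_atTop_atTop_eq]
  exact S.tendsto_dist_of_tendsto_eqState hd le_rfl hu hu hu' hu'

theorem cauchySeq_iff (u : ℕ → extSemigroup g φ) : CauchySeq u ↔
    EventuallyConst u ∨ (Tendsto (fun n => kappa (u n).1.map) atTop (𝓝 ⊤) ∧
      ∃ μ : ProbabilityMeasure X, Tendsto (fun n => eqState g φ (u n)) atTop (𝓝 μ)) := by
  constructor
  · intro hu
    by_cases h : EventuallyConst u
    · exact Or.inl h
    · exact Or.inr ⟨S.tendsto_invKappa_iff.1 (S.tendsto_invKappa_of_cauchySeq hd hu h),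
        S.exists_tendsto_eqState hd hu⟩
  · rintro (⟨y, hy⟩ | ⟨h, μ, hμ⟩)
    · exact (tendsto_nhds_of_eventually_eq hy).cauchySeq
    · exact S.cauchySeq_of_tendsto_eqState hd hμ (S.tendsto_invKappa_iff.2 h)

/-- Makes the boundary map independent of the approximating sequence, as the Wasserstein distance is
at most the semigroup distance. -/
theorem tendsto_eqState_of_tendsto {z : UniformSpace.Completion (extSemigroup g φ)}
    {u v : ℕ → extSemigroup g φ} {μ : ProbabilityMeasure X}
    (hu : Tendsto (fun n => (u n : UniformSpace.Completion (extSemigroup g φ))) atTop (𝓝 z))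
    (hv : Tendsto (fun n => (v n : UniformSpace.Completion (extSemigroup g φ))) atTop (𝓝 z))
    (hμ : Tendsto (fun n => eqState g φ (u n)) atTop (𝓝 μ)) :
    Tendsto (fun n => eqState g φ (v n)) atTop (𝓝 μ) := by
  have h1 := hv.dist hu
  simp only [dist_self, UniformSpace.Completion.dist_eq] at h1
  have h2 := h1.add (tendsto_vaserstein (lam := lam) (φ := φ) S.ha S.hα0 S.hα1 hμ)
  rw [add_zero] at h2
  refine tendsto_of_vaserstein (lam := lam) (φ := φ) S.ha S.hα0 S.hα1
    (squeeze_zero (fun n => vaserstein_nonneg S.ha S.hα0 S.hα1 _ _) (fun n => ?_) h2)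
  exact (vaserstein_triangle S.ha S.hα0 S.hα1 _ (eqState g φ (u n)) _).trans
    (add_le_add_left (S.vaserstein_le_dist hd _ _) _)

theorem same_limit_iff {u v : ℕ → extSemigroup g φ} (hu : CauchySeq u) (hv : CauchySeq v)
    (hu' : ¬ EventuallyConst u) (hv' : ¬ EventuallyConst v) :
    (∃ z : UniformSpace.Completion (extSemigroup g φ),
      Tendsto (fun n => (u n : UniformSpace.Completion (extSemigroup g φ))) atTop (𝓝 z) ∧
      Tendsto (fun n => (v n : UniformSpace.Completion (extSemigroup g φ))) atTop (𝓝 z)) ↔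
    ∃ μ : ProbabilityMeasure X, Tendsto (fun n => eqState g φ (u n)) atTop (𝓝 μ) ∧
      Tendsto (fun n => eqState g φ (v n)) atTop (𝓝 μ) := by
  constructor
  · rintro ⟨z, hzu, hzv⟩
    obtain ⟨μ, hμ⟩ := S.exists_tendsto_eqState hd hu
    exact ⟨μ, hμ, S.tendsto_eqState_of_tendsto hd hzu hzv hμ⟩
  · rintro ⟨μ, hμu, hμv⟩
    obtain ⟨z, hz⟩ := cauchySeq_tendsto_of_complete
      (cauchySeq_coe_iff.2 hu)
    refine ⟨z, hz, ?_⟩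
    have h1 := S.tendsto_dist_of_tendsto_eqState hd (l := map (fun n : ℕ => (n, n)) atTop)
      (tendsto_id.prodMk tendsto_id) hμu hμv
      (S.tendsto_invKappa_of_cauchySeq hd hu hu') (S.tendsto_invKappa_of_cauchySeq hd hv hv')
    have h2 : Tendsto (fun n => dist (u n) (v n)) atTop (𝓝 0) := h1
    refine hz.congr_dist (h2.congr fun n => ?_)
    exact (UniformSpace.Completion.dist_eq _ _).symm

theorem exists_boundary_limit (z : UniformSpace.Completion (extSemigroup g φ)) :
    ∃ μ : ProbabilityMeasure X, ∀ u : ℕ → extSemigroup g φ,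
      Tendsto (fun n => (u n : UniformSpace.Completion (extSemigroup g φ))) atTop (𝓝 z) →
        Tendsto (fun n => eqState g φ (u n)) atTop (𝓝 μ) := by
  obtain ⟨u, hu⟩ := exists_seq_tendsto_coe z
  obtain ⟨μ, hμ⟩ := S.exists_tendsto_eqState hd (cauchySeq_coe_iff.1 hu.cauchySeq)
  exact ⟨μ, fun v hv => S.tendsto_eqState_of_tendsto hd hu hv hμ⟩

/-! ### The image of the boundary and the Lipschitz bound. -/

omit hd [MetricSpace (extSemigroup g φ)] in
/-- The set of the measures `μ_{σ,ω}` is sequentially closed. -/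
theorem exists_eq_twoSidedState_of_tendsto [Finite W] {σ ω : ℕ → ℕ → W} {μ : ProbabilityMeasure X}
    (h : Tendsto (fun n => twoSidedState g φ (σ n) (ω n)) atTop (𝓝 μ)) :
    ∃ σ' ω' : ℕ → W, μ = twoSidedState g φ σ' ω' := by
  obtain ⟨C, ρ, hC, hρ0, hρ1, -, hst⟩ := S.exists_twoSidedState_estimate
  let U : Ultrafilter ℕ := Ultrafilter.of atTop
  have hlim : ∀ τ : ℕ → ℕ → W, ∃ τ' : ℕ → W, ∀ i, ∀ᶠ n in (U : Filter ℕ), τ n i = τ' i := by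
    intro τ
    have h1 : ∀ i, ∃ c, ∀ᶠ n in (U : Filter ℕ), τ n i = c := fun i => by
      -- Over a finite alphabet each letter is constant along the ultrafilter, which gives a limit
      -- word.
      obtain ⟨c, hc⟩ := Ultrafilter.eq_pure_of_finite (U.map fun n => τ n i)
      refine ⟨c, ?_⟩
      have h2 : {c} ∈ U.map fun n => τ n i := by
        rw [hc]
        exact mem_pure.2 rfl
      exact h2
    choose τ' hτ' using h1
    exact ⟨τ', hτ'⟩
  obtain ⟨σ', hσ'⟩ := hlim σ
  obtain ⟨ω', hω'⟩ := hlim ω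
  refine ⟨σ', ω', tendsto_nhds_unique (h.mono_left (Ultrafilter.of_le atTop)) ?_⟩
  refine tendsto_of_vaserstein (lam := lam) (φ := φ) S.ha S.hα0 S.hα1
    (Metric.tendsto_nhds.2 fun ε hε => ?_)
  have hpow : Tendsto (fun N => C * ρ ^ N) atTop (𝓝 0) := by
    simpa using (tendsto_pow_atTop_nhds_zero_of_lt_one hρ0.le hρ1).const_mul C
  obtain ⟨N, hN⟩ := (hpow.eventually (gt_mem_nhds hε)).exists
  have hev : ∀ (τ : ℕ → ℕ → W) (τ' : ℕ → W), (∀ i, ∀ᶠ n in (U : Filter ℕ), τ n i = τ' i) →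
      ∀ᶠ n in (U : Filter ℕ), initialWord (τ n) N = initialWord τ' N := by
    intro τ τ' hτ
    have h1 : ∀ᶠ n in (U : Filter ℕ), ∀ i ∈ Finset.range N, τ n i = τ' i :=
      (Finset.range N).eventually_all.2 fun i _ => hτ i
    filter_upwards [h1] with n hn
    exact List.map_congr_left fun i hi => hn i (by simpa using hi)
  filter_upwards [hev σ σ' hσ', hev ω ω' hω'] with n h1 h2
  rw [dist_zero_right, Real.norm_of_nonneg (vaserstein_nonneg S.ha S.hα0 S.hα1 _ _)]
  refine (hst _ _ _ _ N ?_ h2).trans_lt hN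
  rw [finalWord_eq_reverse, finalWord_eq_reverse, h1]

/-- Every measure `μ_{σ,ω}` is the limit of the equilibrium states along a sequence that converges
to a boundary point. -/
theorem exists_boundary_seq (hκ : ∀ p ∈ extSemigroup g φ, kappa p.map ≠ ⊤) (σ ω : ℕ → W) :
    ∃ (z : boundary (extSemigroup g φ)) (u : ℕ → extSemigroup g φ),
      Tendsto (fun n => (u n : UniformSpace.Completion (extSemigroup g φ))) atTop (𝓝 z.1) ∧
      Tendsto (fun n => eqState g φ (u n)) atTop (𝓝 (twoSidedState g φ σ ω)) := by
  obtain ⟨C, ρ, hC, hρ0, hρ1, -, hst⟩ := S.exists_twoSidedState_estimate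
  -- The right-periodic word of `w n` begins like `ω` and the left-periodic one ends like `σ`, each
  -- for `n + 1` letters; the shift keeps the word nonempty.
  let w : ℕ → NonemptyWord W := fun n =>
    ⟨initialWord ω (n + 1) ++ finalWord σ (n + 1), fun h => by
      have := congrArg List.length h
      rw [List.length_append, initialWord_length] at this
      simp at this⟩
  have hlen : ∀ n, (w n).1.length = n + 1 + (n + 1) := fun n => by
    simp only [w, List.length_append, initialWord_length, finalWord_length]
  let u : ℕ → extSemigroup g φ := fun n => wordPair g φ (w n)
  have hinv : Tendsto (fun n => invKappa (u n)) atTop (𝓝 0) := by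
    refine squeeze_zero (fun n => invKappa_nonneg _) (fun n => ?_)
      (tendsto_pow_atTop_nhds_zero_of_lt_one S.hlam0.le S.hlam1)
    refine (S.invKappa_wordPair_le (w n)).trans
      (pow_le_pow_of_le_one S.hlam0.le S.hlam1.le ?_)
    rw [hlen]
    omega
  have hstate : Tendsto (fun n => eqState g φ (u n)) atTop (𝓝 (twoSidedState g φ σ ω)) := by
    have hpow : Tendsto (fun N => C * ρ ^ (N + 1)) atTop (𝓝 0) := by
      simpa using ((tendsto_pow_atTop_nhds_zero_of_lt_one hρ0.le hρ1).comp
        (tendsto_add_atTop_nat 1)).const_mul C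
    refine tendsto_of_vaserstein (lam := lam) (φ := φ) S.ha S.hα0 S.hα1
      (squeeze_zero (fun n => vaserstein_nonneg S.ha S.hα0 S.hα1 _ _) (fun n => ?_) hpow)
    rw [S.eqState_wordPair]
    refine hst _ _ _ _ (n + 1) ?_ ?_
    · rw [finalWord_leftPeriodic_of_le _ (by rw [hlen]; omega)]
      simp only [w, List.reverse_append]
      rw [List.take_left' (by rw [List.length_reverse, finalWord_length]), List.reverse_reverse]
    · rw [initialWord_rightPeriodic_of_le _ (by rw [hlen]; omega)]
      exact List.take_left' (initialWord_length _ _)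
  obtain ⟨z, hz⟩ := cauchySeq_tendsto_of_complete
    (cauchySeq_coe_iff.2
    (S.cauchySeq_of_tendsto_eqState hd hstate hinv))
  refine ⟨⟨z, ?_⟩, u, hz, hstate⟩
  -- A limit `y` in the discrete semigroup would be attained eventually, contradicting `1/κ → 0` and
  -- `1/κ > 0` at `y`.
  rintro ⟨y, rfl⟩
  have h1 : Tendsto u atTop (𝓝 y) :=
    (UniformSpace.Completion.coe_isometry.isUniformInducing.isInducing.tendsto_nhds_iff).2 hz
  have := S.discreteTopology hd hκ
  rw [nhds_discrete, tendsto_pure] at h1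
  have h2 : Tendsto (fun n => invKappa (u n)) atTop (𝓝 (invKappa y)) :=
    tendsto_nhds_of_eventually_eq (h1.mono fun n hn => by rw [hn])
  exact (S.invKappa_pos hκ y).ne' (tendsto_nhds_unique h2 hinv)

/-- The inequality between the two distances passes to the limit, so the Lipschitz constant is 1. -/
theorem vaserstein_boundary_le {z z' : UniformSpace.Completion (extSemigroup g φ)}
    {u u' : ℕ → extSemigroup g φ} {μ μ' : ProbabilityMeasure X}
    (hu : Tendsto (fun n => (u n : UniformSpace.Completion (extSemigroup g φ))) atTop (𝓝 z))
    (hu' : Tendsto (fun n => (u' n : UniformSpace.Completion (extSemigroup g φ))) atTop (𝓝 z'))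
    (hμ : Tendsto (fun n => eqState g φ (u n)) atTop (𝓝 μ))
    (hμ' : Tendsto (fun n => eqState g φ (u' n)) atTop (𝓝 μ')) :
    vaserstein a lam α φ μ μ' ≤ dist z z' := by
  have h1 := tendsto_vaserstein (lam := lam) (φ := φ) S.ha S.hα0 S.hα1 hμ
  have h2 := tendsto_vaserstein (lam := lam) (φ := φ) S.ha S.hα0 S.hα1 hμ'
  have h3 := (h1.add (hu.dist hu')).add h2
  rw [zero_add, add_zero] at h3
  refine ge_of_tendsto' h3 fun n => ?_
  rw [UniformSpace.Completion.dist_eq]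
  have h4 := vaserstein_triangle (lam := lam) (φ := φ) S.ha S.hα0 S.hα1 μ (eqState g φ (u n)) μ'
  have h5 := vaserstein_triangle (lam := lam) (φ := φ) S.ha S.hα0 S.hα1 (eqState g φ (u n))
    (eqState g φ (u' n)) μ'
  have h6 := S.vaserstein_le_dist hd (u n) (u' n)
  rw [vaserstein_comm S.ha S.hα0 S.hα1 μ (eqState g φ (u n))] at h4
  linarith

theorem exists_boundary_map [Finite W] (hκ : ∀ p ∈ extSemigroup g φ, kappa p.map ≠ ⊤) :
    ∃ F : boundary (extSemigroup g φ) → ProbabilityMeasure X,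
      (∀ (z : boundary (extSemigroup g φ)) (u : ℕ → extSemigroup g φ),
        Tendsto (fun n => (u n : UniformSpace.Completion (extSemigroup g φ))) atTop (𝓝 z.1) →
          Tendsto (fun n => eqState g φ (u n)) atTop (𝓝 (F z))) ∧
      range F = {μ | ∃ σ ω : ℕ → W, μ = twoSidedState g φ σ ω} ∧
      ∃ K : ℝ≥0, ∀ z z' : boundary (extSemigroup g φ),
        vaserstein a lam α φ (F z) (F z') ≤ K * dist z z' := by
  choose F hF using fun z : boundary (extSemigroup g φ) => S.exists_boundary_limit hd z.1
  refine ⟨F, hF, Subset.antisymm ?_ ?_, 1, fun z z' => ?_⟩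
  · rintro _ ⟨z, rfl⟩
    obtain ⟨u, hu⟩ := exists_seq_tendsto_coe z.1
    exact S.exists_eq_twoSidedState_of_tendsto (hF z u hu)
  · rintro _ ⟨σ, ω, rfl⟩
    obtain ⟨z, u, hu, hs⟩ := S.exists_boundary_seq hd hκ σ ω
    exact ⟨z, tendsto_nhds_unique (hF z u hu) hs⟩
  · obtain ⟨u, hu⟩ := exists_seq_tendsto_coe z.1
    obtain ⟨u', hu'⟩ := exists_seq_tendsto_coe z'.1
    rw [NNReal.coe_one, one_mul]
    exact S.vaserstein_boundary_le hd hu hu' (hF z u hu) (hF z' u' hu')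

end RuelleSystem

/-- Hölder continuity in terms of real-valued distances. -/
theorem holderWith_of_dist_le {Y Z : Type*} [PseudoMetricSpace Y] [PseudoMetricSpace Z]
    {f : Y → Z} {C r : ℝ≥0} (h : ∀ x y, dist (f x) (f y) ≤ C * dist x y ^ (r : ℝ)) :
    HolderWith C r f := fun x y => by
  rw [edist_dist, edist_dist, ENNReal.ofReal_rpow_of_nonneg dist_nonneg r.coe_nonneg,
    ← ENNReal.ofReal_coe_nnreal, ← ENNReal.ofReal_mul C.coe_nonneg]
  exact ENNReal.ofReal_le_ofReal (h x y)

end RuelleBoundary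

end

theorem mainTheorem9 {X W : Type*} [MetricSpace X] [CompactSpace X] [Nonempty X]
    [MeasurableSpace X] [BorelSpace X] [Finite W]
    (g : W → X → X) (φ : X → ℝ) (a lam : ℝ) (α : ℝ≥0)
    (ha : 0 < a) (hlam0 : 0 < lam) (hlam1 : lam < 1) (hα0 : 0 < α) (hα1 : α ≤ 1)
    (hcont : ∀ i, Continuous (g i)) (hsurj : ∀ i, Function.Surjective (g i))
    (hexp : ∀ i, IsRuelleExpanding a lam (g i)) (hmix : JointlyMixing g)
    (hφ : MemHolder α φ)
    (hκ : ∀ p ∈ extSemigroup g φ, kappa p.map ≠ ⊤) :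
    -- the measures `μ_{σ,ω}` and `μ_{g,ψ}` are well defined
    (∀ σ ω : ℕ → W, IsTwoSidedLimit g φ σ ω (twoSidedState g φ σ ω)) ∧
    (∀ w : NonemptyWord W,
      eqState g φ (wordPair g φ w) = twoSidedState g φ (leftPeriodic w) (rightPeriodic w)) ∧
    -- both distances are metrics, and both metric spaces are discrete
    ∃ (_ : MetricSpace (List W)) (_ : MetricSpace (extSemigroup g φ)),
      (∀ v w : List W, dist v w = wordDist v w) ∧ DiscreteTopology (List W) ∧
      (∀ p q : extSemigroup g φ, dist p q = semigroupDist a lam α g φ p q) ∧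
      DiscreteTopology (extSemigroup g φ) ∧
      -- Hölder continuity of `w ↦ (T_w, φ_w)`
      (∃ C r : ℝ≥0, 0 < r ∧ r ≤ 1 ∧ HolderWith C r (wordPair g φ)) ∧
      -- Cauchy sequences
      (∀ u : ℕ → extSemigroup g φ, CauchySeq u ↔
        EventuallyConst u ∨
          (Tendsto (fun n => kappa (u n).1.map) atTop (𝓝 ⊤) ∧
            ∃ μ : ProbabilityMeasure X, Tendsto (fun n => eqState g φ (u n)) atTop (𝓝 μ))) ∧
      -- Cauchy sequences with the same limit
      (∀ u v : ℕ → extSemigroup g φ, CauchySeq u → CauchySeq v →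
        ¬ EventuallyConst u → ¬ EventuallyConst v →
        ((∃ z : UniformSpace.Completion (extSemigroup g φ),
            Tendsto (fun n => (u n : UniformSpace.Completion (extSemigroup g φ))) atTop (𝓝 z) ∧
            Tendsto (fun n => (v n : UniformSpace.Completion (extSemigroup g φ))) atTop (𝓝 z)) ↔
          ∃ μ : ProbabilityMeasure X,
            Tendsto (fun n => eqState g φ (u n)) atTop (𝓝 μ) ∧
            Tendsto (fun n => eqState g φ (v n)) atTop (𝓝 μ))) ∧
      -- the boundary map
      ∃ F : boundary (extSemigroup g φ) → ProbabilityMeasure X,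
        (∀ (z : boundary (extSemigroup g φ)) (u : ℕ → extSemigroup g φ),
          Tendsto (fun n => (u n : UniformSpace.Completion (extSemigroup g φ))) atTop (𝓝 z.1) →
            Tendsto (fun n => eqState g φ (u n)) atTop (𝓝 (F z))) ∧
        range F = {μ | ∃ σ ω : ℕ → W, μ = twoSidedState g φ σ ω} ∧
        ∃ K : ℝ≥0, ∀ z z' : boundary (extSemigroup g φ),
          vaserstein a lam α φ (F z) (F z') ≤ K * dist z z' := by
  have S : RuelleSystem g φ a lam α :=
    ⟨ha, hlam0, hlam1, hα0, hα1, hcont, hsurj, hexp, hmix, hφ⟩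
  obtain ⟨-, -, -, -, -, hlim, -⟩ := S.exists_twoSidedState_estimate
  obtain ⟨C, r, hC, hr0, hr1, hhol⟩ := S.exists_semigroupDist_wordPair_le
  let m1 : MetricSpace (List W) := wordMetricSpace W
  let m2 : MetricSpace (extSemigroup g φ) := S.semigroupMetricSpace hκ
  have hd : ∀ p q : extSemigroup g φ, dist p q = semigroupDist a lam α g φ p q := fun _ _ => rfl
  refine ⟨hlim, S.eqState_wordPair, m1, m2, fun _ _ => rfl, ?_, hd, S.discreteTopology hd hκ,
    ⟨⟨C, hC.le⟩, ⟨r, hr0.le⟩, hr0, hr1, holderWith_of_dist_le hhol⟩, S.cauchySeq_iff hd,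
    fun u v hu hv hu' hv' => S.same_limit_iff hd hu hv hu' hv', S.exists_boundary_map hd hκ⟩
  exact discreteTopology_of_forall_le_dist (r := fun v : List W => (2 : ℝ)⁻¹ ^ (v.length + 1))
    (fun v => by positivity) fun v w h => half_pow_length_le_wordDist h
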